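/- **Setting.** Let $G$ be a simple graph on $V=\{1,\dots,n\}$ with $m$ edges and arboricity (least number of forests covering the edges) at most $\alpha$; let $k\ge 2$ and let $n_k$ be the number of $k$-cliques of $G$. An ordered $t$-clique is a $t$-tuple of pairwise adjacent vertices. For an ordered clique $\vec T$ let $u(\vec T)$ be its vertex of least degree (ties broken by id), $d(\vec T)=\deg u(\vec T)$, and for a multiset $R$ of ordered cliques let $d(R)=\sum_{\vec T\in R}d(\vec T)$. Let $\mathcal A$ be a set of (active) ordered cliques; an ordered clique is *fully active* if all its nonempty prefixes (itself included) are in $\mathcal A$. A $k$-clique $C$ is *assigned* to the lexicographically first fully active ordering of $C$, if there is one, and to all nonempty prefixes of it. The weight $\omega(\vec T)$ is the number of $k$-cliques assigned to $\vec T$, and $\omega(V)=\sum_{v\in V}\omega(v)$. Given $\vec\tau=(\tau_1,\dots,\tau_k)$, $\tau_t\ge 0$, the set $\mathcal A$ is *$\vec\tau$-bounded* if $\omega(\vec T)\le\tau_t$ for all $t\in[k]$ and all ordered $t$-cliques $\vec T$; it is *$(\varepsilon,\vec\tau)$-good* if moreover $\omega(V)\ge(1-\varepsilon/2)n_k$.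 **Algorithm Approx.** Input: $n,k,\alpha$, $\varepsilon,\delta\in(0,1)$, $\tilde m\ge 0$, $\tilde n_k>0$, $\vec\tau$; access to $G$ by degree, neighbor and pair queries, and an oracle telling whether an ordered clique is in $\mathcal A$. Put $\beta=\delta/(3k)$, $\gamma=\varepsilon/(2k)$, $K=3\ln(2/\beta)/\gamma^2$, $d(R_0)=n$, $\tilde\omega_0=(1-\varepsilon/2)\tilde n_k$ (and $x/0:=0$). 1. Let $R_1$ consist of $s_1=\lceil n\tau_1K/\tilde\omega_0\rceil$ independent uniform vertices. 2. For $t=1,\dots,k-1$: compute $d(R_t)$; let $\tilde\omega_t=(1-\gamma)\frac{\tilde\omega_{t-1}}{d(R_{t-1})}s_t$ and $s_{t+1}=\lceil d(R_t)\tau_{t+1}K/\tilde\omega_t\rceil$; abort if $s_{t+1}>\frac{4\tilde m\alpha^{t-1}\tau_{t+1}}{\tilde n_k}\cdot\frac{(k!)^2K}{\beta^t}$. Otherwise, $s_{t+1}$ times independently, choose $\vec T\in R_t$ with probability $d(\vec T)/d(R_t)$ and a uniform neighbor $v$ of $u(\vec T)$, and put $(\vec T,v)$ into $R_{t+1}$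 if it is an ordered clique. 3. Abort if $|R_k|>\frac{(k!)^2}{\beta^k}\cdot\frac{n_k\tau_k}{\tilde n_k}\cdot 4K$. 4. Return $\hat n_k=\frac{n\,d(R_1)\cdots d(R_{k-1})}{s_1\cdots s_k}\cdot\#\{\vec C\in R_k:\omega(\vec C)=1\}$ (with multiplicity), where $\omega(\vec C)$ is found by calling the oracle on all nonempty prefixes of all $k!$ orderings of $\vec C$. Let $\text{Approx}^{+}$ be the same algorithm with the thresholds in both abort tests rounded up to integers. Queries, oracle calls, uniform draws and elementary operations have the obvious costs (a query or a uniform draw is one step, an oracle call has its own cost); drawing $s$ samples from $r$ weighted items takes $r+s$ steps. **Theorem.** 1. If $\mathcal A$ is $(\varepsilon,\vec\tau)$-good, $\tilde m\ge m/2$ and $\tilde n_k\le n_k$, then, with probability at least $1-\delta$, Approx returns (without aborting) a value $\hat n_k\in[(1-\varepsilon)n_k,(1+\varepsilon)n_k]$. The same holds for $\text{Approx}^{+}$. 2. If $\mathcal A$ is $\vec\tau$-bounded, $\tilde m\ge m/2$ and $\tilde n_k>n_k$, then, with probability at least $1-\delta$, $\text{Approx}^{+}$ returns (without aborting) a value $\hat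 n_k\le(1+\varepsilon)\tilde n_k$; and with probability at least $1-\delta$, Approx either aborts or returns a value $\hat n_k\le(1+\varepsilon)\tilde n_k$. 3. Suppose that each oracle call takes at most $\rho$ steps ($\rho\ge 1$) and makes at most $q$ queries. For an exponent $e$ and a cost $x$ let $$B_e(x)=\Bigl(\frac{n\tau_1}{\tilde n_k}+\frac{k^{3k}}{\delta^{2k}}\cdot\frac{\tilde m}{\tilde n_k}\sum_{t=2}^{k}\alpha^{t-2}\tau_t+\frac{k^{ek}}{\delta^{k}}\cdot\frac{n_k}{\tilde n_k}\,\tau_k\,x\Bigr)\cdot\frac{3^k\ln(k/\delta)}{\varepsilon^2}+\bigl(k^2+k\cdot k!\cdot x\bigr).$$ With an absolute implied constant, for both Approx and $\text{Approx}^{+}$ and with no further assumption on $\mathcal A,\tilde m,\tilde n_k$: the expected running time is $O(B_3(\rho))$ and the expected number of queries is $O(B_3(q))$; on every run, the running time is $O(B_4(\rho))$ and the number of queries is $O(B_4(q))$. -/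

import Mathlib

open scoped ENNReal Nat

noncomputable section

namespace CliqueApprox

/-! ### Query access to a graph, randomized query algorithms, cost -/

/-- What an algorithm can query: a simple graph on the vertex set `Fin n` (the ids of the vertices)
given by adjacency lists in an arbitrary order, and an oracle for a set `A` of active ordered
cliques.  An oracle call on `T` takes `oracleTime T` steps and `oracleQueries T` graph queries. -/
structure Instance (n : ℕ) where
  G : SimpleGraph (Fin n)
  adj : Fin n → List (Fin n)
  adj_nodup : ∀ v, (adj v).Nodup
  mem_adj : ∀ v w, w ∈ adj v ↔ G.Adj v w
  A : Set (List (Fin n))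
  oracleTime : List (Fin n) → ℕ
  oracleQueries : List (Fin n) → ℕ

/-- Randomized algorithms with output in `α` that access an instance on `n` vertices only through
queries.  They may also abort. -/
inductive Prog (n : ℕ) (α : Type) : Type
  /-- return a value -/
  | ret (a : α) : Prog n α
  /-- abort without a value -/
  | abort : Prog n α
  /-- perform `c` elementary steps (real arithmetic, comparisons, bookkeeping) -/
  | tick (c : ℕ) (p : Prog n α) : Prog n α
  /-- degree query -/
  | deg (v : Fin n) (f : ℕ → Prog n α) : Prog n α
  /-- neighbor query: the `i`-th neighbor of `v` (counted from zero), if there is one -/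
  | nbr (v : Fin n) (i : ℕ) (f : Option (Fin n) → Prog n α) : Prog n α
  /-- pair query: are `u` and `v` adjacent? -/
  | pair (u v : Fin n) (f : Bool → Prog n α) : Prog n α
  /-- oracle call: is `T` active? -/
  | oracle (T : List (Fin n)) (f : Bool → Prog n α) : Prog n α
  /-- draw a uniform element of `{0, …, m - 1}` -/
  | unif (m : ℕ) (f : Fin m → Prog n α) : Prog n α
  /-- draw `s` independent elements of `{0, …, m - 1}`, each equal to `i` with probability
  proportional to `w i` -/
  | draws {m : ℕ} (w : Fin m → ℕ) (s : ℕ) (f : List (Fin m) → Prog n α) : Prog n α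

/-- Sequential composition. -/
def Prog.bind {n : ℕ} {α β : Type} : Prog n α → (α → Prog n β) → Prog n β
  | .ret a, g => g a
  | .abort, _ => .abort
  | .tick c p, g => .tick c (p.bind g)
  | .deg v f, g => .deg v fun d => (f d).bind g
  | .nbr v i f, g => .nbr v i fun w => (f w).bind g
  | .pair u v f, g => .pair u v fun b => (f b).bind g
  | .oracle T f, g => .oracle T fun b => (f b).bind g
  | .unif m f, g => .unif m fun i => (f i).bind g
  | .draws w s f, g => .draws w s fun l => (f l).bind g

instance (n : ℕ) : Monad (Prog n) where
  pure := Prog.ret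
  bind := Prog.bind

/-- Result of a run: the returned value (`none` if the run aborted), the number of steps and the
number of graph queries, where those made by the oracle are included in both. -/
structure Outcome (α : Type) where
  value : Option α
  time : ℕ
  queries : ℕ

/-- Add `t` steps and `q` queries to the cost of a run. -/
def Outcome.charge {α : Type} (t q : ℕ) (o : Outcome α) : Outcome α :=
  ⟨o.value, o.time + t, o.queries + q⟩

theorem tsum_weights_ne_top {m : ℕ} (w : Fin m → ℕ) : ∑' i, (w i : ℝ≥0∞) ≠ ∞ := by
  rw [tsum_fintype]
  exact ENNReal.sum_ne_top.2 fun i _ => ENNReal.natCast_ne_top (w i)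

/-- The law that gives `i` probability `w i / ∑ j, w j`. -/
def weighted {m : ℕ} (w : Fin m → ℕ) (h : ∑' i, (w i : ℝ≥0∞) ≠ 0) : PMF (Fin m) :=
  PMF.normalize (fun i => (w i : ℝ≥0∞)) h (tsum_weights_ne_top w)

/-- The law of a list of `s` independent samples from `μ`. -/
def iidList {β : Type} (μ : PMF β) : ℕ → PMF (List β)
  | 0 => PMF.pure []
  | s + 1 => μ.bind fun b => (iidList μ s).map fun l => b :: l

open Classical in
/-- The law of the outcome of a run on the instance `I`.  Queries and uniform draws take one step.
A batch of `s` weighted samples from `m` items takes `m + s` steps (a sampling structure that is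
built in linear time and then takes constant time per sample).  Drawing from an empty range or from
weights that are all zero is an abort. -/
def Prog.run {n : ℕ} (I : Instance n) {α : Type} : Prog n α → PMF (Outcome α)
  | .ret a => PMF.pure ⟨some a, 0, 0⟩
  | .abort => PMF.pure ⟨none, 0, 0⟩
  | .tick c p => (p.run I).map (Outcome.charge c 0)
  | .deg v f => ((f (I.adj v).length).run I).map (Outcome.charge 1 1)
  | .nbr v i f => ((f (I.adj v)[i]?).run I).map (Outcome.charge 1 1)
  | .pair u v f => ((f (decide (I.G.Adj u v))).run I).map (Outcome.charge 1 1)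
  | .oracle T f => ((f (decide (T ∈ I.A))).run I).map
      (Outcome.charge (I.oracleTime T) (I.oracleQueries T))
  | .unif m f =>
      if h : ∑' _ : Fin m, ((1 : ℕ) : ℝ≥0∞) ≠ 0 then
        ((weighted (fun _ : Fin m => 1) h).bind fun i => (f i).run I).map (Outcome.charge 1 0)
      else PMF.pure ⟨none, 1, 0⟩
  | @Prog.draws _ _ m w s f =>
      if s = 0 then ((f []).run I).map (Outcome.charge m 0)
      else if h : ∑' i, (w i : ℝ≥0∞) ≠ 0 then
        ((iidList (weighted w h) s).bind fun l => (f l).run I).map (Outcome.charge (m + s) 0)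
      else PMF.pure ⟨none, m + s, 0⟩

/-! ### Cliques, weights and good active sets -/

/-- An ordered clique, as the list of its (automatically distinct) vertices. -/
def IsOrderedClique {n : ℕ} (G : SimpleGraph (Fin n)) (T : List (Fin n)) : Prop :=
  T.Pairwise G.Adj

/-- `n_k`, the number of (unordered) `k`-cliques. -/
def numCliques {n : ℕ} (G : SimpleGraph (Fin n)) (k : ℕ) : ℕ :=
  {C : Finset (Fin n) | G.IsNClique k C}.ncard

/-- `m`, the number of edges. -/
def numEdges {n : ℕ} (G : SimpleGraph (Fin n)) : ℕ := G.edgeSet.ncard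

/-- The least number of forests that cover the edges of the graph. -/
def arboricity {n : ℕ} (G : SimpleGraph (Fin n)) : ℕ :=
  sInf {a | ∃ F : Fin a → SimpleGraph (Fin n), (∀ i, (F i).IsAcyclic) ∧ G = ⨆ i, F i}

/-- All nonempty prefixes of `T` belong to `A`. -/
def FullyActive {n : ℕ} (A : Set (List (Fin n))) (T : List (Fin n)) : Prop :=
  ∀ j, 1 ≤ j → j ≤ T.length → T.take j ∈ A

/-- `T` is an ordering of the clique `C` of `G` that is fully active. -/
def IsActiveOrdering {n : ℕ} (G : SimpleGraph (Fin n)) (A : Set (List (Fin n)))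
    (C : Finset (Fin n)) (T : List (Fin n)) : Prop :=
  IsOrderedClique G T ∧ T.toFinset = C ∧ FullyActive A T

/-- The clique `C` is assigned to its lexicographically first fully active ordering, if there is
one, and to all nonempty prefixes of it. -/
def AssignedTo {n : ℕ} (G : SimpleGraph (Fin n)) (A : Set (List (Fin n)))
    (C : Finset (Fin n)) (T : List (Fin n)) : Prop :=
  ∃ F, IsActiveOrdering G A C F ∧ (∀ F', IsActiveOrdering G A C F' → F ≤ F') ∧ T ≠ [] ∧ T <+: F

/-- The weight of the ordered clique `T`: the number of `k`-cliques assigned to it. -/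
def weight {n : ℕ} (G : SimpleGraph (Fin n)) (A : Set (List (Fin n))) (k : ℕ)
    (T : List (Fin n)) : ℕ :=
  {C : Finset (Fin n) | G.IsNClique k C ∧ AssignedTo G A C T}.ncard

/-- `A` is `τ`-bounded: every ordered `t`-clique with `1 ≤ t ≤ k` has weight at most `τ t`. -/
def IsBounded {n : ℕ} (G : SimpleGraph (Fin n)) (A : Set (List (Fin n))) (k : ℕ)
    (τ : ℕ → ℝ) : Prop :=
  ∀ t, 1 ≤ t → t ≤ k → ∀ T : List (Fin n), T.length = t → IsOrderedClique G T →
    (weight G A k T : ℝ) ≤ τ t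

/-- `A` is `(ε, τ)`-good: it is `τ`-bounded and the total weight of the vertices is at least
`(1 - ε / 2) n_k`. -/
def IsGood {n : ℕ} (G : SimpleGraph (Fin n)) (A : Set (List (Fin n))) (k : ℕ) (ε : ℝ)
    (τ : ℕ → ℝ) : Prop :=
  IsBounded G A k τ ∧
    (1 - ε / 2) * (numCliques G k : ℝ) ≤ ((∑ v : Fin n, weight G A k [v] : ℕ) : ℝ)

/-! ### The algorithm -/

/-- Parameters of the algorithm: clique size `k`, arboricity bound `α`, accuracy `ε`, confidence
`δ`, estimate `mt` of the number of edges, guess `nt` of the number of `k`-cliques, and weight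
thresholds `τ 1, …, τ k`. -/
structure Params where
  k : ℕ
  α : ℝ
  ε : ℝ
  δ : ℝ
  mt : ℝ
  nt : ℝ
  τ : ℕ → ℝ

def Params.β (P : Params) : ℝ := P.δ / (3 * P.k)

def Params.γ (P : Params) : ℝ := P.ε / (2 * P.k)

/-- `3 ln(2 / β) / γ²` -/
def Params.K (P : Params) : ℝ := 3 * Real.log (2 / P.β) / P.γ ^ 2

/-- The sample size `s_{t+1} = ⌈d τ_{t+1} / w · 3 ln(2 / β) / γ²⌉`, where `d = d(R_t)` and `w` is the
lower estimate of the weight of `R_t`. -/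
def Params.sampleSize (P : Params) (t d : ℕ) (w : ℝ) : ℕ := ⌈d * P.τ (t + 1) / w * P.K⌉₊

/-- The abort threshold for `s_{t+1}`. -/
def Params.sizeLimit (P : Params) (t : ℕ) : ℝ :=
  4 * P.mt * P.α ^ (t - 1) * P.τ (t + 1) / P.nt * ((P.k ! : ℝ) ^ 2 * P.K / P.β ^ t)

/-- The abort threshold for the number of sampled ordered `k`-cliques; it refers to `n_k`. -/
def Params.finalLimit (P : Params) (nk : ℕ) : ℝ :=
  (P.k ! : ℝ) ^ 2 / P.β ^ P.k * (nk * P.τ P.k / P.nt) * (4 * P.K)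

/-- Does the natural number `s` exceed the threshold `x`?  With `up = true` the threshold is first
rounded up to an integer; with `up = false` it is used as it is. -/
def exceeds (up : Bool) (s : ℕ) (x : ℝ) : Prop :=
  if up then (⌈x⌉₊ : ℝ) < s else x < s

section Procedures

variable {n : ℕ}

/-- Of two candidates (degree, vertex), the one of smaller degree, ties broken by id. -/
def better (a b : ℕ × Fin n) : ℕ × Fin n :=
  if b.1 < a.1 ∨ (b.1 = a.1 ∧ b.2 < a.2) then b else a

/-- Query the degrees of the vertices of `T`, and return a vertex of least degree (ties broken by
id) together with its degree, which is the degree `d(T)` of the ordered clique. -/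
def minDegVertex : List (Fin n) → Prog n (Option (ℕ × Fin n))
  | [] => pure none
  | v :: T => .deg v fun d => .tick 1 do
      let r ← minDegVertex T
      pure (some (match r with
        | none => (d, v)
        | some b => better (d, v) b))

/-- The list of the degrees `d(T)`, for `T` in `R`. -/
def cliqueDegrees : List (List (Fin n)) → Prog n (List ℕ)
  | [] => pure []
  | T :: R => .tick 1 do
      let r ← minDegVertex T
      let ds ← cliqueDegrees R
      pure ((match r with
        | none => 0
        | some b => b.1) :: ds)

/-- Query all the pairs of `v` and a vertex of `T`; are they all edges? -/
def adjacentToAll (v : Fin n) : List (Fin n) → Prog n Bool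
  | [] => pure true
  | u :: T => .pair u v fun b => do
      let c ← adjacentToAll v T
      pure (b && c)

/-- Draw a uniform neighbor `v` of the least-degree vertex of `T`, and return `(T, v)` if this is
an ordered clique. -/
def extend (T : List (Fin n)) : Prog n (Option (List (Fin n))) := do
  let r ← minDegVertex T
  match r with
  | none => .abort
  | some (d, u) => .unif d fun i => .nbr u i fun w =>
      match w with
      | none => .abort
      | some v => do
          let b ← adjacentToAll v T
          pure (if b then some (T ++ [v]) else none)

/-- Apply `extend` to each element of a list and collect the ordered cliques that result. -/
def extendAll : List (List (Fin n)) → Prog n (List (List (Fin n)))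
  | [] => pure []
  | T :: L => .tick 1 do
      let r ← extend T
      let R ← extendAll L
      pure (match r with
        | none => R
        | some T' => T' :: R)

/-- The procedure Sample-a-Set: `s` times, independently, choose `T` in `R` with probability
`d(T) / d(R)` and try to extend it by a random neighbor. -/
def sampleSet (R : List (List (Fin n))) (s : ℕ) : Prog n (List (List (Fin n))) := do
  let ds ← cliqueDegrees R
  .draws (fun i : Fin R.length => ds.getD i 0) s fun l => extendAll (l.map R.get)

/-- Call the oracle on each member of a list; are they all active? -/
def allActive : List (List (Fin n)) → Prog n Bool
  | [] => pure true
  | T :: L => .tick 1 <| .oracle T fun b => do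
      let c ← allActive L
      pure (b && c)

/-- The nonempty prefixes of `T`, by increasing length. -/
def prefixes (T : List (Fin n)) : List (List (Fin n)) :=
  (List.range T.length).map fun j => T.take (j + 1)

/-- The members of a list of ordered cliques that are fully active. -/
def activeOnes : List (List (Fin n)) → Prog n (List (List (Fin n)))
  | [] => pure []
  | T :: L => .tick (T.length + 1) do
      let b ← allActive (prefixes T)
      let M ← activeOnes L
      pure (if b then T :: M else M)

open Classical in
/-- The procedure Is-Assigned: check all the orderings of the vertices of `T`, and return `1` if `T`
is the lexicographically first one that is fully active, and `0` otherwise. -/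
def isAssigned (T : List (Fin n)) : Prog n ℕ := do
  let M ← activeOnes T.permutations
  pure (if T ∈ M ∧ ∀ T' ∈ M, T ≤ T' then 1 else 0)

/-- The sum of the values returned by `isAssigned`. -/
def countAssigned : List (List (Fin n)) → Prog n ℕ
  | [] => pure 0
  | T :: R => .tick 1 do
      let a ← isAssigned T
      let c ← countAssigned R
      pure (a + c)

/-- `s` independent uniform vertices, as ordered `1`-cliques. -/
def sampleVertices (n : ℕ) : ℕ → Prog n (List (List (Fin n)))
  | 0 => pure []
  | s + 1 => .unif n fun v => do
      let R ← sampleVertices n s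
      pure ([v] :: R)

open Classical in
/-- The last part of the algorithm, from the sample `R = R_k` on, where
`D = n d(R_1) ⋯ d(R_{k-1})` and `S = s_1 ⋯ s_k`. -/
def finish (P : Params) (up : Bool) (nk : ℕ) (R : List (List (Fin n))) (D S : ℝ) : Prog n ℝ :=
  .tick 1 <|
    if exceeds up R.length (P.finalLimit nk) then .abort
    else do
      let c ← countAssigned R
      pure (D / S * c)

open Classical in
/-- `r` iterations of the main loop starting from the iteration with index `t`, followed by the last
part.  Here `R = R_t`, `w` is the previous weight estimate (index `t - 1`), `d = d(R_{t-1})`,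
`s = s_t`, `D = n d(R_1) ⋯ d(R_{t-1})` and `S = s_1 ⋯ s_t`. -/
def levels (P : Params) (up : Bool) (nk : ℕ) :
    ℕ → ℕ → List (List (Fin n)) → ℝ → ℕ → ℕ → ℝ → ℝ → Prog n ℝ
  | 0, _, R, _, _, _, D, S => finish P up nk R D S
  | r + 1, t, R, w, d, s, D, S => do
      let ds ← cliqueDegrees R
      let d' := ds.sum
      let w' := (1 - P.γ) * (w / d) * s
      let s' := P.sampleSize t d' w'
      .tick 1 <|
        if exceeds up s' (P.sizeLimit t) then .abort
        else do
          let R' ← sampleSet R s'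
          levels P up nk r (t + 1) R' w' d' s' (D * d') (S * s')

/-- The algorithm.  The argument `nk` is used in the last abort test only. -/
def approx (n : ℕ) (P : Params) (up : Bool) (nk : ℕ) : Prog n ℝ := do
  let w₀ := (1 - P.ε / 2) * P.nt
  let s₁ := P.sampleSize 0 n w₀
  let R₁ ← sampleVertices n s₁
  levels P up nk (P.k - 1) 1 R₁ w₀ n s₁ n s₁

/-- The law of the outcome of the algorithm on an instance. -/
def approxLaw (I : Instance n) (P : Params) (up : Bool) : PMF (Outcome ℝ) :=
  (approx n P up (numCliques I.G P.k)).run I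

end Procedures

/-- The complexity bound with `c` (an upper bound on the cost of an oracle call):
`(n τ₁/ñ + k^{3k}/δ^{2k} · m̃/ñ · ∑_{t=2}^k α^{t-2} τ_t + k^{e k}/δ^k · n_k/ñ · τ_k · c)`
`· 3^k ln(k/δ)/ε²  +  (k² + k · k! · c)`. -/
def costBound (P : Params) (n nk e c : ℕ) : ℝ :=
  (n * P.τ 1 / P.nt
      + (P.k : ℝ) ^ (3 * P.k) / P.δ ^ (2 * P.k) * (P.mt / P.nt)
        * ∑ t ∈ Finset.Icc 2 P.k, P.α ^ (t - 2) * P.τ t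
      + (P.k : ℝ) ^ (e * P.k) / P.δ ^ P.k * (nk / P.nt) * P.τ P.k * c)
    * (3 ^ P.k * Real.log (P.k / P.δ) / P.ε ^ 2)
  + ((P.k : ℝ) ^ 2 + P.k * P.k ! * c)

end CliqueApprox

end

/-!
Why the estimate is accurate.  The empty list is the only ordered `0`-clique; give it the degree
`n` and let `R_0` consist of it alone.  Then all the levels are sampled in the same way: `R_{t+1}`
arises from `R_t` by independent trials, each of which finds any given ordered clique that extends
a member of `R_t` by one vertex with probability `1 / d(R_t)` (`mean_stepLaw`).  All that the
algorithm remembers about the past is determined by `Y_t = n d(R_1) ⋯ d(R_{t-1}) / (s_1 ⋯ s_t)`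
(`approxLaw_eq_process`).  Since weights are passed on to extensions (`sum_prefixWeight_snoc`), the
scaled weight `Y_t ω(R_t)` is a martingale as long as the samples are nonempty; it starts from
`ω(V)`, and its last value is the one that is returned.

* *Concentration.*  The summands of `ω(R_{t+1})` are at most `τ_{t+1}`, and the sample size is
  chosen such that Chernoff's bound keeps the scaled weight from growing or shrinking by more than a
  factor `1 + γ` or `1 - γ` in one level, except with probability `β / 2` each (`mean_weight_tail`).
  The invariants `UpperInv` and `LowerInv` accumulate these factors, whose products over `k` levels
  stay between `1 - ε / 2` and `1 + ε`.
* *Aborts.*  For any function `g` on ordered cliques, the expectation of `Y_{t+1} g(R_{t+1})` is at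
  most `Y_t` times the sum of `g` over the extensions of the members of `R_t` (`mean_step_le`).  So
  `Y_t d(R_t)` is in expectation at most the sum of the degrees of all ordered `t`-cliques, and by
  Markov's inequality it exceeds this sum by a factor `1 / (2 β)` with probability at most `2 β`.
  The function `price` collects these contributions of all the levels, which together with the
  losses of the invariants amount to `3 k β = δ` (`mean_process_le`).
* *Cliques in graphs of small arboricity.*  Rooted forests orient the edges with out-degrees at
  most `α` (`exists_orientation`).  An ordered clique is a permutation of a directed path, as every
  tournament has a Hamiltonian path, so that the degrees of the ordered `t`-cliques add up to at
  most `t! · 2 m · α ^ (t - 1)` (`sum_orderedCliques_le`).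
* *Rounding.*  The sample sizes are rounded up, which the abort tests have to tolerate.  If the
  lower invariant holds, then the rounded number is at least one and the slack of the thresholds is
  enough.  Otherwise it is enough that the thresholds are rounded, too.  This is the reason why the
  two versions of the algorithm differ if the guess is too large.

Why the complexity is as claimed.  The cost of an iteration is at most proportional to `t` times
the sample size, which the abort test bounds (`loopCost`).  The last part costs `k! · k` oracle
calls per member of `R_k`.  On every run the size of `R_k` is bounded by the last abort test.  In
expectation it is at most `1 + 2 κ E(Y_k |R_k|)`, where `κ` is the factor in the last sample size,
and by the supermartingale property `E(Y_k |R_k|) ≤ k! n_k` (`mean_cost_le`).  With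
`k · k! ≤ k ^ k`, the bounds take the form that is claimed.
-/

noncomputable section

namespace CliqueApprox

/-! ### Expectations of discrete laws, and a Chernoff bound -/

section Mean

variable {β γ : Type}

/-- The expectation of an extended nonnegative function under a discrete law. -/
def mean (μ : PMF β) (f : β → ℝ≥0∞) : ℝ≥0∞ := ∑' b, μ b * f b

theorem mean_pure (b : β) (f : β → ℝ≥0∞) : mean (PMF.pure b) f = f b := by
  classical
  rw [mean, tsum_eq_single b]
  · simp
  · intro c hc
    simp [hc]

theorem mean_bind (μ : PMF β) (g : β → PMF γ) (f : γ → ℝ≥0∞) :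
    mean (μ.bind g) f = mean μ fun b => mean (g b) f := by
  simp only [mean, PMF.bind_apply, ← ENNReal.tsum_mul_right, ← ENNReal.tsum_mul_left]
  rw [ENNReal.tsum_comm]
  simp only [mul_assoc]

theorem mean_map (μ : PMF β) (g : β → γ) (f : γ → ℝ≥0∞) :
    mean (μ.map g) f = mean μ fun b => f (g b) := by
  rw [← PMF.bind_pure_comp, mean_bind]
  simp [mean_pure]

theorem mean_mono {μ : PMF β} {f g : β → ℝ≥0∞} (h : ∀ b ∈ μ.support, f b ≤ g b) :
    mean μ f ≤ mean μ g := by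
  refine ENNReal.tsum_le_tsum fun b => ?_
  by_cases hb : b ∈ μ.support
  · gcongr
    exact h b hb
  · simp [(PMF.apply_eq_zero_iff μ b).2 hb]

theorem mean_const (μ : PMF β) (c : ℝ≥0∞) : mean μ (fun _ => c) = c := by
  rw [mean, ENNReal.tsum_mul_right, μ.tsum_coe, one_mul]

theorem mean_add (μ : PMF β) (f g : β → ℝ≥0∞) :
    mean μ (fun b => f b + g b) = mean μ f + mean μ g := by
  simp only [mean, mul_add, ENNReal.tsum_add]

theorem mean_const_mul (μ : PMF β) (c : ℝ≥0∞) (f : β → ℝ≥0∞) :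
    mean μ (fun b => c * f b) = c * mean μ f := by
  simp only [mean, ← ENNReal.tsum_mul_left]
  congr 1 with b
  ring

theorem mean_le_of_forall {μ : PMF β} {f : β → ℝ≥0∞} {c : ℝ≥0∞} (h : ∀ b ∈ μ.support, f b ≤ c) :
    mean μ f ≤ c :=
  (mean_mono h).trans (mean_const μ c).le

/-- A mean with respect to weights, multiplied out by the total weight. -/
theorem mean_weighted {m : ℕ} (w : Fin m → ℕ) (h : ∑' i, (w i : ℝ≥0∞) ≠ 0)
    (f : Fin m → ℝ≥0∞) :
    (∑ i, (w i : ℝ≥0∞)) * mean (weighted w h) f = ∑ i, w i * f i := by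
  rw [tsum_fintype] at h
  have hfin : ∑ i, (w i : ℝ≥0∞) ≠ ∞ := by
    simp
  simp only [mean, weighted, PMF.normalize_apply, tsum_fintype, Finset.mul_sum]
  refine Finset.sum_congr rfl fun i _ => ?_
  calc _ = ((∑ i, (w i : ℝ≥0∞)) * (∑ i, (w i : ℝ≥0∞))⁻¹) * (w i * f i) := by ring
    _ = _ := by rw [ENNReal.mul_inv_cancel h hfin, one_mul]

theorem mean_iidList_prod (μ : PMF β) (g : β → ℝ≥0∞) (s : ℕ) :
    mean (iidList μ s) (fun l => (l.map g).prod) = mean μ g ^ s := by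
  induction s with
  | zero => simp [iidList, mean_pure]
  | succ s ih =>
    simp only [iidList, mean_bind, mean_map, List.map_cons, List.prod_cons, mean_const_mul, ih]
    simp only [mul_comm _ (mean μ g ^ s), mean_const_mul]
    ring

theorem mean_iidList_sum (μ : PMF β) (g : β → ℝ≥0∞) (s : ℕ) :
    mean (iidList μ s) (fun l => (l.map g).sum) = s * mean μ g := by
  induction s with
  | zero => simp [iidList, mean_pure]
  | succ s ih =>
    simp only [iidList, mean_bind, mean_map, List.map_cons, List.sum_cons, mean_add, ih,
      mean_const]
    push_cast
    ring

theorem length_of_mem_support_iidList {μ : PMF β} {s : ℕ} {l : List β}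
    (h : l ∈ (iidList μ s).support) : l.length = s := by
  induction s generalizing l with
  | zero => simp_all [iidList]
  | succ s ih =>
    simp only [iidList, PMF.mem_support_bind_iff, PMF.mem_support_map_iff] at h
    obtain ⟨b, -, l', hl', rfl⟩ := h
    simp [ih hl']

theorem mem_support_of_mem_iidList {μ : PMF β} {s : ℕ} {l : List β}
    (h : l ∈ (iidList μ s).support) : ∀ b ∈ l, b ∈ μ.support := by
  induction s generalizing l with
  | zero => simp_all [iidList]
  | succ s ih =>
    simp only [iidList, PMF.mem_support_bind_iff, PMF.mem_support_map_iff] at h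
    obtain ⟨b, hb, l', hl', rfl⟩ := h
    intro c hc
    rcases List.mem_cons.1 hc with rfl | hc
    · exact hb
    · exact ih hl' c hc

open Classical in
/-- The probability of an event, as an expectation. -/
theorem toOuterMeasure_eq_mean (μ : PMF β) (s : Set β) :
    μ.toOuterMeasure s = mean μ (fun b => if b ∈ s then 1 else 0) := by
  rw [PMF.toOuterMeasure_apply, mean]
  congr 1 with b
  by_cases h : b ∈ s <;> simp [h]

open Classical in
/-- If all the outcomes that are not bad lie in `s`, and an outcome is bad with probability at most
`δ`, then `s` has probability at least `1 - δ`. -/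
theorem ofReal_one_sub_le_toOuterMeasure {μ : PMF β} {s : Set β} {bad : β → Prop} {δ : ℝ}
    (hδ : 0 ≤ δ) (hs : ∀ b, ¬ bad b → b ∈ s)
    (h : mean μ (fun b => if bad b then 1 else 0) ≤ ENNReal.ofReal δ) :
    ENNReal.ofReal (1 - δ) ≤ μ.toOuterMeasure s := by
  rw [toOuterMeasure_eq_mean, ENNReal.ofReal_sub _ hδ, ENNReal.ofReal_one, tsub_le_iff_right]
  calc (1 : ℝ≥0∞) = mean μ (fun _ => 1) := (mean_const μ 1).symm
    _ ≤ mean μ (fun b => (if b ∈ s then 1 else 0) + (if bad b then 1 else 0)) := by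
        refine mean_mono fun b _ => ?_
        by_cases hb : bad b
        · rw [if_pos hb]
          exact le_add_self
        · rw [if_pos (hs b hb)]
          exact le_self_add
    _ ≤ _ := by
        rw [mean_add]
        gcongr

end Mean

section Chernoff

/-- The exponent in Chernoff's bound for the upper tail. -/
theorem sq_div_three_le_of_nonneg {a : ℝ} (h0 : 0 ≤ a) (h1 : a ≤ 1) :
    a ^ 2 / 3 ≤ (1 + a) * Real.log (1 + a) - a := by
  have h := Real.le_log_one_add_of_nonneg h0
  have : a ^ 2 / 3 ≤ a ^ 2 / (a + 2) := by
    apply div_le_div_of_nonneg_left (by positivity) (by positivity) (by linarith)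
  have e : a ^ 2 / (a + 2) = (1 + a) * (2 * a / (a + 2)) - a := by
    field_simp
    ring
  nlinarith

/-- The exponent in Chernoff's bound for the lower tail.  The Taylor expansion of the logarithm to
the second order suffices, as only deviations of at most `1 / 3` are needed. -/
theorem sq_div_three_le_neg {g : ℝ} (h0 : 0 ≤ g) (h1 : g ≤ 1 / 3) :
    g ^ 2 / 3 ≤ (1 + -g) * Real.log (1 + -g) - -g := by
  have h := Real.abs_log_sub_add_sum_range_le (x := g) (by rw [abs_of_nonneg h0]; linarith) 2
  rw [abs_of_nonneg h0] at h
  have h2 := (abs_le.1 h).1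
  simp only [Finset.sum_range_succ, Finset.sum_range_zero] at h2
  norm_num at h2
  have h3 : (1 - g) * (g ^ 3 / (1 - g)) = g ^ 3 := by
    field_simp [show (1 - g) ≠ 0 by linarith]
  have h4 : (1 - g) * (-(g ^ 3 / (1 - g))) ≤ (1 - g) * (g + g ^ 2 / 2 + Real.log (1 - g)) :=
    mul_le_mul_of_nonneg_left h2 (by linarith)
  rw [← sub_eq_add_neg]
  nlinarith [mul_nonneg (sq_nonneg g) (by linarith : 0 ≤ 1 / 3 - g)]

variable {β : Type}

/-- Bernoulli's inequality bounds the exponential moment of a `[0, 1]`-valued variable. -/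
theorem mean_rpow_le (μ : PMF β) (x : β → ℝ) (hx : ∀ b ∈ μ.support, 0 ≤ x b ∧ x b ≤ 1)
    {a u : ℝ} (ha : -1 < a) (hu : 0 ≤ u)
    (h : 0 ≤ a ∧ mean μ (fun b => ENNReal.ofReal (x b)) ≤ ENNReal.ofReal u ∨
      a ≤ 0 ∧ ENNReal.ofReal u ≤ mean μ (fun b => ENNReal.ofReal (x b))) :
    mean μ (fun b => ENNReal.ofReal ((1 + a) ^ x b)) ≤ ENNReal.ofReal (Real.exp (a * u)) := by
  have key : ∀ b ∈ μ.support, (1 + a) ^ x b ≤ 1 + x b * a := fun b hb =>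
    rpow_one_add_le_one_add_mul_self ha.le (hx b hb).1 (hx b hb).2
  rcases h with ⟨ha0, h⟩ | ⟨ha0, h⟩
  · calc _ ≤ mean μ (fun b => 1 + ENNReal.ofReal a * ENNReal.ofReal (x b)) := by
          refine mean_mono fun b hb => ?_
          rw [← ENNReal.ofReal_one, ← ENNReal.ofReal_mul ha0, ← ENNReal.ofReal_add (by simp)
            (mul_nonneg ha0 (hx b hb).1)]
          exact ENNReal.ofReal_le_ofReal (by linarith [key b hb])
      _ ≤ 1 + ENNReal.ofReal a * ENNReal.ofReal u := by
          rw [mean_add, mean_const, mean_const_mul]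
          gcongr
      _ ≤ _ := by
          rw [← ENNReal.ofReal_one, ← ENNReal.ofReal_mul ha0,
            ← ENNReal.ofReal_add (by simp) (mul_nonneg ha0 hu)]
          exact ENNReal.ofReal_le_ofReal (by linarith [Real.add_one_le_exp (a * u)])
  · have h1 : mean μ (fun b => ENNReal.ofReal ((1 + a) ^ x b)) + ENNReal.ofReal (-a * u) ≤ 1 := by
      rw [ENNReal.ofReal_mul (by linarith)]
      calc _ ≤ mean μ (fun b => ENNReal.ofReal ((1 + a) ^ x b)) +
            ENNReal.ofReal (-a) * mean μ (fun b => ENNReal.ofReal (x b)) := by gcongr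
        _ = mean μ (fun b => ENNReal.ofReal ((1 + a) ^ x b) +
            ENNReal.ofReal (-a) * ENNReal.ofReal (x b)) := by rw [mean_add, mean_const_mul]
        _ ≤ 1 := by
          refine mean_le_of_forall fun b hb => ?_
          rw [← ENNReal.ofReal_mul (by linarith),
            ← ENNReal.ofReal_add (Real.rpow_nonneg (by linarith) _)
              (mul_nonneg (by linarith) (hx b hb).1), ← ENNReal.ofReal_one]
          exact ENNReal.ofReal_le_ofReal (by linarith [key b hb])
    refine (ENNReal.le_sub_of_add_le_right ENNReal.ofReal_ne_top h1).trans ?_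
    rw [← ENNReal.ofReal_one, ← ENNReal.ofReal_sub _ (mul_nonneg (by linarith) hu)]
    exact ENNReal.ofReal_le_ofReal (by linarith [Real.add_one_le_exp (a * u)])

open Classical in
/-- Chernoff bound for `s` independent `[0, 1]`-valued samples, in the shape common to both tails:
`a` is the relative deviation, positive for the upper and negative for the lower tail, and `u` is
an upper respectively lower estimate of the expectation of a sample. -/
theorem mean_iidList_tail (μ : PMF β) (x : β → ℝ) (hx : ∀ b ∈ μ.support, 0 ≤ x b ∧ x b ≤ 1)
    (s : ℕ) {a u : ℝ} (ha : -(1 / 3) ≤ a) (ha1 : a ≤ 1) (hu : 0 ≤ u)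
    (h : 0 ≤ a ∧ mean μ (fun b => ENNReal.ofReal (x b)) ≤ ENNReal.ofReal u ∨
      a ≤ 0 ∧ ENNReal.ofReal u ≤ mean μ (fun b => ENNReal.ofReal (x b))) :
    mean (iidList μ s) (fun l => if 0 ≤ a * ((l.map x).sum - (1 + a) * s * u) then 1 else 0) ≤
      ENNReal.ofReal (Real.exp (-(s * u * a ^ 2 / 3))) := by
  have h1a : 0 < 1 + a := by linarith
  have hprod : ∀ l : List β, (l.map fun b => ENNReal.ofReal ((1 + a) ^ x b)).prod =
      ENNReal.ofReal ((1 + a) ^ (l.map x).sum) := by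
    intro l
    induction l with
    | nil => simp
    | cons b l ih =>
      rw [List.map_cons, List.prod_cons, ih, List.map_cons, List.sum_cons, Real.rpow_add h1a,
        ENNReal.ofReal_mul (Real.rpow_nonneg h1a.le _)]
  set v : ℝ := (1 + a) * s * u with hv
  have hsign : 0 ≤ a * Real.log (1 + a) := by
    rcases le_total 0 a with h | h
    · exact mul_nonneg h (Real.log_nonneg (by linarith))
    · exact mul_nonneg_of_nonpos_of_nonpos h (Real.log_nonpos h1a.le (by linarith))
  -- Markov's inequality for `(1 + a) ^ (∑ x)`, whose mean is a product by independence
  have hind : ∀ l : List β, (if 0 ≤ a * ((l.map x).sum - v) then (1 : ℝ≥0∞) else 0) ≤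
      ENNReal.ofReal ((1 + a) ^ (-v)) * (l.map fun b => ENNReal.ofReal ((1 + a) ^ x b)).prod := by
    intro l
    split_ifs with hl
    · rw [hprod, ← ENNReal.ofReal_mul (Real.rpow_nonneg h1a.le _), ← Real.rpow_add h1a,
        ← ENNReal.ofReal_one]
      apply ENNReal.ofReal_le_ofReal
      rcases le_total 0 a with h | h
      · rcases h.eq_or_lt with rfl | h
        · simp
        · exact Real.one_le_rpow (by linarith) (by nlinarith)
      · rcases h.eq_or_lt with rfl | h
        · simp
        · exact Real.one_le_rpow_of_pos_of_le_one_of_nonpos h1a (by linarith) (by nlinarith)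
    · exact zero_le
  refine (mean_mono fun l _ => hind l).trans ?_
  rw [mean_const_mul, mean_iidList_prod]
  calc _ ≤ ENNReal.ofReal ((1 + a) ^ (-v)) * ENNReal.ofReal (Real.exp (a * u)) ^ s := by
        gcongr
        exact mean_rpow_le μ x hx (by linarith) hu h
    _ ≤ _ := by
        rw [← ENNReal.ofReal_pow (Real.exp_nonneg _), ← Real.exp_nat_mul,
          Real.rpow_def_of_pos h1a, ← ENNReal.ofReal_mul (Real.exp_nonneg _), ← Real.exp_add]
        apply ENNReal.ofReal_le_ofReal
        apply Real.exp_le_exp.2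
        have h3 : a ^ 2 / 3 ≤ (1 + a) * Real.log (1 + a) - a := by
          rcases le_total 0 a with h | h
          · exact sq_div_three_le_of_nonneg h ha1
          · simpa using sq_div_three_le_neg (g := -a) (by linarith) (by linarith)
        have := mul_le_mul_of_nonneg_left h3 (mul_nonneg (Nat.cast_nonneg s) hu)
        rw [hv]
        linarith

end Chernoff

/-! ### Forests, orientations and the number of ordered cliques -/

section Orientation

variable {V : Type*}

/-- A forest can be oriented such that every vertex has at most one out-neighbor: root each
component and let every vertex point to the next vertex on the path to the root. -/
theorem exists_parent_of_isAcyclic {F : SimpleGraph V} (hF : F.IsAcyclic) :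
    ∃ p : V → V, ∀ u v, F.Adj u v → p u = v ∨ p v = u := by
  classical
  have hr : ∀ v, ∃ q : F.Walk v (F.connectedComponentMk v).out, q.IsPath := fun v => by
    have h : F.Reachable v (F.connectedComponentMk v).out :=
      SimpleGraph.ConnectedComponent.exact (Quot.out_eq (F.connectedComponentMk v)).symm
    obtain ⟨q⟩ := h
    exact ⟨q.toPath, q.toPath.2⟩
  choose q hq using hr
  refine ⟨fun v => (q v).snd, fun u v huv => ?_⟩
  have hc : F.connectedComponentMk v = F.connectedComponentMk u :=
    SimpleGraph.ConnectedComponent.sound huv.symm.reachable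
  by_cases hv : v ∈ (q u).support
  · exact Or.inl (hF.eq_snd_of_adj_start (hq u) huv hv).symm
  · refine Or.inr (hF.eq_snd_of_adj_start (hq v) huv.symm ?_).symm
    have h2 : ∀ (x : V) (r : F.Walk u x), r.IsPath → x = (F.connectedComponentMk v).out →
        v ∉ r.support → u ∈ (q v).support := by
      rintro x r hr rfl hvr
      have := (hF.subsingleton_path _ _).elim ⟨q v, hq v⟩ ⟨_, hr.cons (h := huv.symm) hvr⟩
      rw [Subtype.mk.inj this]
      simp
    exact h2 _ (q u) (hq u) (by rw [hc]) hv

theorem isAcyclic_fromEdgeSet_singleton (e : Sym2 V) :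
    (SimpleGraph.fromEdgeSet {e}).IsAcyclic := by
  induction e with
  | _ u v =>
    have h := SimpleGraph.isAcyclic_add_edge_iff_of_not_reachable (G := (⊥ : SimpleGraph V)) u v
    by_cases huv : u = v
    · subst huv
      have : SimpleGraph.fromEdgeSet {s(u, u)} = (⊥ : SimpleGraph V) := by
        ext a b
        simp only [SimpleGraph.fromEdgeSet_adj, Set.mem_singleton_iff, SimpleGraph.bot_adj,
          iff_false]
        rintro ⟨h, h'⟩
        simp only [Sym2.eq_iff] at h
        grind
      rw [this]
      exact SimpleGraph.isAcyclic_bot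
    · have h2 := (h (by simpa using huv)).2 SimpleGraph.isAcyclic_bot
      simpa [SimpleGraph.edge] using h2

/-- Single edges are forests, so that the arboricity is the infimum of a nonempty set. -/
theorem exists_forest_cover [Finite V] (G : SimpleGraph V) :
    ∃ (a : ℕ) (F : Fin a → SimpleGraph V), (∀ i, (F i).IsAcyclic) ∧ G = ⨆ i, F i := by
  obtain ⟨a, ⟨e⟩⟩ := Finite.exists_equiv_fin G.edgeSet
  refine ⟨a, fun i => SimpleGraph.fromEdgeSet {(e.symm i : Sym2 V)},
    fun i => isAcyclic_fromEdgeSet_singleton _, ?_⟩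
  ext u v
  simp only [SimpleGraph.iSup_adj, SimpleGraph.fromEdgeSet_adj, Set.mem_singleton_iff]
  constructor
  · intro h
    exact ⟨e ⟨s(u, v), h⟩, by simp, h.ne⟩
  · rintro ⟨i, hi, -⟩
    have := (e.symm i).2
    rwa [← hi] at this

/-- The edges of a graph can be oriented such that all out-degrees are at most the arboricity. -/
theorem exists_orientation {n : ℕ} (G : SimpleGraph (Fin n)) :
    ∃ N : Fin n → Finset (Fin n), (∀ v, (N v).card ≤ arboricity G) ∧
      ∀ u v, G.Adj u v → v ∈ N u ∨ u ∈ N v := by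
  have hne : {a | ∃ F : Fin a → SimpleGraph (Fin n), (∀ i, (F i).IsAcyclic) ∧
      G = ⨆ i, F i}.Nonempty := exists_forest_cover G
  obtain ⟨F, hF, hG⟩ := Nat.sInf_mem hne
  choose p hp using fun i => exists_parent_of_isAcyclic (hF i)
  refine ⟨fun v => Finset.univ.image fun i => p i v, fun v => ?_, fun u v huv => ?_⟩
  · exact Finset.card_image_le.trans (by simp [arboricity])
  · rw [hG, SimpleGraph.iSup_adj] at huv
    obtain ⟨i, hi⟩ := huv
    simp only [Finset.mem_image, Finset.mem_univ, true_and]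
    exact (hp i u v hi).imp (fun h => ⟨i, h⟩) (fun h => ⟨i, h⟩)

/-- Insertion sort along a total relation gives consecutive related elements, even if the relation
is not transitive. -/
theorem isChain_insertionSort {r : V → V → Prop} [DecidableRel r] (hr : ∀ a b, r a b ∨ r b a)
    (l : List V) : (l.insertionSort r).IsChain r := by
  have hins : ∀ (a : V) (l : List V), l.IsChain r → (l.orderedInsert r a).IsChain r ∧
      ∀ b ∈ (l.orderedInsert r a).head?, b = a ∨ b ∈ l.head? := by
    intro a l hl
    induction l with
    | nil => simp
    | cons b l ih =>
      by_cases h : r a b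
      · rw [List.orderedInsert_cons_of_le r l h]
        exact ⟨List.isChain_cons_cons.2 ⟨h, hl⟩, by simp⟩
      · rw [List.orderedInsert_of_not_le r l h]
        obtain ⟨h1, h2⟩ := ih hl.of_cons
        refine ⟨List.isChain_cons.2 ⟨fun y hy => ?_, h1⟩, by simp⟩
        rcases h2 y hy with rfl | hy'
        · exact (hr y b).resolve_left h
        · exact (List.isChain_cons.1 hl).1 y hy'
  induction l with
  | nil => simp
  | cons a l ih => exact (hins a _ ih).1

end Orientation

section OrderedCliques

variable {n : ℕ} (G : SimpleGraph (Fin n))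

/-- The lists that arise from those in `S` by appending a vertex that satisfies `p`. -/
def snocs (p : List (Fin n) → Fin n → Prop) [∀ T v, Decidable (p T v)]
    (S : Finset (List (Fin n))) : Finset (List (Fin n)) :=
  ((S ×ˢ Finset.univ).filter fun x => p x.1 x.2).image fun x => x.1 ++ [x.2]

theorem sum_snocs {M : Type*} [AddCommMonoid M] (p : List (Fin n) → Fin n → Prop)
    [∀ T v, Decidable (p T v)] (S : Finset (List (Fin n))) (f : List (Fin n) → M) :
    ∑ T ∈ snocs p S, f T = ∑ T ∈ S, ∑ v, if p T v then f (T ++ [v]) else 0 := by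
  rw [snocs, Finset.sum_image, Finset.sum_filter, Finset.sum_product]
  rintro ⟨T, v⟩ - ⟨T', v'⟩ - h
  obtain ⟨rfl, h⟩ := List.append_inj' h rfl
  simp_all

theorem mem_snocs (p : List (Fin n) → Fin n → Prop) [∀ T v, Decidable (p T v)]
    (S : Finset (List (Fin n))) (T : List (Fin n)) :
    T ∈ snocs p S ↔ ∃ T' ∈ S, ∃ v, p T' v ∧ T' ++ [v] = T := by
  simp only [snocs, Finset.mem_image, Finset.mem_filter, Finset.mem_product, Finset.mem_univ,
    and_true, Prod.exists]
  constructor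
  · rintro ⟨T', v, ⟨h1, h2⟩, h3⟩
    exact ⟨T', h1, v, h2, h3⟩
  · rintro ⟨T', h1, v, h2, h3⟩
    exact ⟨T', v, ⟨h1, h2⟩, h3⟩

open Classical in
/-- The ordered `t`-cliques. -/
def orderedCliques : ℕ → Finset (List (Fin n))
  | 0 => {[]}
  | t + 1 => snocs (fun T v => IsOrderedClique G (T ++ [v])) (orderedCliques t)

theorem mem_orderedCliques {t : ℕ} {T : List (Fin n)} :
    T ∈ orderedCliques G t ↔ T.length = t ∧ IsOrderedClique G T := by
  induction t generalizing T with
  | zero =>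
    simp only [orderedCliques, Finset.mem_singleton, List.length_eq_zero_iff]
    exact ⟨fun h => ⟨h, by simp [h, IsOrderedClique]⟩, fun h => h.1⟩
  | succ t ih =>
    rw [orderedCliques, mem_snocs]
    constructor
    · rintro ⟨T', hT', v, hv, rfl⟩
      exact ⟨by simp [(ih.1 hT').1], hv⟩
    · rintro ⟨hl, hT⟩
      have hne : T ≠ [] := by rintro rfl; simp at hl
      have happ := List.dropLast_append_getLast hne
      refine ⟨T.dropLast, ih.2 ⟨by simp [hl], ?_⟩, T.getLast hne, by rwa [happ], happ⟩
      exact List.Pairwise.sublist (List.dropLast_sublist T) hT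

theorem IsOrderedClique.nodup {G : SimpleGraph (Fin n)} {T : List (Fin n)}
    (h : IsOrderedClique G T) : T.Nodup :=
  List.Pairwise.imp (fun h => h.ne) h

theorem IsOrderedClique.perm {G : SimpleGraph (Fin n)} {T T' : List (Fin n)}
    (h : IsOrderedClique G T) (hp : T.Perm T') : IsOrderedClique G T' :=
  (hp.pairwise_iff fun h => h.symm).1 h

theorem IsOrderedClique.isNClique {G : SimpleGraph (Fin n)} {T : List (Fin n)}
    (h : IsOrderedClique G T) : G.IsNClique T.length T.toFinset := by
  have : Std.Symm G.Adj := ⟨fun _ _ h => h.symm⟩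
  exact ⟨(List.pairwise_iff_coe_toFinset_pairwise h.nodup).2 h,
    List.toFinset_card_of_nodup h.nodup⟩

theorem card_orderedCliques_le (k : ℕ) : (orderedCliques G k).card ≤ k ! * numCliques G k := by
  classical
  have hfin : {C : Finset (Fin n) | G.IsNClique k C}.Finite := Set.toFinite _
  rw [numCliques, Set.ncard_eq_toFinset_card _ hfin]
  refine Finset.card_le_mul_card_image_of_maps_to (f := List.toFinset) (fun T hT => ?_) _
    fun C hC => ?_
  · have hT' := (mem_orderedCliques G).1 hT
    exact hfin.mem_toFinset.2 (hT'.1 ▸ hT'.2.isNClique)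
  · have hC' : C.card = k := by
      have := (hfin.mem_toFinset.1 hC).card_eq
      exact this
    calc _ ≤ (C.toList.permutations.toFinset).card := by
          refine Finset.card_le_card fun T hT => ?_
          obtain ⟨hT', rfl⟩ := Finset.mem_filter.1 hT
          rw [List.mem_toFinset, List.mem_permutations]
          exact (List.toFinset_toList ((mem_orderedCliques G).1 hT').2.nodup).symm
      _ ≤ k ! := by
          refine (List.toFinset_card_le _).trans ?_
          rw [List.length_permutations, Finset.length_toList, hC']

open Classical in
/-- The lists of `t` vertices that follow the arcs from each `u` to the members of `N u`. -/
def directedWalks (N : Fin n → Finset (Fin n)) : ℕ → Finset (List (Fin n))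
  | 0 => {[]}
  | t + 1 => snocs (fun T v => ∀ u ∈ T.getLast?, v ∈ N u) (directedWalks N t)

theorem mem_directedWalks {N : Fin n → Finset (Fin n)} {t : ℕ} {T : List (Fin n)} :
    T ∈ directedWalks N t ↔ T.length = t ∧ T.IsChain fun u v => v ∈ N u := by
  induction t generalizing T with
  | zero =>
    simp only [directedWalks, Finset.mem_singleton, List.length_eq_zero_iff]
    exact ⟨fun h => ⟨h, by simp [h]⟩, fun h => h.1⟩
  | succ t ih =>
    rw [directedWalks, mem_snocs]
    constructor
    · rintro ⟨T', hT', v, hv, rfl⟩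
      obtain ⟨h1, h2⟩ := ih.1 hT'
      exact ⟨by simp [h1], List.isChain_append.2 ⟨h2, by simp, by simpa using hv⟩⟩
    · rintro ⟨hl, hT⟩
      have hne : T ≠ [] := by rintro rfl; simp at hl
      have happ := List.dropLast_append_getLast hne
      rw [← happ, List.isChain_append] at hT
      exact ⟨T.dropLast, ih.2 ⟨by simp [hl], hT.1⟩, T.getLast hne, by simpa using hT.2.2, happ⟩

open Classical in
/-- There are at most `a ^ t` directed walks with `t` arcs from a given vertex. -/
theorem sum_directedWalks_le {N : Fin n → Finset (Fin n)} {a : ℕ} (hN : ∀ v, (N v).card ≤ a)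
    (f : Fin n → ℕ) (t : ℕ) :
    ∑ W ∈ directedWalks N (t + 1), W.head?.elim 0 f ≤ (∑ v, f v) * a ^ t := by
  induction t with
  | zero => simp [directedWalks, sum_snocs]
  | succ t ih =>
    rw [directedWalks, sum_snocs, pow_succ, ← mul_assoc]
    refine le_trans ?_ (Nat.mul_le_mul_right a ih)
    rw [Finset.sum_mul]
    refine Finset.sum_le_sum fun W hW => ?_
    have hne : W ≠ [] := by
      rintro rfl
      simpa using (mem_directedWalks.1 hW).1
    have hlast := List.getLast?_eq_getLast_of_ne_nil hne
    have hhead : ∀ v, (W ++ [v]).head? = W.head? := fun v => by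
      cases W with
      | nil => exact absurd rfl hne
      | cons _ _ => rfl
    simp only [hlast, Option.mem_some_iff, forall_eq', hhead]
    rw [← Finset.sum_filter, Finset.sum_const, smul_eq_mul, mul_comm]
    refine Nat.mul_le_mul_left _ ((Finset.card_le_card fun v => ?_).trans (hN (W.getLast hne)))
    simp

open Classical in
/-- Every ordered clique is a permutation of a directed walk with respect to an orientation of the
graph, so that there are at most `t! · 2 m · a ^ (t - 1)` ordered `t`-cliques even if each one is
counted with its least degree. -/
theorem sum_orderedCliques_le (d : List (Fin n) → ℕ) (hd : ∀ T, ∀ v ∈ T, d T ≤ G.degree v)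
    (t : ℕ) :
    ∑ T ∈ orderedCliques G (t + 1), d T ≤
      (t + 1)! * (2 * numEdges G * arboricity G ^ t) := by
  obtain ⟨N, hN, hadj⟩ := exists_orientation G
  have hsub : ∀ T ∈ orderedCliques G (t + 1), ∃ W ∈ directedWalks N (t + 1), W.Perm T := by
    intro T hT
    obtain ⟨hl, hT'⟩ := (mem_orderedCliques G).1 hT
    -- on the vertices of `T`, the orientation is a tournament, and sorting along it gives a
    -- Hamiltonian path; off the edges of `G`, the relation is made total artificially
    let r : Fin n → Fin n → Prop := fun u v => v ∈ N u ∨ ¬ G.Adj u v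
    have hr : ∀ u v, r u v ∨ r v u := fun u v => by
      by_cases h : G.Adj u v
      · exact (hadj u v h).imp Or.inl Or.inl
      · exact Or.inl (Or.inr h)
    have hp := T.perm_insertionSort r
    have hpair : IsOrderedClique G (T.insertionSort r) := hT'.perm hp.symm
    refine ⟨T.insertionSort r, mem_directedWalks.2 ⟨by simp [hl], ?_⟩, hp⟩
    have h1 := isChain_insertionSort hr T
    have h2 := List.Pairwise.isChain hpair
    rw [List.isChain_iff_getElem] at h1 h2 ⊢
    exact fun i hi => (h1 i hi).resolve_right fun h => h (h2 i hi)
  calc _ ≤ ∑ T ∈ orderedCliques G (t + 1), ∑ W ∈ directedWalks N (t + 1),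
          if W.Perm T then d T else 0 := by
        refine Finset.sum_le_sum fun T hT => ?_
        obtain ⟨W, hW, hWT⟩ := hsub T hT
        exact (if_pos hWT).symm.le.trans (Finset.single_le_sum
          (f := fun W => if W.Perm T then d T else 0) (fun _ _ => Nat.zero_le _) hW)
    _ = ∑ W ∈ directedWalks N (t + 1),
          ∑ T ∈ (orderedCliques G (t + 1)).filter (fun T => W.Perm T), d T := by
        rw [Finset.sum_comm]
        simp only [Finset.sum_filter]
    _ ≤ ∑ W ∈ directedWalks N (t + 1), (t + 1)! * W.head?.elim 0 (fun v => G.degree v) := by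
        refine Finset.sum_le_sum fun W hW => ?_
        have hlen := (mem_directedWalks.1 hW).1
        calc _ ≤ ∑ T ∈ (orderedCliques G (t + 1)).filter (fun T => W.Perm T),
              W.head?.elim 0 (fun v => G.degree v) := by
              refine Finset.sum_le_sum fun T hT => ?_
              have hperm := (Finset.mem_filter.1 hT).2
              cases W with
              | nil => simp at hlen
              | cons v W => exact hd T v (hperm.mem_iff.1 (by simp))
          _ ≤ _ := by
              rw [Finset.sum_const, smul_eq_mul]
              have hc : (orderedCliques G (t + 1)).filter (fun T => W.Perm T) ⊆
                  W.permutations.toFinset := fun T hT => by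
                rw [List.mem_toFinset, List.mem_permutations]
                exact (Finset.mem_filter.1 hT).2.symm
              refine Nat.mul_le_mul_right _ ((Finset.card_le_card hc).trans ?_)
              refine (List.toFinset_card_le _).trans ?_
              rw [List.length_permutations, hlen]
    _ ≤ _ := by
        rw [← Finset.mul_sum]
        refine Nat.mul_le_mul_left _ ((sum_directedWalks_le hN _ t).trans ?_)
        rw [SimpleGraph.sum_degrees_eq_twice_card_edges, numEdges,
          Set.ncard_eq_toFinset_card']
        refine le_of_eq ?_
        congr 3

end OrderedCliques

/-! ### Weights -/

section Weights

variable {n : ℕ} (G : SimpleGraph (Fin n)) (A : Set (List (Fin n))) (k : ℕ)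

/-- The weight, extended to the empty list, which is a prefix of every ordering. -/
def prefixWeight (T : List (Fin n)) : ℕ :=
  {C : Finset (Fin n) | G.IsNClique k C ∧ ∃ F, IsActiveOrdering G A C F ∧
    (∀ F', IsActiveOrdering G A C F' → F ≤ F') ∧ T <+: F}.ncard

variable {G A k}

theorem weight_eq_prefixWeight {T : List (Fin n)} (hT : T ≠ []) :
    weight G A k T = prefixWeight G A k T := by
  simp only [weight, prefixWeight, AssignedTo, hT, ne_eq, not_false_eq_true, true_and]

theorem prefixWeight_nil_le : prefixWeight G A k [] ≤ numCliques G k :=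
  Set.ncard_le_ncard (fun _ hC => hC.1) (Set.toFinite _)

theorem prefixWeight_eq_zero {T : List (Fin n)} (hT : ¬ IsOrderedClique G T) :
    prefixWeight G A k T = 0 := by
  rw [prefixWeight, Set.ncard_eq_zero (Set.toFinite _)]
  refine Set.eq_empty_of_forall_notMem fun C hC => hT ?_
  obtain ⟨-, F, hF, -, hTF⟩ := hC
  exact List.Pairwise.sublist hTF.sublist hF.1

theorem IsActiveOrdering.length_eq {C : Finset (Fin n)} {F : List (Fin n)}
    (hF : IsActiveOrdering G A C F) : F.length = C.card := by
  rw [← hF.2.1, List.toFinset_card_of_nodup hF.1.nodup]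

/-- A short list passes its weight on to its extensions by one vertex: the ordering to which a
clique is assigned has exactly one prefix of each length. -/
theorem sum_prefixWeight_snoc {T : List (Fin n)} (hT : T.length < k) :
    ∑ v, prefixWeight G A k (T ++ [v]) = prefixWeight G A k T := by
  classical
  have hfin : ∀ S : Set (Finset (Fin n)), S.Finite := fun S => Set.toFinite S
  simp only [prefixWeight, Set.ncard_eq_toFinset_card _ (hfin _)]
  rw [← Finset.card_biUnion]
  · congr 1
    ext C
    simp only [Finset.mem_biUnion, Finset.mem_univ, true_and, Set.Finite.mem_toFinset,
      Set.mem_ofPred_eq]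
    constructor
    · rintro ⟨v, hC, F, hF, hmin, hpre⟩
      exact ⟨hC, F, hF, hmin, (List.prefix_append T [v]).trans hpre⟩
    · rintro ⟨hC, F, hF, hmin, ⟨L, rfl⟩⟩
      have hlen := hF.length_eq
      rw [hC.card_eq, List.length_append] at hlen
      cases L with
      | nil => simp at hlen; omega
      | cons v L => exact ⟨v, hC, _, hF, hmin, by simp⟩
  · intro v _ w _ hvw
    simp only [Function.onFun]
    rw [Finset.disjoint_left]
    intro C hC hC'
    simp only [Set.Finite.mem_toFinset, Set.mem_ofPred_eq] at hC hC'
    obtain ⟨-, F, hF, hmin, h1⟩ := hC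
    obtain ⟨-, F', hF', hmin', h2⟩ := hC'
    have heq : F = F' := le_antisymm (hmin F' hF') (hmin' F hF)
    subst heq
    have := List.prefix_of_prefix_length_le h1 h2 (by simp)
    have h3 := this.eq_of_length (by simp)
    exact hvw (by simpa using h3)

/-- A full-length ordered clique has weight one or zero, according to whether it is the first fully
active ordering of its vertices. -/
theorem prefixWeight_of_length_eq {T : List (Fin n)} (hT : IsOrderedClique G T)
    [Decidable (FullyActive A T ∧ ∀ T', T'.Perm T → FullyActive A T' → T ≤ T')] :
    prefixWeight G A T.length T =
      if FullyActive A T ∧ ∀ T', T'.Perm T → FullyActive A T' → T ≤ T' then 1 else 0 := by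
  classical
  have hord : ∀ F, IsActiveOrdering G A T.toFinset F ↔ F.Perm T ∧ FullyActive A F := by
    intro F
    constructor
    · rintro ⟨h1, h2, h3⟩
      exact ⟨List.perm_of_nodup_nodup_toFinset_eq h1.nodup hT.nodup h2, h3⟩
    · rintro ⟨h1, h3⟩
      exact ⟨hT.perm h1.symm, List.toFinset_eq_of_perm _ _ h1, h3⟩
  have hset : {C : Finset (Fin n) | G.IsNClique T.length C ∧ ∃ F, IsActiveOrdering G A C F ∧
      (∀ F', IsActiveOrdering G A C F' → F ≤ F') ∧ T <+: F} =
      if FullyActive A T ∧ ∀ T', T'.Perm T → FullyActive A T' → T ≤ T' then {T.toFinset}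
      else ∅ := by
    ext C
    have hkey : (G.IsNClique T.length C ∧ ∃ F, IsActiveOrdering G A C F ∧
      (∀ F', IsActiveOrdering G A C F' → F ≤ F') ∧ T <+: F) ↔ C = T.toFinset ∧
        (FullyActive A T ∧ ∀ T', T'.Perm T → FullyActive A T' → T ≤ T') := by
      constructor
      · rintro ⟨hC, F, hF, hmin, hpre⟩
        have hTF : T = F := hpre.eq_of_length (by rw [hF.length_eq, hC.card_eq])
        subst hTF
        obtain rfl := hF.2.1
        exact ⟨rfl, hF.2.2, fun T' h1 h2 => hmin T' ((hord T').2 ⟨h1, h2⟩)⟩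
      · rintro ⟨rfl, h1, h2⟩
        exact ⟨hT.isNClique, T, (hord T).2 ⟨List.Perm.refl T, h1⟩,
          fun F' hF' => h2 F' ((hord F').1 hF').1 ((hord F').1 hF').2, List.prefix_rfl⟩
    rw [Set.mem_ofPred_eq, hkey]
    split_ifs with h
    · exact and_iff_left h
    · exact iff_of_false (fun h' => h h'.2) (Set.notMem_empty C)
  rw [prefixWeight, hset]
  split_ifs <;> simp

end Weights

/-! ### Laws and costs of the procedures -/

section Runs

variable {n : ℕ} {α β : Type}

/-- Every run of `p` takes `t` steps and `q` queries and returns a value, and the law of the value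
is `ν`. -/
def Runs (I : Instance n) (p : Prog n α) (ν : PMF α) (t q : ℕ) : Prop :=
  p.run I = ν.map fun a => ⟨some a, t, q⟩

theorem Prog.bind_eq (p : Prog n α) (g : α → Prog n β) : p >>= g = p.bind g := rfl

theorem Prog.pure_eq (a : α) : (pure a : Prog n α) = Prog.ret a := rfl

theorem Outcome.charge_comp_charge (t q t' q' : ℕ) :
    (Outcome.charge t q ∘ Outcome.charge t' q' : Outcome α → Outcome α) =
      Outcome.charge (t + t') (q + q') := by
  funext o
  simp [Outcome.charge, Nat.add_comm, Nat.add_left_comm]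

theorem Outcome.charge_zero : (Outcome.charge 0 0 : Outcome α → Outcome α) = id := rfl

/-- What remains to be run after a first part with outcome `o`. -/
def continueWith (I : Instance n) (g : α → Prog n β) (o : Outcome α) : PMF (Outcome β) :=
  match o.value with
  | none => PMF.pure ⟨none, o.time, o.queries⟩
  | some a => ((g a).run I).map (Outcome.charge o.time o.queries)

theorem continueWith_charge (I : Instance n) (g : α → Prog n β) (t q : ℕ) (o : Outcome α) :
    continueWith I g (o.charge t q) = (continueWith I g o).map (Outcome.charge t q) := by
  obtain ⟨_ | a, t', q'⟩ := o
  · simp [continueWith, Outcome.charge, PMF.pure_map]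
  · simp only [continueWith, Outcome.charge, PMF.map_comp]
    congr 1
    funext o
    simp [Outcome.charge, Nat.add_assoc]

/-- The semantics of sequential composition. -/
theorem Prog.run_bind (I : Instance n) (p : Prog n α) (g : α → Prog n β) :
    (p.bind g).run I = (p.run I).bind (continueWith I g) := by
  induction p with
  | ret a => simp [Prog.bind, Prog.run, continueWith, Outcome.charge_zero, PMF.map_id]
  | abort => simp [Prog.bind, Prog.run, continueWith]
  | tick c p ih =>
    simp only [Prog.bind, Prog.run, ih, PMF.map_bind, PMF.bind_map, Function.comp_def,
      continueWith_charge]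
  | deg v f ih =>
    simp only [Prog.bind, Prog.run, ih, PMF.map_bind, PMF.bind_map, Function.comp_def,
      continueWith_charge]
  | nbr v i f ih =>
    simp only [Prog.bind, Prog.run, ih, PMF.map_bind, PMF.bind_map, Function.comp_def,
      continueWith_charge]
  | pair u v f ih =>
    simp only [Prog.bind, Prog.run, ih, PMF.map_bind, PMF.bind_map, Function.comp_def,
      continueWith_charge]
  | oracle T f ih =>
    simp only [Prog.bind, Prog.run, ih, PMF.map_bind, PMF.bind_map, Function.comp_def,
      continueWith_charge]
  | unif m f ih =>
    simp only [Prog.bind, Prog.run]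
    split_ifs
    · simp only [ih, PMF.map_bind, PMF.bind_map, PMF.bind_bind, Function.comp_def,
        continueWith_charge]
    · simp [continueWith]
  | draws w s f ih =>
    simp only [Prog.bind, Prog.run]
    split_ifs
    · simp only [ih, PMF.map_bind, PMF.bind_map, Function.comp_def, continueWith_charge]
    · simp only [ih, PMF.map_bind, PMF.bind_map, PMF.bind_bind, Function.comp_def,
        continueWith_charge]
    · simp [continueWith]

theorem pmf_bind_congr {μ : PMF α} {f g : α → PMF β} (h : ∀ a ∈ μ.support, f a = g a) :
    μ.bind f = μ.bind g := by
  ext b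
  simp only [PMF.bind_apply]
  refine tsum_congr fun a => ?_
  by_cases ha : a ∈ μ.support
  · rw [h a ha]
  · simp [(PMF.apply_eq_zero_iff μ a).2 ha]

variable {I : Instance n}

theorem Runs.cast {p : Prog n α} {ν : PMF α} {t q t' q' : ℕ} (h : Runs I p ν t q) (ht : t = t')
    (hq : q = q') : Runs I p ν t' q' := by
  subst ht hq
  exact h

theorem Runs.run_bind {p : Prog n α} {ν : PMF α} {t q : ℕ} (h : Runs I p ν t q)
    (g : α → Prog n β) :
    (p >>= g).run I = ν.bind fun a => ((g a).run I).map (Outcome.charge t q) := by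
  rw [Prog.bind_eq, Prog.run_bind, h, PMF.bind_map]
  rfl

theorem map_charge_map (ν : PMF α) (t q t' q' : ℕ) :
    (ν.map fun a => (⟨some a, t', q'⟩ : Outcome α)).map (Outcome.charge t q) =
      ν.map fun a => ⟨some a, t + t', q + q'⟩ := by
  rw [PMF.map_comp]
  congr 1
  funext a
  simp [Outcome.charge, Nat.add_comm]

theorem Runs.ret (a : α) : Runs I (pure a) (PMF.pure a) 0 0 := by
  simp [Runs, Prog.pure_eq, Prog.run, PMF.pure_map]

theorem Runs.bind {p : Prog n α} {ν : PMF α} {t q : ℕ} (h : Runs I p ν t q) {g : α → Prog n β}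
    {κ : α → PMF β} {t' q' : ℕ} (hg : ∀ a ∈ ν.support, Runs I (g a) (κ a) t' q') :
    Runs I (p >>= g) (ν.bind κ) (t + t') (q + q') := by
  rw [Runs, h.run_bind, PMF.map_bind]
  refine pmf_bind_congr fun a ha => ?_
  rw [hg a ha, map_charge_map]

theorem Runs.bind_pure {p : Prog n α} {a : α} {t q : ℕ} (h : Runs I p (PMF.pure a) t q)
    {g : α → Prog n β} {κ : PMF β} {t' q' : ℕ} (hg : Runs I (g a) κ t' q') :
    Runs I (p >>= g) κ (t + t') (q + q') := by
  have := h.bind (g := g) (κ := fun _ => κ) (t' := t') (q' := q') (by simpa using hg)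
  rwa [PMF.pure_bind] at this

/-- A deterministic part followed by a return statement. -/
theorem Runs.bind_ret {p : Prog n α} {a : α} {t q : ℕ} (h : Runs I p (PMF.pure a) t q)
    {g : α → Prog n β} {b : β} (hg : g a = pure b) : Runs I (p >>= g) (PMF.pure b) t q :=
  h.bind_pure (hg ▸ Runs.ret b : Runs I (g a) (PMF.pure b) 0 0)

theorem Runs.tick {p : Prog n α} {ν : PMF α} {t q : ℕ} (h : Runs I p ν t q) (c : ℕ) :
    Runs I (.tick c p) ν (c + t) q := by
  rw [Runs, Prog.run, h, map_charge_map, Nat.zero_add]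

theorem Runs.deg {v : Fin n} {f : ℕ → Prog n α} {ν : PMF α} {t q : ℕ}
    (h : Runs I (f (I.adj v).length) ν t q) : Runs I (.deg v f) ν (1 + t) (1 + q) := by
  rw [Runs, Prog.run, h, map_charge_map]

theorem Runs.nbr {v : Fin n} {i : ℕ} {f : Option (Fin n) → Prog n α} {ν : PMF α} {t q : ℕ}
    (h : Runs I (f (I.adj v)[i]?) ν t q) : Runs I (.nbr v i f) ν (1 + t) (1 + q) := by
  rw [Runs, Prog.run, h, map_charge_map]

open Classical in
theorem Runs.pair {u v : Fin n} {f : Bool → Prog n α} {ν : PMF α} {t q : ℕ}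
    (h : Runs I (f (decide (I.G.Adj u v))) ν t q) : Runs I (.pair u v f) ν (1 + t) (1 + q) := by
  rw [Runs, Prog.run, h, map_charge_map]

open Classical in
theorem Runs.oracle {T : List (Fin n)} {f : Bool → Prog n α} {ν : PMF α} {t q : ℕ}
    (h : Runs I (f (decide (T ∈ I.A))) ν t q) :
    Runs I (.oracle T f) ν (I.oracleTime T + t) (I.oracleQueries T + q) := by
  rw [Runs, Prog.run, h, map_charge_map]

theorem Runs.unif {m : ℕ} (hm : ∑' _ : Fin m, ((1 : ℕ) : ℝ≥0∞) ≠ 0) {f : Fin m → Prog n α}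
    {κ : Fin m → PMF α} {t q : ℕ} (h : ∀ i, Runs I (f i) (κ i) t q) :
    Runs I (.unif m f) ((weighted (fun _ : Fin m => 1) hm).bind κ) (1 + t) q := by
  rw [Runs, Prog.run, dif_pos hm, PMF.map_bind, PMF.map_bind]
  refine pmf_bind_congr fun i _ => ?_
  rw [h i, map_charge_map, Nat.zero_add]

theorem Runs.draws {m s : ℕ} {w : Fin m → ℕ} (hs : s ≠ 0) (hw : ∑' i, (w i : ℝ≥0∞) ≠ 0)
    {f : List (Fin m) → Prog n α} {κ : List (Fin m) → PMF α} {t q : ℕ}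
    (h : ∀ l ∈ (iidList (weighted w hw) s).support, Runs I (f l) (κ l) t q) :
    Runs I (.draws w s f) ((iidList (weighted w hw) s).bind κ) (m + s + t) q := by
  rw [Runs, Prog.run, if_neg hs, dif_pos hw, PMF.map_bind, PMF.map_bind]
  refine pmf_bind_congr fun l hl => ?_
  rw [h l hl, map_charge_map, Nat.zero_add]

theorem Runs.draws_zero {m : ℕ} {w : Fin m → ℕ} {f : List (Fin m) → Prog n α} {ν : PMF α}
    {t q : ℕ} (h : Runs I (f []) ν t q) : Runs I (.draws w 0 f) ν (m + t) q := by
  rw [Runs, Prog.run, if_pos rfl, h, map_charge_map, Nat.zero_add]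

end Runs

section Degrees

variable {n : ℕ} (I : Instance n)

/-- The value returned by `minDegVertex`. -/
def leastDeg : List (Fin n) → Option (ℕ × Fin n)
  | [] => none
  | v :: T => some (match leastDeg T with
    | none => ((I.adj v).length, v)
    | some b => better ((I.adj v).length, v) b)

/-- The degree `d(T)` of an ordered clique, with the convention `d([]) = n`. -/
def cliqueDeg (T : List (Fin n)) : ℕ := (leastDeg I T).elim n Prod.fst

theorem leastDeg_spec {T : List (Fin n)} {d : ℕ} {u : Fin n} (h : leastDeg I T = some (d, u)) :
    d = (I.adj u).length ∧ u ∈ T ∧ ∀ v ∈ T, d ≤ (I.adj v).length := by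
  induction T generalizing d u with
  | nil => simp [leastDeg] at h
  | cons v T ih =>
    simp only [leastDeg, Option.some.injEq] at h
    cases hT : leastDeg I T with
    | none =>
      have hnil : T = [] := by
        cases T with
        | nil => rfl
        | cons w T => simp [leastDeg] at hT
      subst hnil
      simp only [hT, Prod.mk.injEq] at h
      obtain ⟨rfl, rfl⟩ := h
      simp
    | some b =>
      obtain ⟨d', u'⟩ := b
      obtain ⟨h1, h2, h3⟩ := ih hT
      simp only [hT, better] at h
      split_ifs at h with hc
      · simp only [Prod.mk.injEq] at h
        obtain ⟨rfl, rfl⟩ := h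
        refine ⟨h1, List.mem_cons_of_mem _ h2, fun w hw => ?_⟩
        rcases List.mem_cons.1 hw with rfl | hw
        · rcases hc with hc | hc
          · exact hc.le
          · exact hc.1.le
        · exact h3 w hw
      · simp only [Prod.mk.injEq] at h
        obtain ⟨rfl, rfl⟩ := h
        refine ⟨rfl, by simp, fun w hw => ?_⟩
        rcases List.mem_cons.1 hw with rfl | hw
        · exact le_rfl
        · push Not at hc
          exact hc.1.trans (h3 w hw)

theorem exists_leastDeg {T : List (Fin n)} (hT : T ≠ []) : ∃ d u, leastDeg I T = some (d, u) := by
  cases T with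
  | nil => exact absurd rfl hT
  | cons v T => exact ⟨_, _, rfl⟩

theorem length_adj [∀ v, Fintype (I.G.neighborSet v)] (v : Fin n) :
    (I.adj v).length = I.G.degree v := by
  rw [← SimpleGraph.card_neighborFinset_eq_degree, ← List.toFinset_card_of_nodup (I.adj_nodup v)]
  congr 1
  ext w
  simp [I.mem_adj]

/-- The degree of an ordered clique is the least degree of its vertices. -/
theorem cliqueDeg_le [∀ v, Fintype (I.G.neighborSet v)] {T : List (Fin n)} {v : Fin n}
    (hv : v ∈ T) : cliqueDeg I T ≤ I.G.degree v := by
  obtain ⟨d, u, h⟩ := exists_leastDeg I (List.ne_nil_of_mem hv)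
  rw [← length_adj, cliqueDeg, h]
  exact (leastDeg_spec I h).2.2 v hv

theorem runs_minDegVertex (T : List (Fin n)) :
    Runs I (minDegVertex T) (PMF.pure (leastDeg I T)) (2 * T.length) T.length := by
  induction T with
  | nil => exact Runs.ret _
  | cons v T ih =>
    refine Runs.cast (Runs.deg (Runs.tick (ih.bind_ret ?_) 1)) ?_ ?_
    · rfl
    all_goals rw [List.length_cons]; omega

theorem runs_cliqueDegrees {t : ℕ} {R : List (List (Fin n))} (hR : ∀ T ∈ R, T.length = t)
    (ht : t ≠ 0) :
    Runs I (cliqueDegrees R) (PMF.pure (R.map (cliqueDeg I))) (R.length * (1 + 2 * t))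
      (R.length * t) := by
  induction R with
  | nil => exact (Runs.ret _).cast (by simp) (by simp)
  | cons T R ih =>
    have hT : T.length = t := hR T (by simp)
    have hne : T ≠ [] := by
      rintro rfl
      exact ht hT.symm
    obtain ⟨d, u, h⟩ := exists_leastDeg I hne
    have h1 := runs_minDegVertex I T
    rw [h] at h1
    have h2 := ih fun T hT => hR T (List.mem_cons_of_mem _ hT)
    have h4 : (T :: R).map (cliqueDeg I) = d :: R.map (cliqueDeg I) := by
      simp [cliqueDeg, h]
    rw [h4]
    refine Runs.cast (Runs.tick (h1.bind_pure (h2.bind_ret ?_)) 1) ?_ ?_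
    · rfl
    all_goals rw [hT, List.length_cons]; ring

open Classical in
theorem runs_adjacentToAll (v : Fin n) (T : List (Fin n)) :
    Runs I (adjacentToAll v T) (PMF.pure (decide (∀ u ∈ T, I.G.Adj u v))) T.length T.length := by
  induction T with
  | nil => simpa [adjacentToAll] using Runs.ret (I := I) true
  | cons u T ih =>
    refine Runs.cast (Runs.pair (ih.bind_ret ?_)) ?_ ?_
    · simp
    all_goals rw [List.length_cons, Nat.add_comm]

theorem isOrderedClique_snoc {G : SimpleGraph (Fin n)} {T : List (Fin n)} {v : Fin n} :
    IsOrderedClique G (T ++ [v]) ↔ IsOrderedClique G T ∧ ∀ u ∈ T, G.Adj u v := by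
  simp [IsOrderedClique, List.pairwise_append]

open Classical in
/-- The law of the result of `extend`.  For the empty list, this is a uniform vertex, so that the
sampling of the first level becomes an instance of the sampling of the later ones. -/
def extendLaw (T : List (Fin n)) : PMF (Option (List (Fin n))) :=
  match leastDeg I T with
  | none =>
    if h : ∑' _ : Fin n, ((1 : ℕ) : ℝ≥0∞) ≠ 0 then
      (weighted (fun _ : Fin n => 1) h).map fun v : Fin n => some [v]
    else PMF.pure none
  | some (d, u) =>
    if h : ∑' _ : Fin d, ((1 : ℕ) : ℝ≥0∞) ≠ 0 then
      (weighted (fun _ : Fin d => 1) h).map fun i : Fin d => (I.adj u)[(i : ℕ)]?.bind fun v =>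
        if IsOrderedClique I.G (T ++ [v]) then some (T ++ [v]) else none
    else PMF.pure none

theorem tsum_one_ne_zero {d : ℕ} (hd : d ≠ 0) : ∑' _ : Fin d, ((1 : ℕ) : ℝ≥0∞) ≠ 0 := by
  simpa using hd

open Classical in
theorem runs_extend {T : List (Fin n)} (hne : T ≠ []) (hT : IsOrderedClique I.G T)
    (hd : cliqueDeg I T ≠ 0) :
    Runs I (extend T) (extendLaw I T) (3 * T.length + 2) (2 * T.length + 1) := by
  obtain ⟨d, u, h⟩ := exists_leastDeg I hne
  have hd' : d ≠ 0 := by simpa [cliqueDeg, h] using hd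
  have h1 := runs_minDegVertex I T
  rw [h] at h1
  rw [extendLaw, h]
  simp only
  rw [dif_pos (tsum_one_ne_zero hd'), ← PMF.bind_pure_comp]
  unfold extend
  refine (h1.bind_pure (t' := 1 + (1 + T.length)) (q' := 1 + T.length)
    (Runs.unif _ fun i => ?_)).cast (by omega) (by omega)
  have hi : (i : ℕ) < (I.adj u).length := by
    rw [← (leastDeg_spec I h).1]
    exact i.2
  refine Runs.nbr ?_
  rw [Function.comp_apply, List.getElem?_eq_getElem hi]
  exact (runs_adjacentToAll I _ T).bind_ret (by simp [isOrderedClique_snoc, hT])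

open Classical in
/-- The law of one sample taken by `sampleSet R`. -/
def stepLaw (R : List (List (Fin n))) : PMF (Option (List (Fin n))) :=
  if h : ∑' i : Fin R.length, (((R.map (cliqueDeg I)).getD i 0 : ℕ) : ℝ≥0∞) ≠ 0 then
    (weighted _ h).bind fun i => extendLaw I (R.get i)
  else PMF.pure none

/-- The sum `d(R)` of the degrees of the members of `R`. -/
def totalDeg (R : List (List (Fin n))) : ℕ := (R.map (cliqueDeg I)).sum

theorem sum_getD (R : List (List (Fin n))) (f : List (Fin n) → ℕ) :
    ∑ i : Fin R.length, (R.map f).getD i 0 = (R.map f).sum := by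
  rw [← Fin.sum_univ_fun_getElem]
  exact Finset.sum_congr rfl fun i _ => by simp

theorem tsum_getD_ne_zero {R : List (List (Fin n))} (h : totalDeg I R ≠ 0) :
    ∑' i : Fin R.length, (((R.map (cliqueDeg I)).getD i 0 : ℕ) : ℝ≥0∞) ≠ 0 := by
  rw [tsum_fintype, ← Nat.cast_sum, sum_getD]
  exact_mod_cast h

/-- The trials made by `extendAll` are independent: the law of their results is the product of the
laws `extendLaw I T`, of which the failed trials are then dropped. -/
theorem runs_extendAll {t : ℕ} (ht : t ≠ 0) {L : List (List (Fin n))}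
    (hL : ∀ T ∈ L, T.length = t ∧ IsOrderedClique I.G T ∧ cliqueDeg I T ≠ 0) :
    ∃ ν : PMF (List (Option (List (Fin n)))),
      ν = L.foldr (fun T ν => (extendLaw I T).bind fun o => ν.map fun l => o :: l) (PMF.pure []) ∧
      Runs I (extendAll L) (ν.map List.reduceOption) (L.length * (3 * t + 3))
        (L.length * (2 * t + 1)) := by
  refine ⟨_, rfl, ?_⟩
  induction L with
  | nil => simpa [extendAll, PMF.pure_map] using Runs.ret (I := I) ([] : List (List (Fin n)))
  | cons T L ih =>
    obtain ⟨hT, hcl, hd⟩ := hL T (by simp)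
    have hne : T ≠ [] := by
      rintro rfl
      exact ht hT.symm
    have h1 := runs_extend I hne hcl hd
    have h2 := ih fun T hT => hL T (List.mem_cons_of_mem _ hT)
    have h3 := (h1.bind (g := fun r => extendAll L >>= fun R => pure (match r with
      | none => R
      | some T' => T' :: R)) fun o _ => h2.bind fun R _ => Runs.ret _).tick 1
    simp only [List.foldr_cons, PMF.map_bind, PMF.map_comp]
    have h4 : ∀ (o : Option (List (Fin n))) (ν : PMF (List (Option (List (Fin n))))),
        ν.map (List.reduceOption ∘ fun l => o :: l) = (ν.map List.reduceOption).bind fun R =>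
          PMF.pure (match o with
            | none => R
            | some T' => T' :: R) := by
      intro o ν
      rw [PMF.bind_map, ← PMF.bind_pure_comp]
      congr 1
      funext l
      cases o <;> simp
    simp only [h4]
    refine Runs.cast h3 ?_ ?_ <;> rw [hT, List.length_cons] <;> ring

/-- `sampleSet R s` consists of `s` independent samples from `stepLaw I R`, of which the failed ones
are dropped.  If all the weights are zero, then nothing may be drawn. -/
theorem runs_sampleSet {t s : ℕ} (ht : t ≠ 0) {R : List (List (Fin n))}
    (hR : ∀ T ∈ R, T.length = t ∧ IsOrderedClique I.G T) (hs : totalDeg I R = 0 → s = 0) :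
    Runs I (sampleSet R s) ((iidList (stepLaw I R) s).map List.reduceOption)
      (R.length * (1 + 2 * t) + (R.length + s + s * (3 * t + 3)))
      (R.length * t + s * (2 * t + 1)) := by
  refine (runs_cliqueDegrees I (fun T hT => (hR T hT).1) ht).bind_pure ?_
  by_cases h0 : s = 0
  · subst h0
    have h : Runs I (extendAll ([] : List (List (Fin n)))) (PMF.pure []) 0 0 := Runs.ret _
    simp only [iidList, PMF.pure_map, List.reduceOption_nil]
    exact Runs.cast (Runs.draws_zero h) (by simp) (by simp)
  · have hw := tsum_getD_ne_zero I fun h => h0 (hs h)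
    rw [stepLaw, dif_pos hw]
    have hmem : ∀ i ∈ (weighted _ hw).support, cliqueDeg I (R.get i) ≠ 0 := by
      intro i hi
      rw [weighted, PMF.mem_support_normalize_iff] at hi
      intro h
      apply hi
      simp at h
      simp [h]
    have hfold : ∀ s, (iidList (weighted _ hw) s).bind (fun l => (l.map R.get).foldr
        (fun T ν => (extendLaw I T).bind fun o => ν.map fun l => o :: l) (PMF.pure [])) =
        iidList ((weighted _ hw).bind fun i => extendLaw I (R.get i)) s := by
      intro s
      induction s with
      | zero => simp [iidList]
      | succ s ih =>
        simp only [iidList, PMF.bind_bind, PMF.bind_map, Function.comp_def, List.map_cons,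
          List.foldr_cons]
        congr 1
        funext i
        rw [PMF.bind_comm]
        congr 1
        funext o
        rw [← PMF.map_bind, ih]
    rw [← hfold s, PMF.map_bind]
    refine Runs.draws h0 hw fun l hl => ?_
    have hlen := length_of_mem_support_iidList hl
    have hsupp := mem_support_of_mem_iidList hl
    obtain ⟨ν, rfl, hν⟩ := runs_extendAll I ht (L := l.map R.get) (by
      intro T hT
      obtain ⟨i, hi, rfl⟩ := List.mem_map.1 hT
      have := hR (R.get i) (List.get_mem _ _)
      exact ⟨this.1, this.2, hmem i (hsupp i hi)⟩)
    rw [List.length_map, hlen] at hν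
    exact hν

end Degrees

section Assigned

variable {n : ℕ} (I : Instance n)

open Classical in
theorem runs_allActive (L : List (List (Fin n))) :
    Runs I (allActive L) (PMF.pure (decide (∀ T ∈ L, T ∈ I.A)))
      (L.length + (L.map I.oracleTime).sum) (L.map I.oracleQueries).sum := by
  induction L with
  | nil => simpa [allActive] using Runs.ret (I := I) true
  | cons T L ih =>
    refine Runs.cast (Runs.tick (Runs.oracle (ih.bind_ret ?_)) 1) ?_ ?_
    · simp
    · simp only [List.length_cons, List.map_cons, List.sum_cons]
      ring
    · simp

/-- The number of steps of a check whether `T` is fully active. -/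
def activeTime (T : List (Fin n)) : ℕ :=
  T.length + 1 + (T.length + ((prefixes T).map I.oracleTime).sum)

/-- The number of queries of a check whether `T` is fully active. -/
def activeQueries (T : List (Fin n)) : ℕ := ((prefixes T).map I.oracleQueries).sum

theorem length_prefixes (T : List (Fin n)) : (prefixes T).length = T.length := by
  simp [prefixes]

theorem fullyActive_iff {A : Set (List (Fin n))} {T : List (Fin n)} :
    FullyActive A T ↔ ∀ T' ∈ prefixes T, T' ∈ A := by
  simp only [FullyActive, prefixes, List.mem_map, List.mem_range, forall_exists_index, and_imp,
    forall_apply_eq_imp_iff₂]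
  constructor
  · exact fun h j hj => h (j + 1) (by omega) hj
  · intro h j hj hj'
    obtain ⟨i, rfl⟩ : ∃ i, j = i + 1 := ⟨j - 1, by omega⟩
    exact h i hj'

open Classical in
theorem runs_activeOnes (L : List (List (Fin n))) :
    Runs I (activeOnes L) (PMF.pure (L.filter fun T => FullyActive I.A T))
      (L.map (activeTime I)).sum (L.map (activeQueries I)).sum := by
  induction L with
  | nil => exact Runs.ret _
  | cons T L ih =>
    refine Runs.cast (Runs.tick ((runs_allActive I (prefixes T)).bind_pure (ih.bind_ret ?_)) _)
      ?_ ?_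
    · simp only [← fullyActive_iff, List.filter_cons]
    · simp only [activeTime, List.map_cons, List.sum_cons]
      rw [length_prefixes]
      ring
    · simp [activeQueries]

/-- The procedure computes the weight of an ordered clique of full length. -/
theorem runs_isAssigned {T : List (Fin n)} (hT : IsOrderedClique I.G T) :
    Runs I (isAssigned T) (PMF.pure (prefixWeight I.G I.A T.length T))
      (T.permutations.map (activeTime I)).sum (T.permutations.map (activeQueries I)).sum := by
  classical
  refine (runs_activeOnes I T.permutations).bind_ret ?_
  rw [prefixWeight_of_length_eq hT]
  congr 1
  refine if_congr ?_ rfl rfl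
  simp only [List.mem_filter, List.mem_permutations, List.Perm.refl, true_and, decide_eq_true_eq,
    and_imp]

/-- The number of steps of `countAssigned R`. -/
def countTime (R : List (List (Fin n))) : ℕ :=
  (R.map fun T => 1 + (T.permutations.map (activeTime I)).sum).sum

/-- The number of queries of `countAssigned R`. -/
def countQueries (R : List (List (Fin n))) : ℕ :=
  (R.map fun T => (T.permutations.map (activeQueries I)).sum).sum

theorem runs_countAssigned {k : ℕ} {R : List (List (Fin n))}
    (hR : ∀ T ∈ R, T.length = k ∧ IsOrderedClique I.G T) :
    Runs I (countAssigned R) (PMF.pure (R.map (prefixWeight I.G I.A k)).sum)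
      (countTime I R) (countQueries I R) := by
  induction R with
  | nil => exact Runs.ret _
  | cons T R ih =>
    obtain ⟨h1, h2⟩ := hR T (by simp)
    have h3 := runs_isAssigned I h2
    rw [h1] at h3
    refine Runs.cast (Runs.tick (h3.bind_pure
      ((ih fun T hT => hR T (List.mem_cons_of_mem _ hT)).bind_ret ?_)) 1) ?_ ?_
    · simp
    · simp only [countTime, List.map_cons, List.sum_cons]
      ring
    · simp [countQueries]

theorem sum_map_le {β : Type} {L : List β} {f : β → ℕ} {c : ℕ} (h : ∀ b ∈ L, f b ≤ c) :
    (L.map f).sum ≤ L.length * c := by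
  have := List.sum_le_card_nsmul (L.map f) c (by simpa using h)
  simpa using this

theorem countTime_le {k ρ : ℕ} (hρ : ∀ T, I.oracleTime T ≤ ρ) {R : List (List (Fin n))}
    (hR : ∀ T ∈ R, T.length = k) :
    countTime I R ≤ R.length * (1 + k ! * (k + 1 + (k + k * ρ))) := by
  refine sum_map_le fun T hT => ?_
  have h1 : ∀ T' ∈ T.permutations, activeTime I T' ≤ k + 1 + (k + k * ρ) := by
    intro T' hT'
    have hlen : T'.length = k := by
      rw [(List.mem_permutations.1 hT').length_eq, hR T hT]
    have h2 : ((prefixes T').map I.oracleTime).sum ≤ k * ρ := by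
      have := sum_map_le (L := prefixes T') fun T _ => hρ T
      rwa [length_prefixes, hlen] at this
    rw [activeTime, hlen]
    omega
  have h2 := sum_map_le h1
  rw [List.length_permutations, hR T hT] at h2
  omega

theorem countQueries_le {k q : ℕ} (hq : ∀ T, I.oracleQueries T ≤ q) {R : List (List (Fin n))}
    (hR : ∀ T ∈ R, T.length = k) :
    countQueries I R ≤ R.length * (k ! * (k * q)) := by
  refine sum_map_le fun T hT => ?_
  have h1 : ∀ T' ∈ T.permutations, activeQueries I T' ≤ k * q := by
    intro T' hT'
    have hlen : T'.length = k := by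
      rw [(List.mem_permutations.1 hT').length_eq, hR T hT]
    have := sum_map_le (L := prefixes T') fun T _ => hq T
    rwa [length_prefixes, hlen] at this
  have h2 := sum_map_le h1
  rwa [List.length_permutations, hR T hT] at h2

end Assigned

/-! ### The main loop -/

section Levels

variable {n : ℕ} (I : Instance n) (P : Params) (up : Bool) (nk : ℕ)

theorem run_abort_tick {α : Type} (t : ℕ) :
    (Prog.tick t (Prog.abort : Prog n α)).run I = PMF.pure ⟨none, t, 0⟩ := by
  simp [Prog.run, PMF.pure_map, Outcome.charge]

open Classical in
theorem run_finish {k : ℕ} {R : List (List (Fin n))}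
    (hR : ∀ T ∈ R, T.length = k ∧ IsOrderedClique I.G T) (D S : ℝ) :
    (finish P up nk R D S).run I =
      if exceeds up R.length (P.finalLimit nk) then PMF.pure ⟨none, 1, 0⟩
      else PMF.pure ⟨some (D / S * ((R.map (prefixWeight I.G I.A k)).sum : ℕ)),
        1 + countTime I R, countQueries I R⟩ := by
  unfold finish
  split_ifs with h
  · exact run_abort_tick I 1
  · have := Runs.tick ((runs_countAssigned I hR).bind_ret
      (g := fun c => (pure (D / S * (c : ℝ)) : Prog n ℝ)) rfl) 1
    rw [Runs, PMF.pure_map] at this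
    exact this

theorem sampleSize_zero_deg (t : ℕ) (w : ℝ) : P.sampleSize t 0 w = 0 := by
  simp [Params.sampleSize]

open Classical in
/-- One iteration of the main loop: the law of the new sample, and the costs. -/
theorem run_levels_succ {t : ℕ} (ht : t ≠ 0) {R : List (List (Fin n))}
    (hR : ∀ T ∈ R, T.length = t ∧ IsOrderedClique I.G T) (r : ℕ) (w : ℝ) (d s : ℕ) (D S : ℝ) :
    (levels P up nk (r + 1) t R w d s D S).run I =
      if exceeds up (P.sampleSize t (totalDeg I R) ((1 - P.γ) * (w / d) * s)) (P.sizeLimit t) then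
        PMF.pure ⟨none, R.length * (1 + 2 * t) + 1, R.length * t⟩
      else
        (iidList (stepLaw I R)
          (P.sampleSize t (totalDeg I R) ((1 - P.γ) * (w / d) * s))).bind fun l =>
          ((levels P up nk r (t + 1) l.reduceOption ((1 - P.γ) * (w / d) * s) (totalDeg I R)
            (P.sampleSize t (totalDeg I R) ((1 - P.γ) * (w / d) * s)) (D * totalDeg I R)
            (S * P.sampleSize t (totalDeg I R) ((1 - P.γ) * (w / d) * s))).run I).map
          (Outcome.charge (R.length * (1 + 2 * t) + 1 + (R.length * (1 + 2 * t) + (R.length +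
              P.sampleSize t (totalDeg I R) ((1 - P.γ) * (w / d) * s) +
              P.sampleSize t (totalDeg I R) ((1 - P.γ) * (w / d) * s) * (3 * t + 3))))
            (R.length * t + (R.length * t +
              P.sampleSize t (totalDeg I R) ((1 - P.γ) * (w / d) * s) * (2 * t + 1)))) := by
  have h1 := runs_cliqueDegrees I (fun T hT => (hR T hT).1) ht
  rw [levels, h1.run_bind, PMF.pure_bind]
  change PMF.map _ (Prog.run I (.tick 1 (if exceeds up (P.sampleSize t (totalDeg I R) _) _
    then _ else _))) = _
  split_ifs with h
  · rw [run_abort_tick, PMF.pure_map, Outcome.charge, Nat.add_comm 1, Nat.zero_add]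
  · have h2 := runs_sampleSet (I := I) ht hR (s := P.sampleSize t (totalDeg I R)
      ((1 - P.γ) * (w / d) * s)) (fun h0 => by rw [h0, sampleSize_zero_deg])
    have hdef : (R.map (cliqueDeg I)).sum = totalDeg I R := rfl
    rw [Prog.run, hdef, h2.run_bind, PMF.bind_map, PMF.map_bind, PMF.map_bind]
    congr 1
    funext l
    simp only [Function.comp_apply, PMF.map_comp, Outcome.charge_comp_charge, Nat.zero_add,
      Nat.add_assoc]

theorem stepLaw_singleton (T : List (Fin n)) (hT : cliqueDeg I T ≠ 0) :
    stepLaw I [T] = extendLaw I T := by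
  have h := tsum_getD_ne_zero I (R := [T]) (by simpa [totalDeg] using hT)
  rw [stepLaw, dif_pos h]
  have : ∀ i : Fin [T].length, extendLaw I ([T].get i) = extendLaw I T := fun i => by
    congr 1
    simp
  simp only [this, PMF.bind_const]

/-- Uniform vertices are samples of the same kind as those of the later levels, taken from the
sample `R_0` that consists of the empty list alone. -/
theorem runs_sampleVertices {s : ℕ} (h : n = 0 → s = 0) :
    Runs I (sampleVertices n s) ((iidList (stepLaw I [[]]) s).map List.reduceOption) s 0 := by
  induction s with
  | zero =>
    simp only [iidList, PMF.pure_map, List.reduceOption_nil]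
    exact Runs.ret _
  | succ s ih =>
    have hn : n ≠ 0 := fun h0 => by simpa using h h0
    have hstep : stepLaw I [[]] = extendLaw I [] := stepLaw_singleton I [] (by
      simpa [cliqueDeg, leastDeg] using hn)
    have h1 : ∀ v : Fin n, Runs I (sampleVertices n s >>= fun R => pure ([v] :: R))
        (((iidList (stepLaw I [[]]) s).map List.reduceOption).bind fun R =>
          PMF.pure ([v] :: R)) (s + 0) (0 + 0) := fun v =>
      (ih fun h0 => absurd h0 hn).bind fun R _ => Runs.ret _
    have h2 := Runs.unif (tsum_one_ne_zero hn) h1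
    rw [iidList, PMF.map_bind]
    nth_rewrite 1 [hstep]
    rw [extendLaw, leastDeg]
    simp only
    rw [dif_pos (tsum_one_ne_zero hn), PMF.bind_map]
    have heq : ∀ v : Fin n, ((iidList (stepLaw I [[]]) s).map List.reduceOption).bind
        (fun R => PMF.pure ([v] :: R)) = PMF.map List.reduceOption
          ((iidList (stepLaw I [[]]) s).map fun l => some [v] :: l) := fun v => by
      rw [PMF.map_comp, PMF.bind_map, ← PMF.bind_pure_comp]
      rfl
    simp only [heq] at h2
    exact h2.cast (Nat.add_comm 1 s) rfl

theorem approxLaw_eq : approxLaw I P up =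
    (iidList (stepLaw I [[]]) (P.sampleSize 0 n ((1 - P.ε / 2) * P.nt))).bind fun l =>
      ((levels P up (numCliques I.G P.k) (P.k - 1) 1 l.reduceOption ((1 - P.ε / 2) * P.nt) n
        (P.sampleSize 0 n ((1 - P.ε / 2) * P.nt)) n
        (P.sampleSize 0 n ((1 - P.ε / 2) * P.nt))).run I).map
      (Outcome.charge (P.sampleSize 0 n ((1 - P.ε / 2) * P.nt)) 0) := by
  have h := runs_sampleVertices I (s := P.sampleSize 0 n ((1 - P.ε / 2) * P.nt))
    (fun h0 => by subst h0; exact sampleSize_zero_deg P 0 _)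
  rw [approxLaw, approx, h.run_bind, PMF.bind_map]
  rfl

open Classical in
/-- The sum of `g` over the ordered cliques that extend `T` by one vertex. -/
def extSum {M : Type} [AddCommMonoid M] (G : SimpleGraph (Fin n)) (g : List (Fin n) → M)
    (T : List (Fin n)) : M :=
  ∑ v, if IsOrderedClique G (T ++ [v]) then g (T ++ [v]) else 0

theorem mean_uniform {d : ℕ} (h : ∑' _ : Fin d, ((1 : ℕ) : ℝ≥0∞) ≠ 0) (f : Fin d → ℝ≥0∞) :
    (d : ℝ≥0∞) * mean (weighted (fun _ : Fin d => 1) h) f = ∑ i, f i := by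
  simpa using mean_weighted (fun _ : Fin d => 1) h f

open Classical in
/-- Each extension of `T` is found with probability `1 / d(T)`, because every common neighbor of `T`
is a neighbor of the least-degree vertex. -/
theorem mean_extendLaw {T : List (Fin n)} (hT : IsOrderedClique I.G T)
    (g : List (Fin n) → ℝ≥0∞) :
    (cliqueDeg I T : ℝ≥0∞) * mean (extendLaw I T) (fun o => o.elim 0 g) = extSum I.G g T := by
  cases T with
  | nil =>
    simp only [cliqueDeg, extendLaw, leastDeg, Option.elim_none]
    by_cases hn : n = 0
    · subst hn
      simp [extSum]
    · rw [dif_pos (tsum_one_ne_zero hn), mean_map, mean_uniform]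
      simp [extSum, IsOrderedClique]
  | cons w T =>
    obtain ⟨d, u, h⟩ := exists_leastDeg I (List.cons_ne_nil w T)
    obtain ⟨hd, hu, -⟩ := leastDeg_spec I h
    rw [cliqueDeg, extendLaw, h, Option.elim_some]
    simp only
    have hsum : extSum I.G g (w :: T) = ∑ v ∈ (I.adj u).toFinset,
        if IsOrderedClique I.G (w :: T ++ [v]) then g (w :: T ++ [v]) else 0 := by
      symm
      refine Finset.sum_subset (Finset.subset_univ _) fun v _ hv => if_neg fun hc => hv ?_
      rw [List.mem_toFinset, I.mem_adj]
      exact (isOrderedClique_snoc.1 hc).2 u hu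
    rw [hsum, List.sum_toFinset _ (I.adj_nodup u), ← Fin.sum_univ_fun_getElem]
    by_cases hd0 : d = 0
    · rw [dif_neg (by simp [hd0])]
      rw [hd0] at hd
      have := List.length_eq_zero_iff.1 hd.symm
      rw [hd0, Nat.cast_zero, zero_mul]
      exact (Finset.sum_eq_zero fun i _ => absurd i.2 (by simp [this])).symm
    · rw [dif_pos (tsum_one_ne_zero hd0), mean_map, mean_uniform]
      subst hd
      refine Finset.sum_congr rfl fun i _ => ?_
      rw [List.getElem?_eq_getElem i.2, Option.bind_some]
      split_ifs <;> simp

/-- A sample has the right mean: the expectation of `g` is `1 / d(R)` times the sum of `g` over the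
ordered cliques that extend a member of `R` by one vertex. -/
theorem mean_stepLaw {R : List (List (Fin n))} (hR : ∀ T ∈ R, IsOrderedClique I.G T)
    (g : List (Fin n) → ℝ≥0∞) :
    (totalDeg I R : ℝ≥0∞) * mean (stepLaw I R) (fun o => o.elim 0 g) =
      (R.map (extSum I.G g)).sum := by
  have hsum : ∑ i : Fin R.length, (((R.map (cliqueDeg I)).getD i 0 : ℕ) : ℝ≥0∞) *
      mean (extendLaw I (R.get i)) (fun o => o.elim 0 g) = (R.map (extSum I.G g)).sum := by
    rw [← Fin.sum_univ_fun_getElem]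
    refine Finset.sum_congr rfl fun i _ => ?_
    have := mean_extendLaw I (hR _ (List.get_mem R i)) g
    simpa using this
  by_cases h : totalDeg I R = 0
  · rw [← hsum, h]
    rw [totalDeg, ← sum_getD, Finset.sum_eq_zero_iff] at h
    rw [Nat.cast_zero, zero_mul]
    exact (Finset.sum_eq_zero fun i hi => by rw [h i hi, Nat.cast_zero, zero_mul]).symm
  · have hw := tsum_getD_ne_zero I h
    rw [stepLaw, dif_pos hw, mean_bind, ← hsum, ← mean_weighted _ hw, ← Nat.cast_sum, sum_getD]
    rfl

theorem mem_support_stepLaw {R : List (List (Fin n))} {T' : List (Fin n)}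
    (h : some T' ∈ (stepLaw I R).support) :
    IsOrderedClique I.G T' ∧ ∃ T ∈ R, T'.length = T.length + 1 := by
  classical
  have hext : ∀ T, some T' ∈ (extendLaw I T).support → IsOrderedClique I.G T' ∧
      T'.length = T.length + 1 := by
    intro T hT
    rw [extendLaw] at hT
    split at hT
    · rename_i h0
      have hnil : T = [] := by
        by_contra hne
        obtain ⟨d, u, h1⟩ := exists_leastDeg I hne
        simp [h1] at h0
      split_ifs at hT with h1
      · obtain ⟨v, -, hv⟩ := (PMF.mem_support_map_iff _ _ _).1 hT
        obtain rfl := Option.some_injective _ hv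
        simp [hnil, IsOrderedClique]
      · simp at hT
    · split_ifs at hT with h1
      · obtain ⟨i, -, hi⟩ := (PMF.mem_support_map_iff _ _ _).1 hT
        obtain ⟨v, -, hv⟩ := Option.bind_eq_some_iff.1 hi
        split_ifs at hv with hc
        obtain rfl := Option.some_injective _ hv
        exact ⟨hc, by simp⟩
      · simp at hT
  rw [stepLaw] at h
  split_ifs at h with hw
  · obtain ⟨i, -, hi⟩ := (PMF.mem_support_bind_iff _ _ _).1 h
    exact ⟨(hext _ hi).1, _, List.get_mem R i, (hext _ hi).2⟩
  · simp at h

end Levels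

/-! ### The algorithm as a process on the samples -/

section Samples

variable {n : ℕ} (I : Instance n) (P : Params) (up : Bool) (nk : ℕ)

/-- The lower estimate of the total weight from which the algorithm starts. -/
def Params.w₀ (P : Params) : ℝ := (1 - P.ε / 2) * P.nt

/-- The factor of `n d(R_1) ⋯ d(R_t) / (s_1 ⋯ s_t)` in the sample size `s_{t+1}`. -/
def Params.κ (P : Params) (t : ℕ) : ℝ := P.τ (t + 1) * P.K / ((1 - P.γ) ^ t * P.w₀)

/-- The next sample size, where `Y = n d(R_1) ⋯ d(R_{t-1}) / (s_1 ⋯ s_t)` and `R = R_t`. -/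
def nextSize (t : ℕ) (R : List (List (Fin n))) (Y : ℝ) : ℕ :=
  ⌈P.κ t * (Y * totalDeg I R)⌉₊

/-- The next value of `n d(R_1) ⋯ d(R_{t-1}) / (s_1 ⋯ s_t)`. -/
def nextScale (t : ℕ) (R : List (List (Fin n))) (Y : ℝ) : ℝ :=
  Y * totalDeg I R / nextSize I P t R Y

open Classical in
/-- The law of the outcome of `r` iterations of the main loop and the last part, in terms of
`R = R_t` and the single number `Y = n d(R_1) ⋯ d(R_{t-1}) / (s_1 ⋯ s_t)`, which determines all the
quantities that the algorithm keeps track of. -/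
def process : ℕ → ℕ → List (List (Fin n)) → ℝ → PMF (Outcome ℝ)
  | 0, _, R, Y => (finish P up nk R Y 1).run I
  | r + 1, t, R, Y =>
    if exceeds up (nextSize I P t R Y) (P.sizeLimit t) then
      PMF.pure ⟨none, R.length * (1 + 2 * t) + 1, R.length * t⟩
    else
      (iidList (stepLaw I R) (nextSize I P t R Y)).bind fun l =>
        (process r (t + 1) l.reduceOption (nextScale I P t R Y)).map
          (Outcome.charge (R.length * (1 + 2 * t) + 1 + (R.length * (1 + 2 * t) + (R.length +
            nextSize I P t R Y + nextSize I P t R Y * (3 * t + 3))))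
            (R.length * t + (R.length * t + nextSize I P t R Y * (2 * t + 1))))

/-- `R` consists of ordered `t`-cliques. -/
def IsLevel (t : ℕ) (R : List (List (Fin n))) : Prop :=
  ∀ T ∈ R, T.length = t ∧ IsOrderedClique I.G T

variable {I} in
theorem IsLevel.reduceOption {t s : ℕ} {R : List (List (Fin n))} (hR : IsLevel I t R)
    {l : List (Option (List (Fin n)))} (hl : l ∈ (iidList (stepLaw I R) s).support) :
    IsLevel I (t + 1) l.reduceOption := by
  intro T' hT'
  have h := mem_support_of_mem_iidList hl _ (List.reduceOption_mem_iff.1 hT')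
  obtain ⟨h1, T, hT, h2⟩ := mem_support_stepLaw I h
  exact ⟨by rw [h2, (hR T hT).1], h1⟩

theorem isLevel_zero : IsLevel I 0 [[]] := by
  simp [IsLevel, IsOrderedClique]

theorem totalDeg_singleton_nil : totalDeg I [[]] = n := by
  simp [totalDeg, cliqueDeg, leastDeg]

/-- The estimate `w` kept by the algorithm is determined by `D / S`, and so is the sample size. -/
theorem sampleSize_eq {t d' s d : ℕ} {w D S : ℝ}
    (hw : w / d * s = (1 - P.γ) ^ t * P.w₀ * (S / D)) :
    P.sampleSize (t + 1) d' ((1 - P.γ) * (w / d) * s) = ⌈P.κ (t + 1) * (D / S * d')⌉₊ := by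
  rw [Params.sampleSize, mul_assoc (1 - P.γ), hw, Params.κ]
  congr 1
  rw [pow_succ]
  simp only [div_eq_mul_inv, mul_inv, inv_inv]
  ring

theorem run_levels_eq_process (r t : ℕ) {R : List (List (Fin n))} (hR : IsLevel I (t + 1) R)
    {w : ℝ} {d s : ℕ} {D S : ℝ} (hw : w / d * s = (1 - P.γ) ^ t * P.w₀ * (S / D)) :
    (levels P up nk r (t + 1) R w d s D S).run I = process I P up nk r (t + 1) R (D / S) := by
  induction r generalizing t R w d s D S with
  | zero =>
    rw [levels, process, run_finish I P up nk hR, run_finish I P up nk hR, div_one]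
  | succ r ih =>
    rw [run_levels_succ I P up nk (Nat.succ_ne_zero t) hR, process, sampleSize_eq P hw]
    rw [← nextSize]
    split_ifs with h
    · rfl
    · refine pmf_bind_congr fun l hl => ?_
      rw [ih (t + 1) (hR.reduceOption hl), nextScale]
      · congr 2
        simp only [div_eq_mul_inv, mul_inv]
        ring
      · rw [mul_assoc (1 - P.γ), hw, pow_succ]
        simp only [div_eq_mul_inv, mul_inv]
        ring

theorem approxLaw_eq_process : approxLaw I P up =
    (iidList (stepLaw I [[]]) (nextSize I P 0 [[]] 1)).bind fun l =>
      (process I P up (numCliques I.G P.k) (P.k - 1) 1 l.reduceOption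
        (nextScale I P 0 [[]] 1)).map (Outcome.charge (nextSize I P 0 [[]] 1) 0) := by
  have hs : P.sampleSize 0 n ((1 - P.ε / 2) * P.nt) = nextSize I P 0 [[]] 1 := by
    rw [nextSize, Params.sampleSize, Params.κ, totalDeg_singleton_nil, pow_zero, one_mul, one_mul,
      Params.w₀]
    congr 1
    ring
  rw [approxLaw_eq, hs]
  refine pmf_bind_congr fun l hl => ?_
  rw [run_levels_eq_process I P up _ _ 0 ((isLevel_zero I).reduceOption hl), nextScale,
    totalDeg_singleton_nil, one_mul]
  rw [pow_zero, one_mul, Params.w₀]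
  ring

variable {I P}

theorem sum_reduceOption (g : List (Fin n) → ℝ≥0∞) (l : List (Option (List (Fin n)))) :
    (l.reduceOption.map g).sum = (l.map fun o => o.elim 0 g).sum := by
  induction l with
  | nil => rfl
  | cons o l ih => cases o <;> simp [ih]

/-- `Y` times an additive function of the sample is a supermartingale, once the function is replaced
by its sum over the extensions. -/
theorem mean_step_le {t : ℕ} {R : List (List (Fin n))} (hR : IsLevel I t R) {Y : ℝ} (hY : 0 ≤ Y)
    (g : List (Fin n) → ℝ≥0∞) :
    mean (iidList (stepLaw I R) (nextSize I P t R Y)) (fun l =>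
      ENNReal.ofReal (nextScale I P t R Y) * (l.reduceOption.map g).sum) ≤
      ENNReal.ofReal Y * (R.map (extSum I.G g)).sum := by
  simp only [sum_reduceOption, mean_const_mul, mean_iidList_sum]
  rw [← mean_stepLaw I (fun T hT => (hR T hT).2) g, ← mul_assoc, ← mul_assoc]
  refine mul_le_mul' ?_ le_rfl
  rw [nextScale, ← ENNReal.ofReal_natCast, ← ENNReal.ofReal_natCast, ← ENNReal.ofReal_mul hY,
    ← ENNReal.ofReal_mul (by positivity)]
  refine ENNReal.ofReal_le_ofReal ?_
  rcases Nat.eq_zero_or_pos (nextSize I P t R Y) with h | h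
  · rw [h]
    simp only [Nat.cast_zero, mul_zero]
    positivity
  · rw [div_mul_cancel₀]
    positivity

/-- A bound on the size of the sample `R_t` by the scale: the sample size is at most one, or at most
twice the number of which it is the rounding. -/
def Sized (P : Params) (t : ℕ) (R : List (List (Fin n))) (Y : ℝ) : Prop :=
  0 ≤ Y ∧ ∃ s : ℕ, R.length ≤ s ∧ (s ≤ 1 ∨ 1 ≤ 2 * P.κ (t - 1) * Y) ∧ (P.κ (t - 1) = 0 → s = 0)

theorem nextScale_nonneg (t : ℕ) (R : List (List (Fin n))) {Y : ℝ} (hY : 0 ≤ Y) :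
    0 ≤ nextScale I P t R Y := by
  unfold nextScale
  positivity

theorem length_reduceOption_of_mem {t : ℕ} {R : List (List (Fin n))} {Y : ℝ}
    {l : List (Option (List (Fin n)))}
    (hl : l ∈ (iidList (stepLaw I R) (nextSize I P t R Y)).support) :
    l.reduceOption.length ≤ nextSize I P t R Y :=
  (List.reduceOption_length_le l).trans (length_of_mem_support_iidList hl).le

/-- Rounding up at most doubles a number greater than `1 / 2`, and gives at most one otherwise. -/
theorem sized_next {t : ℕ} {R : List (List (Fin n))} {Y : ℝ} (hY : 0 ≤ Y)
    {l : List (Option (List (Fin n)))}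
    (hl : l ∈ (iidList (stepLaw I R) (nextSize I P t R Y)).support) :
    Sized P (t + 1) l.reduceOption (nextScale I P t R Y) := by
  refine ⟨nextScale_nonneg t R hY, _, length_reduceOption_of_mem hl, ?_, fun h => ?_⟩
  · rw [Nat.add_sub_cancel, or_iff_not_imp_left, not_le]
    intro hs
    have h1 : (nextSize I P t R Y : ℝ) < P.κ t * (Y * totalDeg I R) + 1 := by
      refine Nat.ceil_lt_add_one ?_
      by_contra hneg
      rw [nextSize, Nat.ceil_eq_zero.2 (not_le.1 hneg).le] at hs
      omega
    have h2 : (2 : ℝ) ≤ nextSize I P t R Y := by exact_mod_cast hs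
    rw [nextScale, ← mul_div_assoc, le_div_iff₀ (by linarith)]
    linarith
  · rw [Nat.add_sub_cancel] at h
    simp [nextSize, h]

end Samples

/-! ### The union bound over the levels -/

section Tail

variable {n : ℕ} (I : Instance n) (P : Params) (up : Bool) (nk : ℕ)

/-- The price of `T`, a member of `R_t`, in Markov's inequality for the `r` levels from `t` on:
the sum of `c j · d(T')` over its extensions `T'` to ordered `j`-cliques, with `1` instead of
`d(T')` at the last level. -/
def price (c : ℕ → ℝ≥0∞) : ℕ → ℕ → List (Fin n) → ℝ≥0∞
  | 0, t, _ => c t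
  | r + 1, t, T => c t * cliqueDeg I T + extSum I.G (price c r (t + 1)) T

theorem sum_extSum {M : Type} [AddCommMonoid M] (G : SimpleGraph (Fin n)) (g : List (Fin n) → M)
    (t : ℕ) : ∑ T ∈ orderedCliques G t, extSum G g T = ∑ T ∈ orderedCliques G (t + 1), g T := by
  rw [orderedCliques, sum_snocs]
  rfl

theorem extSum_nil {M : Type} [AddCommMonoid M] (G : SimpleGraph (Fin n)) (g : List (Fin n) → M) :
    extSum G g [] = ∑ T ∈ orderedCliques G 1, g T := by
  rw [← sum_extSum, orderedCliques, Finset.sum_singleton]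

/-- The number of ordered `t`-cliques, counted with their degrees if `t < k`. -/
def cliqueSum (k t : ℕ) : ℕ :=
  if t < k then ∑ T ∈ orderedCliques I.G t, cliqueDeg I T else (orderedCliques I.G t).card

/-- If the levels are priced at `x` divided by the total degree of their ordered cliques, then each
level contributes at most `x` to the price of all the ordered `t`-cliques. -/
theorem sum_price_le (x : ℝ≥0∞) (k : ℕ) {r t : ℕ} (h : t + r = k) :
    ∑ T ∈ orderedCliques I.G t, price I (fun t => x * (cliqueSum I k t : ℝ≥0∞)⁻¹) r t T ≤
      (r + 1 : ℕ) * x := by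
  have key : ∀ N : ℕ, x * (N : ℝ≥0∞)⁻¹ * N ≤ x := fun N => by
    rw [mul_assoc]
    exact mul_le_of_le_one_right' (ENNReal.inv_mul_le_one _)
  induction r generalizing t with
  | zero =>
    obtain rfl : t = k := h
    simp only [price, Finset.sum_const, nsmul_eq_mul]
    rw [mul_comm]
    simpa [cliqueSum] using key (cliqueSum I t t)
  | succ r ih =>
    simp only [price, Finset.sum_add_distrib]
    rw [sum_extSum, ← Finset.mul_sum, ← Nat.cast_sum]
    have h1 := ih (t := t + 1) (by omega)
    have h2 : cliqueSum I k t = ∑ T ∈ orderedCliques I.G t, cliqueDeg I T := by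
      rw [cliqueSum, if_pos (by omega)]
    rw [← h2]
    calc _ ≤ x + (r + 1 : ℕ) * x := add_le_add (key _) h1
      _ = _ := by push_cast; ring

open Classical in
/-- The probability of a bad outcome, bounded by induction over the levels.  An invariant of the
state is lost with probability at most `η` per level, and the states in which the algorithm aborts
although the invariant holds are paid for by Markov's inequality. -/
theorem mean_process_le {bad : Option ℝ → Prop} {Inv : ℕ → List (List (Fin n)) → ℝ → Prop}
    {η : ℝ≥0∞} {c : ℕ → ℝ≥0∞} {k : ℕ}
    (hfin : ∀ R Y, IsLevel I k R → Sized P k R Y → Inv k R Y →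
      mean (process I P up nk 0 k R Y) (fun o => if bad o.value then 1 else 0) ≤
        ENNReal.ofReal Y * (c k * R.length))
    (habort : ∀ t R Y, 1 ≤ t → t < k → IsLevel I t R → 0 ≤ Y → Inv t R Y →
      exceeds up (nextSize I P t R Y) (P.sizeLimit t) → bad none →
        1 ≤ ENNReal.ofReal Y * (c t * totalDeg I R))
    (hstep : ∀ t R Y, t < k → IsLevel I t R → 0 ≤ Y → Inv t R Y →
      mean (iidList (stepLaw I R) (nextSize I P t R Y)) (fun l =>
        if Inv (t + 1) l.reduceOption (nextScale I P t R Y) then 0 else 1) ≤ η)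
    (r t : ℕ) (ht : 1 ≤ t) (htr : t + r = k) (R : List (List (Fin n))) (Y : ℝ)
    (hR : IsLevel I t R) (hs : Sized P t R Y) (hI : Inv t R Y) :
    mean (process I P up nk r t R Y) (fun o => if bad o.value then 1 else 0) ≤
      r * η + ENNReal.ofReal Y * (R.map (price I c r t)).sum := by
  induction r generalizing t R Y with
  | zero =>
    obtain rfl : t = k := htr
    refine (hfin R Y hR hs hI).trans ?_
    simp [price, mul_comm]
  | succ r ih =>
    have hsum : (R.map (price I c (r + 1) t)).sum = c t * totalDeg I R +
        (R.map (extSum I.G (price I c r (t + 1)))).sum := by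
      simp only [price, List.sum_map_add, List.sum_map_mul_left]
      congr 2
      rw [totalDeg]
      push_cast [List.map_map]
      rfl
    rw [hsum, process]
    split_ifs with h
    · rw [mean_pure]
      split_ifs with hb
      · refine (habort t R Y ht (by omega) hR hs.1 hI h hb).trans ?_
        rw [mul_add, ← add_assoc, add_comm, ← add_assoc]
        exact le_add_self
      · exact zero_le
    · rw [mean_bind]
      calc _ ≤ mean (iidList (stepLaw I R) (nextSize I P t R Y)) (fun l =>
            (if Inv (t + 1) l.reduceOption (nextScale I P t R Y) then 0 else 1) +
            (r * η + ENNReal.ofReal (nextScale I P t R Y) *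
              (l.reduceOption.map (price I c r (t + 1))).sum)) := by
            refine mean_mono fun l hl => ?_
            rw [mean_map]
            split_ifs with hi
            · rw [zero_add]
              exact ih (t + 1) (by omega) (by omega) _ _ (hR.reduceOption hl)
                (sized_next hs.1 hl) hi
            · refine le_trans (mean_le_of_forall (c := 1) fun o _ => ?_) le_self_add
              split_ifs <;> simp
        _ ≤ η + (r * η + ENNReal.ofReal Y * (R.map (extSum I.G (price I c r (t + 1)))).sum) := by
            rw [mean_add, mean_add, mean_const]
            gcongr
            · exact hstep t R Y (by omega) hR hs.1 hI
            · exact mean_step_le hR hs.1 _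
        _ ≤ _ := by
            rw [mul_add, ← add_assoc]
            push_cast
            rw [add_mul, one_mul, add_comm η]
            gcongr
            exact le_add_self

open Classical in
/-- The union bound for the whole algorithm: a loss of the invariant costs `η` per level, and
Markov's inequality costs `x` per level. -/
theorem mean_approxLaw_le {bad : Option ℝ → Prop} {Inv : ℕ → List (List (Fin n)) → ℝ → Prop}
    {η x : ℝ≥0∞} (hk : 1 ≤ P.k)
    (hfin : ∀ R Y, IsLevel I P.k R → Sized P P.k R Y → Inv P.k R Y →
      mean (process I P up (numCliques I.G P.k) 0 P.k R Y)
        (fun o => if bad o.value then 1 else 0) ≤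
        ENNReal.ofReal Y * (x * (cliqueSum I P.k P.k : ℝ≥0∞)⁻¹ * R.length))
    (habort : ∀ t R Y, 1 ≤ t → t < P.k → IsLevel I t R → 0 ≤ Y → Inv t R Y →
      exceeds up (nextSize I P t R Y) (P.sizeLimit t) → bad none →
        1 ≤ ENNReal.ofReal Y * (x * (cliqueSum I P.k t : ℝ≥0∞)⁻¹ * totalDeg I R))
    (hstep : ∀ t R Y, t < P.k → IsLevel I t R → 0 ≤ Y → Inv t R Y →
      mean (iidList (stepLaw I R) (nextSize I P t R Y)) (fun l =>
        if Inv (t + 1) l.reduceOption (nextScale I P t R Y) then 0 else 1) ≤ η)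
    (h0 : Inv 0 [[]] 1) :
    mean (approxLaw I P up) (fun o => if bad o.value then 1 else 0) ≤ P.k * η + P.k * x := by
  set c : ℕ → ℝ≥0∞ := fun t => x * (cliqueSum I P.k t : ℝ≥0∞)⁻¹ with hc
  obtain ⟨r, hr⟩ : ∃ r, P.k = r + 1 := ⟨P.k - 1, by omega⟩
  rw [approxLaw_eq_process, mean_bind, show P.k - 1 = r by omega]
  calc _ ≤ mean (iidList (stepLaw I [[]]) (nextSize I P 0 [[]] 1)) (fun l =>
        (if Inv 1 l.reduceOption (nextScale I P 0 [[]] 1) then 0 else 1) +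
        (r * η + ENNReal.ofReal (nextScale I P 0 [[]] 1) *
          (l.reduceOption.map (price I c r 1)).sum)) := by
        refine mean_mono fun l hl => ?_
        rw [mean_map]
        split_ifs with hi
        · rw [zero_add]
          exact mean_process_le I P up (numCliques I.G P.k) hfin habort hstep r 1 le_rfl (by omega)
            _ _ ((isLevel_zero I).reduceOption hl) (sized_next zero_le_one hl) hi
        · refine le_trans (mean_le_of_forall (c := 1) fun o _ => ?_) le_self_add
          split_ifs <;> simp
    _ ≤ η + (r * η + ENNReal.ofReal 1 * (([[]] : List (List (Fin n))).map
          (extSum I.G (price I c r 1))).sum) := by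
        rw [mean_add, mean_add, mean_const]
        gcongr
        · exact hstep 0 [[]] 1 (by omega) (isLevel_zero I) zero_le_one h0
        · exact mean_step_le (isLevel_zero I) zero_le_one _
    _ ≤ η + (r * η + P.k * x) := by
        refine add_le_add le_rfl (add_le_add le_rfl ?_)
        rw [ENNReal.ofReal_one, one_mul, List.map_singleton, List.sum_singleton, extSum_nil]
        have := sum_price_le I x P.k (r := r) (t := 1) (by omega)
        rwa [← hr] at this
    _ = _ := by
        rw [← add_assoc]
        congr 1
        rw [hr]
        push_cast
        ring

end Tail

/-! ### The parameters -/

/-- The hypotheses on the parameters that do not refer to a graph. -/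
structure Params.Valid (P : Params) : Prop where
  two_le_k : 2 ≤ P.k
  ε_pos : 0 < P.ε
  ε_lt : P.ε < 1
  δ_pos : 0 < P.δ
  δ_lt : P.δ < 1
  nt_pos : 0 < P.nt
  τ_nonneg : ∀ t, 0 ≤ P.τ t

namespace Params.Valid

variable {P : Params} (hP : P.Valid)
include hP

theorem two_le_cast : (2 : ℝ) ≤ P.k := by exact_mod_cast hP.two_le_k

theorem k_pos : (0 : ℝ) < P.k := by linarith [hP.two_le_cast]

theorem β_pos : 0 < P.β := div_pos hP.δ_pos (mul_pos three_pos hP.k_pos)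

theorem three_mul_k_mul_β : 3 * P.k * P.β = P.δ := by
  rw [Params.β, mul_div_cancel₀]
  exact (mul_pos three_pos hP.k_pos).ne'

theorem β_le : P.β ≤ 1 / 6 := by
  have := hP.three_mul_k_mul_β
  nlinarith [hP.two_le_cast, hP.β_pos, hP.δ_lt]

theorem γ_pos : 0 < P.γ := div_pos hP.ε_pos (mul_pos two_pos hP.k_pos)

theorem k_mul_γ : P.k * P.γ = P.ε / 2 := by
  have := hP.k_pos
  rw [Params.γ]
  field_simp

theorem γ_le : P.γ ≤ 1 / 4 := by
  have := hP.k_mul_γ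
  nlinarith [hP.two_le_cast, hP.γ_pos, hP.ε_lt]

theorem one_le_log : 1 ≤ Real.log (2 / P.β) := by
  rw [Real.le_log_iff_exp_le (div_pos two_pos hP.β_pos), le_div_iff₀ hP.β_pos]
  have := Real.exp_one_lt_d9
  nlinarith [hP.β_le, hP.β_pos]

theorem K_mul_sq : P.K * P.γ ^ 2 / 3 = Real.log (2 / P.β) := by
  have := hP.γ_pos
  rw [Params.K]
  field_simp

theorem one_le_K : 1 ≤ P.K := by
  have h1 := hP.K_mul_sq
  have h2 := hP.one_le_log
  have h3 : P.γ ^ 2 ≤ 1 := by nlinarith [hP.γ_pos, hP.γ_le]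
  by_contra h
  push Not at h
  have h4 := sq_nonneg P.γ
  nlinarith

/-- The constant `K` is chosen such that Chernoff's bound with deviation `γ` gives `β / 2`. -/
theorem exp_neg_K : Real.exp (-(P.K * P.γ ^ 2 / 3)) = P.β / 2 := by
  rw [hP.K_mul_sq, Real.exp_neg, Real.exp_log (div_pos two_pos hP.β_pos), inv_div]

/-- Bernoulli's inequality: the losses of all the levels together amount to at most `ε / 2`. -/
theorem half_le_pow {t : ℕ} (ht : t ≤ P.k) : 1 - P.ε / 2 ≤ (1 - P.γ) ^ t := by
  have h1 := one_add_mul_le_pow (a := -P.γ) (by linarith [hP.γ_le]) t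
  have h2 : (t : ℝ) * P.γ ≤ P.k * P.γ := by
    have := hP.γ_pos
    gcongr
  rw [hP.k_mul_γ] at h2
  rw [sub_eq_add_neg 1 P.γ]
  linarith

theorem one_sub_γ_pos : 0 < 1 - P.γ := by linarith [hP.γ_le]

theorem w₀_pos : 0 < P.w₀ := mul_pos (by linarith [hP.ε_lt]) hP.nt_pos

/-- The weight estimates never drop below a quarter of the guess. -/
theorem quarter_le {t : ℕ} (ht : t ≤ P.k) : P.nt / 4 ≤ (1 - P.γ) ^ t * P.w₀ := by
  have h1 := hP.half_le_pow ht
  have h2 : (1 : ℝ) / 2 ≤ 1 - P.ε / 2 := by linarith [hP.ε_lt]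
  have h3 := hP.nt_pos
  calc P.nt / 4 = 1 / 2 * (1 / 2 * P.nt) := by ring
    _ ≤ (1 - P.γ) ^ t * ((1 - P.ε / 2) * P.nt) := by
        gcongr
        all_goals linarith

theorem κ_nonneg (t : ℕ) : 0 ≤ P.κ t :=
  div_nonneg (mul_nonneg (hP.τ_nonneg _) (by linarith [hP.one_le_K]))
    (mul_nonneg (pow_nonneg hP.one_sub_γ_pos.le _) hP.w₀_pos.le)

theorem κ_le {t : ℕ} (ht : t ≤ P.k) : P.κ t ≤ 4 * P.τ (t + 1) * P.K / P.nt := by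
  have h1 := hP.nt_pos
  have h2 := hP.τ_nonneg (t + 1)
  have h3 := hP.one_le_K
  calc P.κ t ≤ P.τ (t + 1) * P.K / (P.nt / 4) := by
        rw [Params.κ]
        gcongr
        exact hP.quarter_le ht
    _ = _ := by
        field_simp

/-- The gains of all the levels together amount to at most `ε`. -/
theorem pow_one_add_γ_le : (1 + P.γ) ^ P.k ≤ 1 + P.ε := by
  have h1 : (1 + P.γ) ^ P.k ≤ Real.exp (P.ε / 2) := by
    rw [← hP.k_mul_γ, Real.exp_nat_mul]
    gcongr
    · linarith [hP.γ_pos]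
    · linarith [Real.add_one_le_exp P.γ]
  have h2 := Real.one_sub_le_exp_neg (P.ε / 2)
  rw [Real.exp_neg] at h2
  have h3 : (1 - P.ε / 2) * Real.exp (P.ε / 2) ≤ 1 := by
    calc _ ≤ (Real.exp (P.ε / 2))⁻¹ * Real.exp (P.ε / 2) := by gcongr
      _ = 1 := inv_mul_cancel₀ (Real.exp_pos _).ne'
  have h4 : Real.exp (P.ε / 2) ≤ 1 + P.ε := by
    by_contra h
    push Not at h
    nlinarith [hP.ε_lt, hP.ε_pos]
  linarith

end Params.Valid

/-! ### Concentration of the weight of a sample -/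

section Concentration

variable {n : ℕ} (I : Instance n) (P : Params)

/-- The total weight of the members of `R`. -/
def totalWeight (k : ℕ) (R : List (List (Fin n))) : ℕ := (R.map (prefixWeight I.G I.A k)).sum

variable {I P}

theorem extSum_prefixWeight {k : ℕ} {T : List (Fin n)} (hT : T.length < k) :
    extSum I.G (fun T => (prefixWeight I.G I.A k T : ℝ≥0∞)) T = prefixWeight I.G I.A k T := by
  classical
  rw [← sum_prefixWeight_snoc hT, Nat.cast_sum]
  refine Finset.sum_congr rfl fun v _ => ?_
  split_ifs with h
  · rfl
  · rw [prefixWeight_eq_zero h, Nat.cast_zero]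

/-- The expected weight of a sample is the average weight `ω(R) / d(R)`. -/
theorem mean_stepLaw_weight {t : ℕ} {R : List (List (Fin n))} (hR : IsLevel I t R)
    (ht : t < P.k) :
    (totalDeg I R : ℝ≥0∞) * mean (stepLaw I R)
      (fun o => o.elim 0 fun T => (prefixWeight I.G I.A P.k T : ℝ≥0∞)) =
      totalWeight I P.k R := by
  rw [mean_stepLaw I (fun T hT => (hR T hT).2), totalWeight, Nat.cast_list_sum, List.map_map]
  congr 1
  refine List.map_congr_left fun T hT => ?_
  exact extSum_prefixWeight (by rw [(hR T hT).1]; exact ht)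

theorem prefixWeight_le_of_isBounded (hb : IsBounded I.G I.A P.k P.τ) {T : List (Fin n)}
    (hT : IsOrderedClique I.G T) (h1 : 1 ≤ T.length) (h2 : T.length ≤ P.k) :
    (prefixWeight I.G I.A P.k T : ℝ) ≤ P.τ T.length := by
  have := hb _ h1 h2 T rfl hT
  rwa [weight_eq_prefixWeight (by rintro rfl; simp at h1)] at this

theorem weight_le_of_mem_support (hP : P.Valid) (hb : IsBounded I.G I.A P.k P.τ) {t : ℕ}
    {R : List (List (Fin n))} (hR : IsLevel I t R) (ht : t < P.k) :
    ∀ o ∈ (stepLaw I R).support,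
      o.elim 0 (fun T => (prefixWeight I.G I.A P.k T : ℝ)) ≤ P.τ (t + 1) := by
  intro o ho
  cases o with
  | none => exact hP.τ_nonneg _
  | some T' =>
    obtain ⟨h1, T, hT, h2⟩ := mem_support_stepLaw I ho
    rw [(hR T hT).1] at h2
    rw [← h2]
    exact prefixWeight_le_of_isBounded hb h1 (by omega) (by omega)

/-- In a bounded set of active cliques, the weight of a sample is at most `τ` times the number of
its possible extensions. -/
theorem totalWeight_le (hP : P.Valid) (hb : IsBounded I.G I.A P.k P.τ) {t : ℕ}
    {R : List (List (Fin n))} (hR : IsLevel I t R) (ht : t < P.k) :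
    (totalWeight I P.k R : ℝ) ≤ P.τ (t + 1) * totalDeg I R := by
  have h : (totalWeight I P.k R : ℝ≥0∞) ≤ ENNReal.ofReal (P.τ (t + 1) * totalDeg I R) := by
    rw [← mean_stepLaw_weight hR ht, mul_comm (P.τ _), ENNReal.ofReal_mul (Nat.cast_nonneg _),
      ENNReal.ofReal_natCast]
    gcongr
    refine mean_le_of_forall fun o ho => ?_
    have := weight_le_of_mem_support hP hb hR ht o ho
    cases o with
    | none => exact zero_le
    | some T =>
      rw [Option.elim_some, ← ENNReal.ofReal_natCast]
      exact ENNReal.ofReal_le_ofReal this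
  rw [← ENNReal.ofReal_natCast] at h
  exact (ENNReal.ofReal_le_ofReal_iff
    (mul_nonneg (hP.τ_nonneg _) (Nat.cast_nonneg _))).1 h

theorem totalWeight_reduceOption (k : ℕ) (l : List (Option (List (Fin n)))) (c : ℝ) :
    (l.map fun o => o.elim 0 (fun T => (prefixWeight I.G I.A k T : ℝ)) / c).sum =
      totalWeight I k l.reduceOption / c := by
  induction l with
  | nil => simp [totalWeight]
  | cons o l ih =>
    rw [List.map_cons, List.sum_cons, ih]
    cases o with
    | none => simp [totalWeight]
    | some T =>
      simp only [totalWeight, Option.elim_some, List.reduceOption_cons_of_some, List.map_cons,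
        List.sum_cons, Nat.cast_add]
      ring

open Classical in
/-- Chernoff's bound for one level: if `B` is an upper (`a ≥ 0`) or lower (`a ≤ 0`) estimate of the
scaled weight `Y ω(R)` that is at least as large as the estimate on which the sample size is based,
then the scaled weight of the next level deviates beyond `(1 + a) B` with small probability. -/
theorem mean_weight_tail (hP : P.Valid) (hb : IsBounded I.G I.A P.k P.τ) {t : ℕ}
    {R : List (List (Fin n))} (hR : IsLevel I t R) (ht : t < P.k) {Y : ℝ}
    (hYd : 0 < Y * totalDeg I R) (hτ : 0 < P.τ (t + 1)) {a B : ℝ} (ha : -(1 / 3) ≤ a) (ha1 : a ≤ 1)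
    (hB : (1 - P.γ) ^ t * P.w₀ ≤ B)
    (h : 0 ≤ a ∧ Y * totalWeight I P.k R ≤ B ∨ a ≤ 0 ∧ B ≤ Y * totalWeight I P.k R) :
    mean (iidList (stepLaw I R) (nextSize I P t R Y)) (fun l =>
      if 0 ≤ a * (nextScale I P t R Y * totalWeight I P.k l.reduceOption - (1 + a) * B)
        then 1 else 0) ≤ ENNReal.ofReal (Real.exp (-(P.K * a ^ 2 / 3))) := by
  have hw : 0 < (1 - P.γ) ^ t * P.w₀ := mul_pos (pow_pos hP.one_sub_γ_pos _) hP.w₀_pos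
  have hB0 : 0 < B := hw.trans_le hB
  have hK : 0 < P.K := by linarith [hP.one_le_K]
  have hd : (0 : ℝ) < totalDeg I R := (Nat.cast_nonneg _).lt_of_ne fun h0 => by
    simp [← h0] at hYd
  have hY : 0 < Y := pos_of_mul_pos_left hYd hd.le
  set s := nextSize I P t R Y with hs
  set τ' := P.τ (t + 1) with hτ'
  have hsle : P.κ t * (Y * totalDeg I R) ≤ s := Nat.le_ceil _
  have hκ : 0 < P.κ t := div_pos (mul_pos hτ hK) hw
  have hs0 : (0 : ℝ) < s := (mul_pos hκ hYd).trans_le hsle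
  set u : ℝ := B / (Y * totalDeg I R * τ') with hu
  have hu0 : 0 < u := div_pos hB0 (mul_pos hYd hτ)
  -- the sample size makes the expected total weight, in units of `τ'`, at least `K`
  have hsu : P.K ≤ s * u := by
    calc P.K = P.κ t * (Y * totalDeg I R) * ((1 - P.γ) ^ t * P.w₀ / (Y * totalDeg I R * τ')) := by
          rw [Params.κ, ← hτ']
          have := (pow_pos hP.one_sub_γ_pos t).ne'
          have := hP.w₀_pos.ne'
          field_simp
      _ ≤ s * u := by
          gcongr
          rw [hu]
          gcongr
  have hmean : mean (stepLaw I R) (fun o => ENNReal.ofReal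
      (o.elim 0 (fun T => (prefixWeight I.G I.A P.k T : ℝ)) / τ')) =
      ENNReal.ofReal (totalWeight I P.k R / (totalDeg I R * τ')) := by
    have h1 := mean_stepLaw_weight (P := P) hR ht
    have h2 : mean (stepLaw I R)
        (fun o => o.elim 0 fun T => (prefixWeight I.G I.A P.k T : ℝ≥0∞)) =
        ENNReal.ofReal (totalWeight I P.k R / totalDeg I R) := by
      rw [ENNReal.ofReal_div_of_pos hd, ENNReal.ofReal_natCast, ENNReal.ofReal_natCast,
        ENNReal.eq_div_iff (by exact_mod_cast hd.ne') (ENNReal.natCast_ne_top _), h1]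
    rw [← div_div, div_eq_mul_inv _ τ', mul_comm _ τ'⁻¹,
      ENNReal.ofReal_mul (inv_nonneg.2 hτ.le), ← h2, ← mean_const_mul]
    congr 1
    funext o
    rw [div_eq_mul_inv, mul_comm, ENNReal.ofReal_mul (inv_nonneg.2 hτ.le)]
    cases o <;> simp
  have hcheb := mean_iidList_tail (stepLaw I R)
    (fun o => o.elim 0 (fun T => (prefixWeight I.G I.A P.k T : ℝ)) / τ') (fun o ho => ⟨by
      cases o
      · simp
      · simp only [Option.elim_some]
        positivity, (div_le_one hτ).2 (weight_le_of_mem_support hP hb hR ht o ho)⟩)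
    s ha ha1 hu0.le (by
      rw [hmean]
      refine h.imp (fun h => ⟨h.1, ENNReal.ofReal_le_ofReal ?_⟩)
        (fun h => ⟨h.1, ENNReal.ofReal_le_ofReal ?_⟩)
      · rw [hu, div_le_div_iff₀ (mul_pos hd hτ) (mul_pos hYd hτ)]
        calc _ = Y * totalWeight I P.k R * (totalDeg I R * τ') := by ring
          _ ≤ _ := by gcongr; exact h.2
      · rw [hu, div_le_div_iff₀ (mul_pos hYd hτ) (mul_pos hd hτ)]
        calc B * (totalDeg I R * τ') ≤ Y * totalWeight I P.k R * (totalDeg I R * τ') := by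
              gcongr
              exact h.2
          _ = _ := by ring)
  refine (mean_mono fun l _ => ?_).trans (hcheb.trans (ENNReal.ofReal_le_ofReal
    (Real.exp_le_exp.2 ?_)))
  · rw [totalWeight_reduceOption]
    have hEq : nextScale I P t R Y * totalWeight I P.k l.reduceOption - (1 + a) * B =
        Y * totalDeg I R * τ' / s *
          (totalWeight I P.k l.reduceOption / τ' - (1 + a) * s * u) := by
      rw [nextScale, ← hs, hu]
      field_simp
    have hfac : 0 < Y * totalDeg I R * τ' / s := by positivity
    rw [hEq, mul_left_comm]
    refine le_of_eq (if_congr ?_ rfl rfl)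
    exact mul_nonneg_iff_of_pos_left hfac
  · have := mul_le_mul_of_nonneg_right hsu (sq_nonneg a)
    linarith

end Concentration

/-! ### Correctness -/

section Invariants

variable {n : ℕ} (I : Instance n) (P : Params)

/-- The scaled weight of `R_t` is at most `(1 + γ) ^ t U`. -/
def UpperInv (U : ℝ) (t : ℕ) (R : List (List (Fin n))) (Y : ℝ) : Prop :=
  Y * totalWeight I P.k R ≤ (1 + P.γ) ^ t * U

/-- The scaled weight of `R_t` is at least `(1 - γ) ^ t L`. -/
def LowerInv (L : ℝ) (t : ℕ) (R : List (List (Fin n))) (Y : ℝ) : Prop :=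
  (1 - P.γ) ^ t * L ≤ Y * totalWeight I P.k R

variable {I P}

theorem reduceOption_eq_nil_of_nextSize_eq_zero {t : ℕ} {R : List (List (Fin n))} {Y : ℝ}
    (h : nextSize I P t R Y = 0) {l : List (Option (List (Fin n)))}
    (hl : l ∈ (iidList (stepLaw I R) (nextSize I P t R Y)).support) : l.reduceOption = [] := by
  have := length_reduceOption_of_mem hl
  rw [h] at this
  exact List.length_eq_zero_iff.1 (Nat.le_zero.1 this)

open Classical in
/-- The upper invariant is lost with probability at most `β / 2` per level. -/
theorem mean_upperInv_le (hP : P.Valid) (hb : IsBounded I.G I.A P.k P.τ) {U : ℝ} (hU : P.w₀ ≤ U)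
    {t : ℕ} (ht : t < P.k) {R : List (List (Fin n))} (hR : IsLevel I t R) {Y : ℝ} (hY : 0 ≤ Y)
    (hI : UpperInv I P U t R Y) :
    mean (iidList (stepLaw I R) (nextSize I P t R Y)) (fun l =>
      if UpperInv I P U (t + 1) l.reduceOption (nextScale I P t R Y) then 0 else 1) ≤
      ENNReal.ofReal (P.β / 2) := by
  have hγ := hP.γ_pos
  have hU0 : 0 < U := hP.w₀_pos.trans_le hU
  by_cases h0 : P.κ t * (Y * totalDeg I R) = 0
  · -- nothing is sampled, and the weight of the next level vanishes
    have hs : nextSize I P t R Y = 0 := by rw [nextSize, h0, Nat.ceil_zero]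
    refine (mean_le_of_forall (c := 0) fun l hl => ?_).trans zero_le
    rw [if_pos]
    rw [reduceOption_eq_nil_of_nextSize_eq_zero hs hl, UpperInv]
    simp only [totalWeight, List.map_nil, List.sum_nil, Nat.cast_zero, mul_zero]
    positivity
  · have hκ : P.κ t ≠ 0 := left_ne_zero_of_mul h0
    have hYd : 0 < Y * totalDeg I R :=
      (mul_nonneg hY (Nat.cast_nonneg _)).lt_of_ne (right_ne_zero_of_mul h0).symm
    have hτ : 0 < P.τ (t + 1) := (hP.τ_nonneg _).lt_of_ne fun h => hκ (by simp [Params.κ, ← h])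
    have hpow : (1 - P.γ) ^ t ≤ (1 + P.γ) ^ t :=
      pow_le_pow_left₀ hP.one_sub_γ_pos.le (by linarith) t
    have hw := hP.w₀_pos
    have h := mean_weight_tail hP hb hR ht hYd hτ (a := P.γ) (B := (1 + P.γ) ^ t * U)
      (by linarith) (by linarith [hP.γ_le]) (by gcongr) (Or.inl ⟨hγ.le, hI⟩)
    rw [hP.exp_neg_K] at h
    refine (mean_mono fun l _ => ?_).trans h
    by_cases hl : UpperInv I P U (t + 1) l.reduceOption (nextScale I P t R Y)
    · rw [if_pos hl]
      exact zero_le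
    · rw [if_neg hl, if_pos]
      rw [UpperInv, not_le, pow_succ] at hl
      exact mul_nonneg hγ.le (by linarith)

/-- The lower invariant forces the sample to have positive degree, and the next sample size to be
the rounding of a number that is at least one. -/
theorem LowerInv.pos (hP : P.Valid) (hb : IsBounded I.G I.A P.k P.τ) {L : ℝ} (hL : P.w₀ ≤ L)
    {t : ℕ} (ht : t < P.k) {R : List (List (Fin n))} (hR : IsLevel I t R) {Y : ℝ} (hY : 0 ≤ Y)
    (hI : LowerInv I P L t R Y) :
    0 < P.τ (t + 1) ∧ 0 < Y * totalDeg I R ∧ 1 ≤ P.κ t * (Y * totalDeg I R) := by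
  have hpow := pow_pos hP.one_sub_γ_pos t
  have hw : 0 < (1 - P.γ) ^ t * P.w₀ := mul_pos hpow hP.w₀_pos
  have h1 : (1 - P.γ) ^ t * P.w₀ ≤ Y * (P.τ (t + 1) * totalDeg I R) :=
    calc _ ≤ (1 - P.γ) ^ t * L := by gcongr
      _ ≤ _ := hI
      _ ≤ _ := by
        gcongr
        exact totalWeight_le hP hb hR ht
  have h2 : (1 - P.γ) ^ t * P.w₀ ≤ P.τ (t + 1) * (Y * totalDeg I R) := by linarith
  have hYd : 0 ≤ Y * totalDeg I R := mul_nonneg hY (Nat.cast_nonneg _)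
  have hτ := hP.τ_nonneg (t + 1)
  refine ⟨pos_of_mul_pos_left (hw.trans_le h2) hYd, pos_of_mul_pos_right (hw.trans_le h2) hτ, ?_⟩
  rw [Params.κ, div_mul_eq_mul_div, le_div_iff₀ hw, one_mul]
  nlinarith [hP.one_le_K]

open Classical in
/-- The lower invariant is lost with probability at most `β / 2` per level. -/
theorem mean_lowerInv_le (hP : P.Valid) (hb : IsBounded I.G I.A P.k P.τ) {L : ℝ} (hL : P.w₀ ≤ L)
    {t : ℕ} (ht : t < P.k) {R : List (List (Fin n))} (hR : IsLevel I t R) {Y : ℝ} (hY : 0 ≤ Y)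
    (hI : LowerInv I P L t R Y) :
    mean (iidList (stepLaw I R) (nextSize I P t R Y)) (fun l =>
      if LowerInv I P L (t + 1) l.reduceOption (nextScale I P t R Y) then 0 else 1) ≤
      ENNReal.ofReal (P.β / 2) := by
  have hγ := hP.γ_pos
  obtain ⟨hτ, hYd, -⟩ := hI.pos hP hb hL ht hR hY
  have hpow := pow_pos hP.one_sub_γ_pos t
  have h := mean_weight_tail hP hb hR ht hYd hτ (a := -P.γ) (B := (1 - P.γ) ^ t * L)
    (by linarith [hP.γ_le]) (by linarith) (by gcongr) (Or.inr ⟨by linarith, hI⟩)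
  rw [neg_sq, hP.exp_neg_K] at h
  refine (mean_mono fun l _ => ?_).trans h
  by_cases hl : LowerInv I P L (t + 1) l.reduceOption (nextScale I P t R Y)
  · rw [if_pos hl]
    exact zero_le
  · rw [if_neg hl, if_pos]
    rw [LowerInv, not_le, pow_succ] at hl
    exact mul_nonneg_of_nonpos_of_nonpos (by linarith) (by linarith)

theorem lt_of_exceeds {up : Bool} {s : ℕ} {x : ℝ} (h : exceeds up s x) : x < s := by
  cases up with
  | false => simpa [exceeds] using h
  | true =>
    simp only [exceeds, if_true] at h
    exact (Nat.le_ceil x).trans_lt h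

theorem ceil_lt_of_exceeds {s : ℕ} {x : ℝ} (h : exceeds true s x) : ⌈x⌉₊ < s := by
  simp only [exceeds, if_true] at h
  exact_mod_cast h

theorem four_mul_factorial_le {k t : ℕ} (hk : 2 ≤ k) (ht : t < k) : 4 * t ! ≤ k ! ^ 2 := by
  obtain ⟨j, rfl⟩ : ∃ j, k = j + 1 := ⟨k - 1, by omega⟩
  have h1 : t ! ≤ j ! := Nat.factorial_le (by omega)
  have h2 : 1 ≤ j ! := Nat.factorial_pos j
  rw [Nat.factorial_succ]
  have h3 : 4 ≤ (j + 1) * (j + 1) := Nat.mul_le_mul hk hk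
  calc 4 * t ! ≤ (j + 1) * (j + 1) * (j ! * j !) :=
        Nat.mul_le_mul h3 (h1.trans (Nat.le_mul_of_pos_right _ h2))
    _ = _ := by ring

/-- If the state is not expensive enough for Markov's inequality, then `2 β` times its scaled size
`Y d` is at most the number `N` to which it is compared. -/
theorem le_of_lt_one {Y β : ℝ} {N d : ℕ} (hY : 0 ≤ Y) (hβ : 0 < β)
    (h : ¬ (1 : ℝ≥0∞) ≤ ENNReal.ofReal Y * (ENNReal.ofReal (2 * β) * (N : ℝ≥0∞)⁻¹ * d)) :
    2 * β * (Y * d) ≤ N := by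
  by_contra hlt
  push Not at hlt
  apply h
  have h1 : (N : ℝ≥0∞) ≤ ENNReal.ofReal (2 * β * (Y * d)) := by
    rw [← ENNReal.ofReal_natCast]
    exact ENNReal.ofReal_le_ofReal hlt.le
  have h2 : ENNReal.ofReal Y * (ENNReal.ofReal (2 * β) * (N : ℝ≥0∞)⁻¹ * d) =
      ENNReal.ofReal (2 * β * (Y * d)) * (N : ℝ≥0∞)⁻¹ := by
    rw [ENNReal.ofReal_mul (by positivity : 0 ≤ 2 * β), ENNReal.ofReal_mul hY,
      ENNReal.ofReal_natCast]
    ring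
  rw [h2]
  have hpos : ENNReal.ofReal (2 * β * (Y * d)) ≠ 0 := by
    rw [ne_eq, ENNReal.ofReal_eq_zero, not_le]
    exact (Nat.cast_nonneg _).trans_lt hlt
  rw [← ENNReal.div_eq_inv_mul.trans (mul_comm _ _), ENNReal.le_div_iff_mul_le
    (Or.inr hpos) (Or.inr ENNReal.ofReal_ne_top), one_mul]
  exact h1

/-- The number to which `Y d(R_t)` is compared, in terms of the parameters. -/
theorem cliqueSum_le (hα : (arboricity I.G : ℝ) ≤ P.α) (hm : (numEdges I.G : ℝ) / 2 ≤ P.mt)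
    {t : ℕ} (h1 : 1 ≤ t) (ht : t < P.k) :
    (cliqueSum I P.k t : ℝ) ≤ t ! * (4 * P.mt * P.α ^ (t - 1)) := by
  classical
  obtain ⟨j, rfl⟩ : ∃ j, t = j + 1 := ⟨t - 1, by omega⟩
  have h := sum_orderedCliques_le I.G (cliqueDeg I) (fun T v hv => cliqueDeg_le I hv) j
  rw [cliqueSum, if_pos ht, Nat.add_sub_cancel]
  calc _ ≤ (((j + 1)! * (2 * numEdges I.G * arboricity I.G ^ j) : ℕ) : ℝ) := by exact_mod_cast h
    _ = (j + 1)! * (2 * numEdges I.G * (arboricity I.G : ℝ) ^ j) := by push_cast; ring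
    _ ≤ _ := by
      have : (0 : ℝ) ≤ numEdges I.G := Nat.cast_nonneg _
      have : 0 ≤ P.mt := by linarith
      refine mul_le_mul_of_nonneg_left (mul_le_mul (by linarith)
        (pow_le_pow_left₀ (Nat.cast_nonneg _) hα j) (by positivity) (by positivity)) (by positivity)

/-- If the main loop aborts, then `Y d(R_t)` exceeds the number of ordered `t`-cliques, counted
with their degrees, by a factor `1 / (2 β)`.  Rounding the sample size up does no harm if the
threshold is rounded up too, or if the number that is rounded is at least one. -/
theorem one_le_of_exceeds_sizeLimit (hP : P.Valid) (hα : (arboricity I.G : ℝ) ≤ P.α)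
    (hm : (numEdges I.G : ℝ) / 2 ≤ P.mt) {up : Bool} {t : ℕ} (h1 : 1 ≤ t) (ht : t < P.k)
    {R : List (List (Fin n))} {Y : ℝ} (hY : 0 ≤ Y)
    (hup : up = true ∨ 1 ≤ P.κ t * (Y * totalDeg I R))
    (hex : exceeds up (nextSize I P t R Y) (P.sizeLimit t)) :
    1 ≤ ENNReal.ofReal Y *
      (ENNReal.ofReal (2 * P.β) * (cliqueSum I P.k t : ℝ≥0∞)⁻¹ * totalDeg I R) := by
  by_contra hlt
  have h2 := le_of_lt_one hY hP.β_pos hlt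
  have hβ := hP.β_pos
  have hnt := hP.nt_pos
  have hτ := hP.τ_nonneg (t + 1)
  have hK : 0 ≤ P.K := by linarith [hP.one_le_K]
  have hα0 : 0 ≤ P.α := (Nat.cast_nonneg _).trans hα
  have hmt : 0 ≤ P.mt := le_trans (by positivity) hm
  have hfac : (4 * t ! : ℝ) ≤ (P.k ! : ℝ) ^ 2 := by
    exact_mod_cast four_mul_factorial_le hP.two_le_k ht
  have hβt : P.β ^ t ≤ P.β := pow_le_of_le_one hβ.le (by linarith [hP.β_le]) (by omega)
  have h3 : 2 * (P.κ t * (Y * totalDeg I R)) ≤ P.sizeLimit t := by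
    have h4 : Y * totalDeg I R ≤ t ! * (4 * P.mt * P.α ^ (t - 1)) / (2 * P.β) := by
      rw [le_div_iff₀ (by positivity)]
      calc _ = 2 * P.β * (Y * totalDeg I R) := by ring
        _ ≤ _ := h2
        _ ≤ _ := cliqueSum_le hα hm h1 ht
    calc _ ≤ 2 * ((4 * P.τ (t + 1) * P.K / P.nt) *
          (t ! * (4 * P.mt * P.α ^ (t - 1)) / (2 * P.β))) := by
          have := hP.κ_le ht.le
          gcongr
      _ = 4 * P.mt * P.α ^ (t - 1) * P.τ (t + 1) / P.nt * (4 * t ! * P.K / P.β) := by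
          field_simp
      _ ≤ _ := by
          rw [Params.sizeLimit]
          gcongr
  have h5 : 0 ≤ P.κ t * (Y * totalDeg I R) := mul_nonneg (hP.κ_nonneg t) (by positivity)
  rcases hup with rfl | hup
  · have h6 := ceil_lt_of_exceeds hex
    rw [nextSize] at h6
    exact absurd (Nat.ceil_mono (by linarith : P.κ t * (Y * totalDeg I R) ≤ P.sizeLimit t))
      (not_le.2 h6)
  · have h6 := lt_of_exceeds hex
    have h7 := Nat.ceil_lt_add_one h5
    rw [nextSize] at h6
    linarith

/-- If the algorithm aborts because `R_k` is too large, then `Y |R_k|` exceeds the number of ordered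
`k`-cliques by a factor `1 / (2 β)`. -/
theorem one_le_of_exceeds_finalLimit (hP : P.Valid) {up : Bool} {R : List (List (Fin n))} {Y : ℝ}
    (hR : IsLevel I P.k R) (hs : Sized P P.k R Y)
    (hup : up = true ∨ 1 ≤ P.finalLimit (numCliques I.G P.k))
    (hex : exceeds up R.length (P.finalLimit (numCliques I.G P.k))) :
    1 ≤ ENNReal.ofReal Y *
      (ENNReal.ofReal (2 * P.β) * (cliqueSum I P.k P.k : ℝ≥0∞)⁻¹ * R.length) := by
  by_contra hlt
  obtain ⟨hY, s, hRs, hsmall, hκs⟩ := hs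
  have h2 := le_of_lt_one hY hP.β_pos hlt
  have hβ := hP.β_pos
  have hnt := hP.nt_pos
  have hτ := hP.τ_nonneg P.k
  have hK : 0 < P.K := by linarith [hP.one_le_K]
  have hex' := lt_of_exceeds hex
  have hk := hP.two_le_k
  have hfac0 : (0 : ℝ) < P.k ! := by exact_mod_cast Nat.factorial_pos _
  rcases hsmall with hsmall | hbig
  · -- at most one sample is taken: the abort test has to be passed by a set of one element
    have hlim : 0 ≤ P.finalLimit (numCliques I.G P.k) := by
      rw [Params.finalLimit]
      positivity
    have hlen : R.length = 1 := by
      have : 0 < R.length := by exact_mod_cast hlim.trans_lt hex'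
      omega
    rcases hup with rfl | hup
    · have hpos : 0 < P.finalLimit (numCliques I.G P.k) := by
        have hκ : P.κ (P.k - 1) ≠ 0 := fun h => by
          have := hκs h
          omega
        have hτ' : P.τ P.k ≠ 0 := fun h => hκ (by
          rw [Params.κ, Nat.sub_add_cancel (by omega), h]
          simp)
        have hτ0 : 0 < P.τ P.k := hτ.lt_of_ne hτ'.symm
        have hnk : 0 < numCliques I.G P.k := by
          obtain ⟨T, hT⟩ := List.exists_mem_of_length_pos (by omega : 0 < R.length)
          obtain ⟨h3, h4⟩ := hR T hT
          exact (Set.ncard_pos (Set.toFinite _)).2 ⟨T.toFinset, h3 ▸ h4.isNClique⟩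
        rw [Params.finalLimit]
        positivity
      have h6 := ceil_lt_of_exceeds hex
      rw [hlen] at h6
      exact absurd (Nat.ceil_pos.2 hpos) (by omega)
    · rw [hlen, Nat.cast_one] at hex'
      linarith
  · refine absurd hex' (not_lt.2 ?_)
    have hN : (cliqueSum I P.k P.k : ℝ) ≤ P.k ! * numCliques I.G P.k := by
      rw [cliqueSum, if_neg (lt_irrefl _)]
      exact_mod_cast card_orderedCliques_le I.G P.k
    have h4 : Y * R.length ≤ P.k ! * numCliques I.G P.k / (2 * P.β) := by
      rw [le_div_iff₀ (by positivity)]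
      linarith
    have hκ := hP.κ_le (t := P.k - 1) (by omega)
    rw [Nat.sub_add_cancel (by omega)] at hκ
    have hβk : P.β ^ P.k ≤ P.β := pow_le_of_le_one hβ.le (by linarith [hP.β_le]) (by omega)
    have hfac : (P.k ! : ℝ) ≤ (P.k ! : ℝ) ^ 2 := by
      have : (1 : ℝ) ≤ P.k ! := by exact_mod_cast Nat.factorial_pos _
      nlinarith
    calc (R.length : ℝ) ≤ 2 * P.κ (P.k - 1) * Y * R.length := by
          have : (0 : ℝ) ≤ R.length := Nat.cast_nonneg _
          nlinarith
      _ = 2 * P.κ (P.k - 1) * (Y * R.length) := by ring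
      _ ≤ 2 * (4 * P.τ P.k * P.K / P.nt) * (P.k ! * numCliques I.G P.k / (2 * P.β)) := by
          gcongr
      _ = P.k ! / P.β * (numCliques I.G P.k * P.τ P.k / P.nt) * (4 * P.K) := by
          field_simp
      _ ≤ _ := by
          rw [Params.finalLimit]
          gcongr

end Invariants

section Correctness

variable {n : ℕ} {I : Instance n} {P : Params}

theorem totalWeight_singleton_nil (hP : P.Valid) :
    totalWeight I P.k [[]] = ∑ v, weight I.G I.A P.k [v] := by
  have hk : ([] : List (Fin n)).length < P.k := lt_of_lt_of_le two_pos hP.two_le_k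
  rw [totalWeight, List.map_singleton, List.sum_singleton, ← sum_prefixWeight_snoc hk]
  refine Finset.sum_congr rfl fun v _ => ?_
  rw [List.nil_append, weight_eq_prefixWeight (by simp)]

theorem totalWeight_singleton_nil_le : totalWeight I P.k [[]] ≤ numCliques I.G P.k := by
  rw [totalWeight, List.map_singleton, List.sum_singleton]
  exact prefixWeight_nil_le

open Classical in
theorem mean_process_zero_le {up : Bool} {nk : ℕ} {bad : Option ℝ → Prop} {x : ℝ≥0∞}
    {R : List (List (Fin n))} {Y : ℝ} (hR : IsLevel I P.k R)
    (hex : exceeds up R.length (P.finalLimit nk) → bad none → 1 ≤ x)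
    (hval : ¬ bad (some (Y * totalWeight I P.k R))) :
    mean (process I P up nk 0 P.k R Y) (fun o => if bad o.value then 1 else 0) ≤ x := by
  rw [process, run_finish I P up nk hR, div_one]
  split_ifs with h
  · rw [mean_pure]
    split_ifs with hb
    · exact hex h hb
    · exact zero_le
  · rw [mean_pure]
    change (if bad (some (Y * totalWeight I P.k R)) then (1 : ℝ≥0∞) else 0) ≤ x
    rw [if_neg hval]
    exact zero_le

/-- The budget per level is `β` for both tails of the weight and `2 β` for Markov's inequality. -/
theorem union_bound_eq (hP : P.Valid) {η : ℝ} (hη : 0 ≤ η) (hηβ : η ≤ P.β) :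
    (P.k : ℝ≥0∞) * ENNReal.ofReal η + P.k * ENNReal.ofReal (2 * P.β) ≤ ENNReal.ofReal P.δ := by
  have hβ := hP.β_pos
  rw [← ENNReal.ofReal_natCast, ← ENNReal.ofReal_mul (Nat.cast_nonneg _),
    ← ENNReal.ofReal_mul (Nat.cast_nonneg _), ← ENNReal.ofReal_add (by positivity) (by positivity),
    ← hP.three_mul_k_mul_β]
  refine ENNReal.ofReal_le_ofReal ?_
  have := mul_le_mul_of_nonneg_left hηβ hP.k_pos.le
  linarith

/-- The result is close to `n_k` if the guess `ñ` is at most `n_k`. -/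
theorem approx_of_le (up : Bool) (hP : P.Valid) (hα : (arboricity I.G : ℝ) ≤ P.α)
    (hg : IsGood I.G I.A P.k P.ε P.τ) (hm : (numEdges I.G : ℝ) / 2 ≤ P.mt)
    (hnt : P.nt ≤ numCliques I.G P.k) :
    ENNReal.ofReal (1 - P.δ) ≤ (approxLaw I P up).toOuterMeasure
      {o | ∃ x : ℝ, o.value = some x ∧ (1 - P.ε) * (numCliques I.G P.k : ℝ) ≤ x ∧
        x ≤ (1 + P.ε) * (numCliques I.G P.k : ℝ)} := by
  classical
  obtain ⟨hb, htot⟩ := hg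
  set N : ℝ := (numCliques I.G P.k : ℝ) with hN
  have hε := hP.ε_pos
  have hε1 := hP.ε_lt
  have hN0 : 0 < N := hP.nt_pos.trans_le hnt
  have hL : P.w₀ ≤ (1 - P.ε / 2) * N := by
    rw [Params.w₀]
    gcongr
    linarith
  have hU : P.w₀ ≤ N := hL.trans (mul_le_of_le_one_left hN0.le (by linarith))
  have hγ := hP.γ_pos
  let bad : Option ℝ → Prop := fun v => ¬ ∃ x : ℝ, v = some x ∧ (1 - P.ε) * N ≤ x ∧
    x ≤ (1 + P.ε) * N
  refine ofReal_one_sub_le_toOuterMeasure (bad := fun o => bad o.value) hP.δ_pos.le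
    (fun o ho => by rw [Set.mem_ofPred_eq]; simpa only [bad, not_not] using ho) ?_
  refine (mean_approxLaw_le I P up (bad := bad) (η := ENNReal.ofReal P.β)
    (x := ENNReal.ofReal (2 * P.β))
    (Inv := fun t R Y => UpperInv I P N t R Y ∧ LowerInv I P ((1 - P.ε / 2) * N) t R Y)
    (by linarith [hP.two_le_k]) ?_ ?_ ?_ ?_).trans (union_bound_eq hP hP.β_pos.le le_rfl)
  · rintro R Y hR hs ⟨hu, hl⟩
    refine mean_process_zero_le hR (fun hex _ => one_le_of_exceeds_finalLimit hP hR hs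
      (Or.inr ?_) hex) ?_
    · -- a member of positive weight shows that `τ_k` is at least one
      have hpos : (0 : ℝ) < Y * totalWeight I P.k R :=
        lt_of_lt_of_le (mul_pos (pow_pos hP.one_sub_γ_pos _)
          (hP.w₀_pos.trans_le hL)) hl
      have hw : totalWeight I P.k R ≠ 0 := fun h => by simp [h] at hpos
      obtain ⟨T, hT, hTw⟩ : ∃ T ∈ R, prefixWeight I.G I.A P.k T ≠ 0 := by
        by_contra hall
        push Not at hall
        exact hw (List.sum_eq_zero (by simpa using hall))
      have hk := hP.two_le_k
      have h1 := prefixWeight_le_of_isBounded hb (hR T hT).2 (by rw [(hR T hT).1]; omega)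
        (hR T hT).1.le
      rw [(hR T hT).1] at h1
      have hτ : (1 : ℝ) ≤ P.τ P.k :=
        le_trans (by exact_mod_cast Nat.one_le_iff_ne_zero.2 hTw) h1
      have hβ := hP.β_pos
      have hβk : P.β ^ P.k ≤ 1 := pow_le_one₀ hβ.le (by linarith [hP.β_le])
      have hfac : (1 : ℝ) ≤ (P.k ! : ℝ) ^ 2 := one_le_pow₀ (by
        exact_mod_cast Nat.factorial_pos _)
      have h3 : 1 ≤ (P.k ! : ℝ) ^ 2 / P.β ^ P.k :=
        (one_le_div (pow_pos hβ _)).2 (hβk.trans hfac)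
      have h4 : 1 ≤ N * P.τ P.k / P.nt := by
        rw [one_le_div hP.nt_pos]
        nlinarith
      have h5 : 1 ≤ 4 * P.K := by linarith [hP.one_le_K]
      rw [Params.finalLimit]
      exact one_le_mul_of_one_le_of_one_le (one_le_mul_of_one_le_of_one_le h3 h4) h5
    · simp only [bad, not_not]
      refine ⟨_, rfl, le_trans ?_ hl, le_trans hu ?_⟩
      · have := hP.half_le_pow le_rfl
        calc (1 - P.ε) * N ≤ (1 - P.ε / 2) * ((1 - P.ε / 2) * N) := by
              rw [← mul_assoc]
              gcongr
              nlinarith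
          _ ≤ _ := by
              gcongr
              exact mul_nonneg (by linarith) hN0.le
      · have := hP.pow_one_add_γ_le
        gcongr
  · rintro t R Y h1 ht hR hY ⟨-, hl⟩ hex -
    exact one_le_of_exceeds_sizeLimit hP hα hm h1 ht hY
      (Or.inr (hl.pos hP hb hL ht hR hY).2.2) hex
  · rintro t R Y ht hR hY ⟨hu, hl⟩
    calc _ ≤ mean (iidList (stepLaw I R) (nextSize I P t R Y)) (fun l =>
          (if UpperInv I P N (t + 1) l.reduceOption (nextScale I P t R Y) then 0 else 1) +
          (if LowerInv I P ((1 - P.ε / 2) * N) (t + 1) l.reduceOption (nextScale I P t R Y)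
            then 0 else 1)) := by
          refine mean_mono fun l _ => ?_
          split_ifs <;> simp_all
      _ ≤ ENNReal.ofReal (P.β / 2) + ENNReal.ofReal (P.β / 2) := by
          rw [mean_add]
          exact add_le_add (mean_upperInv_le hP hb hU ht hR hY hu)
            (mean_lowerInv_le hP hb hL ht hR hY hl)
      _ = _ := by
          have := hP.β_pos
          rw [← ENNReal.ofReal_add (by positivity) (by positivity), add_halves]
  · refine ⟨?_, ?_⟩
    · rw [UpperInv, pow_zero, one_mul, one_mul, hN]
      exact_mod_cast totalWeight_singleton_nil_le
    · rw [LowerInv, pow_zero, one_mul, one_mul, totalWeight_singleton_nil hP]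
      exact htot

/-- If the guess `ñ` exceeds `n_k`, then a returned value is unlikely to exceed `(1 + ε) ñ`; with
rounded thresholds, an abort is unlikely as well. -/
theorem approx_of_lt (up : Bool) (hP : P.Valid) (hα : (arboricity I.G : ℝ) ≤ P.α)
    (hb : IsBounded I.G I.A P.k P.τ) (hm : (numEdges I.G : ℝ) / 2 ≤ P.mt)
    (hnt : (numCliques I.G P.k : ℝ) < P.nt) :
    ENNReal.ofReal (1 - P.δ) ≤ (approxLaw I P up).toOuterMeasure
      {o | (up = true → o.value ≠ none) ∧ ∀ x : ℝ, o.value = some x → x ≤ (1 + P.ε) * P.nt} := by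
  classical
  have hε := hP.ε_pos
  have hγ := hP.γ_pos
  have hnt0 := hP.nt_pos
  have hU : P.w₀ ≤ P.nt := mul_le_of_le_one_left hnt0.le (by linarith)
  let bad : Option ℝ → Prop := fun v => ¬ ((up = true → v ≠ none) ∧
    ∀ x : ℝ, v = some x → x ≤ (1 + P.ε) * P.nt)
  have hnone : bad none → up = true := fun h => by
    simpa [bad] using h
  refine ofReal_one_sub_le_toOuterMeasure (bad := fun o => bad o.value) hP.δ_pos.le
    (fun o ho => by rw [Set.mem_ofPred_eq]; simpa only [bad, not_not] using ho) ?_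
  refine (mean_approxLaw_le I P up (bad := bad) (η := ENNReal.ofReal (P.β / 2))
    (x := ENNReal.ofReal (2 * P.β)) (Inv := UpperInv I P P.nt)
    (by linarith [hP.two_le_k]) ?_ ?_ ?_ ?_).trans
    (union_bound_eq hP (by linarith [hP.β_pos]) (by linarith [hP.β_pos]))
  · intro R Y hR hs hu
    refine mean_process_zero_le hR (fun hex hn => one_le_of_exceeds_finalLimit hP hR hs
      (Or.inl (hnone hn)) hex) ?_
    simp only [bad, not_not]
    refine ⟨fun _ => by simp, fun x hx => ?_⟩
    rw [← Option.some_injective _ hx]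
    refine le_trans hu ?_
    have := hP.pow_one_add_γ_le
    gcongr
  · intro t R Y h1 ht hR hY hu hex hn
    exact one_le_of_exceeds_sizeLimit hP hα hm h1 ht hY (Or.inl (hnone hn)) hex
  · intro t R Y ht hR hY hu
    exact mean_upperInv_le hP hb hU ht hR hY hu
  · rw [UpperInv, pow_zero, one_mul, one_mul]
    refine le_trans ?_ hnt.le
    exact_mod_cast totalWeight_singleton_nil_le

end Correctness

/-! ### Running time and queries -/

section Cost

variable {n : ℕ} (I : Instance n) (P : Params)

/-- The properties of the running time and of the number of queries on which the estimates depend,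
so that one proof serves for both; `x` bounds the cost of treating one ordered `k`-clique at the
end. -/
structure IsCost (cost : Outcome ℝ → ℕ) (x : ℕ) : Prop where
  charge_le : ∀ (t q : ℕ) (o : Outcome ℝ), q ≤ t → cost (o.charge t q) ≤ t + cost o
  none_le : ∀ t q : ℕ, q ≤ t → cost ⟨none, t, q⟩ ≤ t
  some_le : ∀ (y : ℝ) (R : List (List (Fin n))), IsLevel I P.k R →
    cost ⟨some y, 1 + countTime I R, countQueries I R⟩ ≤ 1 + R.length * x

theorem isCost_time {ρ : ℕ} (hρ : ∀ T, I.oracleTime T ≤ ρ) :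
    IsCost I P Outcome.time (1 + P.k ! * (P.k + 1 + (P.k + P.k * ρ))) where
  charge_le _ _ _ _ := (Nat.add_comm _ _).le
  none_le _ _ _ := le_rfl
  some_le _ _ hR := Nat.add_le_add_left (countTime_le I hρ fun T hT => (hR T hT).1) 1

theorem isCost_queries {q : ℕ} (hq : ∀ T, I.oracleQueries T ≤ q) :
    IsCost I P Outcome.queries (P.k ! * (P.k * q)) where
  charge_le t q o h := by
    change o.queries + q ≤ t + o.queries
    omega
  none_le _ _ h := h
  some_le _ _ hR := (countQueries_le I hq fun T hT => (hR T hT).1).trans (Nat.le_add_left _ _)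

/-- A bound on the cost of `r` iterations of the main loop from the iteration with index `t` on, up
to the part that depends on the size of the sample `R_t`. -/
def loopCost : ℕ → ℕ → ℝ
  | 0, _ => 1
  | r + 1, t => 1 + (P.sizeLimit t + 1) * (7 * t + 11) + loopCost r (t + 1)

variable {I P}

theorem le_of_not_exceeds {up : Bool} {s : ℕ} {x : ℝ} (hx : 0 ≤ x) (h : ¬ exceeds up s x) :
    (s : ℝ) ≤ x + 1 := by
  cases up with
  | false =>
    simp only [exceeds, Bool.false_eq_true, if_false, not_lt] at h
    linarith
  | true =>
    simp only [exceeds, if_true, not_lt] at h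
    exact h.trans (Nat.ceil_lt_add_one hx).le

theorem sizeLimit_nonneg (hP : P.Valid) (hα : 0 ≤ P.α) (hm : 0 ≤ P.mt) (t : ℕ) :
    0 ≤ P.sizeLimit t := by
  have := hP.τ_nonneg (t + 1)
  have := hP.nt_pos
  have := hP.β_pos
  have : 0 ≤ P.K := by linarith [hP.one_le_K]
  rw [Params.sizeLimit]
  positivity

theorem finalLimit_nonneg (hP : P.Valid) (nk : ℕ) : 0 ≤ P.finalLimit nk := by
  have := hP.τ_nonneg P.k
  have := hP.nt_pos
  have := hP.β_pos
  have : 0 ≤ P.K := by linarith [hP.one_le_K]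
  rw [Params.finalLimit]
  positivity

theorem loopCost_pos (hP : P.Valid) (hα : 0 ≤ P.α) (hm : 0 ≤ P.mt) (r t : ℕ) :
    0 < loopCost P r t := by
  induction r generalizing t with
  | zero => exact one_pos
  | succ r ih =>
    have := ih (t + 1)
    have := sizeLimit_nonneg hP hα hm t
    rw [loopCost]
    positivity

/-- The bookkeeping of one iteration that leads from `a` to `b` ordered cliques: each member of
`R_t` is charged `4 t + 3` for having its degrees computed, twice, and for the weighted draws. -/
theorem loop_step {a b s t : ℕ} {x w : ℝ} (hb : b ≤ s) (hs : (s : ℝ) ≤ x + 1) :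
    ((a * (1 + 2 * t) + 1 + (a * (1 + 2 * t) + (a + s + s * (3 * t + 3))) : ℕ) : ℝ) +
      (b * (4 * (t + 1 : ℕ) + 3) + w) ≤
      a * (4 * t + 3) + (1 + (x + 1) * (7 * t + 11) + w) := by
  have hb' : (b : ℝ) ≤ x + 1 := le_trans (by exact_mod_cast hb) hs
  have h1 : (b : ℝ) * (4 * t + 7) ≤ (x + 1) * (4 * t + 7) := by gcongr
  have h2 : (s : ℝ) * (3 * t + 4) ≤ (x + 1) * (3 * t + 4) := by gcongr
  push_cast
  linarith

theorem loop_abort_le {a t : ℕ} {x w : ℝ} (hx : 0 ≤ x) (hw : 0 ≤ w) :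
    ((a * (1 + 2 * t) + 1 : ℕ) : ℝ) ≤ a * (4 * t + 3) + (1 + (x + 1) * (7 * t + 11) + w) := by
  have h1 : (0 : ℝ) ≤ a * (2 * t + 2) := by positivity
  have h2 : 0 ≤ (x + 1) * (7 * t + 11) := by positivity
  push_cast
  linarith

theorem queries_le_time {a s t : ℕ} : a * t + (a * t + s * (2 * t + 1)) ≤
    a * (1 + 2 * t) + 1 + (a * (1 + 2 * t) + (a + s + s * (3 * t + 3))) := by
  nlinarith [Nat.zero_le (a * t), Nat.zero_le (s * t)]

/-- The bound on the cost that holds on every run. -/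
theorem cost_le_of_mem_support (hP : P.Valid) (hα : 0 ≤ P.α) (hm : 0 ≤ P.mt)
    {cost : Outcome ℝ → ℕ} {x : ℕ} (hc : IsCost I P cost x) (up : Bool) (nk : ℕ) (r t : ℕ)
    (htr : t + r = P.k) {R : List (List (Fin n))} (hR : IsLevel I t R) (Y : ℝ)
    {o : Outcome ℝ} (ho : o ∈ (process I P up nk r t R Y).support) :
    (cost o : ℝ) ≤ R.length * (4 * t + 3) + loopCost P r t + (P.finalLimit nk + 1) * x := by
  have hfin := finalLimit_nonneg hP nk
  have hfinx : 0 ≤ (P.finalLimit nk + 1) * x := by positivity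
  induction r generalizing t R Y o with
  | zero =>
    obtain rfl : t = P.k := htr
    rw [process, run_finish I P up nk hR] at ho
    rw [loopCost]
    have h0 : (0 : ℝ) ≤ R.length * (4 * P.k + 3) := by positivity
    split_ifs at ho with h
    · rw [PMF.support_pure, Set.mem_singleton_iff] at ho
      subst ho
      have h1 : (cost ⟨none, 1, 0⟩ : ℝ) ≤ 1 := by exact_mod_cast hc.none_le 1 0 (Nat.zero_le _)
      linarith
    · rw [PMF.support_pure, Set.mem_singleton_iff] at ho
      subst ho
      have h1 := hc.some_le (Y / 1 * ((R.map (prefixWeight I.G I.A P.k)).sum : ℕ)) R hR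
      have h2 := le_of_not_exceeds hfin h
      have h3 : (R.length : ℝ) * x ≤ (P.finalLimit nk + 1) * x := by gcongr
      have h4 : (cost ⟨some (Y / 1 * ((R.map (prefixWeight I.G I.A P.k)).sum : ℕ)),
        1 + countTime I R, countQueries I R⟩ : ℝ) ≤ 1 + R.length * x := by exact_mod_cast h1
      linarith
  | succ r ih =>
    rw [process] at ho
    rw [loopCost]
    have hlim := sizeLimit_nonneg hP hα hm t
    split_ifs at ho with h
    · rw [PMF.support_pure, Set.mem_singleton_iff] at ho
      subst ho
      have h1 : (cost ⟨none, R.length * (1 + 2 * t) + 1, R.length * t⟩ : ℝ) ≤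
          ((R.length * (1 + 2 * t) + 1 : ℕ) : ℝ) := by
        exact_mod_cast hc.none_le _ _ (by nlinarith [Nat.zero_le (R.length * t)])
      have h2 := loop_abort_le (a := R.length) (t := t) hlim (loopCost_pos hP hα hm r (t + 1)).le
      linarith
    · obtain ⟨l, hl, ho⟩ := (PMF.mem_support_bind_iff _ _ _).1 ho
      obtain ⟨o', ho', rfl⟩ := (PMF.mem_support_map_iff _ _ _).1 ho
      have h1 := ih (t + 1) (by omega) (hR.reduceOption hl) _ ho'
      have h2 := hc.charge_le _ _ o' (queries_le_time (a := R.length) (s := nextSize I P t R Y)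
        (t := t))
      have h3 := loop_step (a := R.length) (t := t) (w := loopCost P r (t + 1))
        (length_reduceOption_of_mem hl) (le_of_not_exceeds hlim h)
      have h4 := Nat.cast_le (α := ℝ).2 h2
      rw [Nat.cast_add] at h4
      linarith

/-- The number of ordered cliques that extend `T` by `r` vertices. -/
def extCount (G : SimpleGraph (Fin n)) : ℕ → List (Fin n) → ℝ≥0∞
  | 0, _ => 1
  | r + 1, T => extSum G (extCount G r) T

theorem sum_extCount (G : SimpleGraph (Fin n)) (r t : ℕ) :
    ∑ T ∈ orderedCliques G t, extCount G r T = (orderedCliques G (t + r)).card := by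
  induction r generalizing t with
  | zero => simp [extCount]
  | succ r ih =>
    simp only [extCount]
    rw [sum_extSum, ih, Nat.add_right_comm, Nat.add_assoc]

/-- The bound on the expected cost.  The last part costs `x` per member of `R_k`.  By `Sized`, the
size of `R_k` is at most `1 + 2 κ Y |R_k|`, and `Y |R_k|` is at most the number of ordered
`k`-cliques in expectation. -/
theorem mean_cost_le (hP : P.Valid) (hα : 0 ≤ P.α) (hm : 0 ≤ P.mt)
    {cost : Outcome ℝ → ℕ} {x : ℕ} (hc : IsCost I P cost x) (up : Bool) (nk : ℕ) (r t : ℕ)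
    (htr : t + r = P.k) {R : List (List (Fin n))} (hR : IsLevel I t R) {Y : ℝ}
    (hs : Sized P t R Y) :
    mean (process I P up nk r t R Y) (fun o => (cost o : ℝ≥0∞)) ≤
      ENNReal.ofReal (R.length * (4 * t + 3) + loopCost P r t + x) +
        ENNReal.ofReal (2 * P.κ (P.k - 1) * x) *
          (ENNReal.ofReal Y * (R.map (extCount I.G r)).sum) := by
  have hκ := hP.κ_nonneg (P.k - 1)
  induction r generalizing t R Y with
  | zero =>
    obtain rfl : t = P.k := htr
    rw [process, run_finish I P up nk hR, loopCost]
    have h0 : (0 : ℝ) ≤ R.length * (4 * P.k + 3) := by positivity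
    have hx : (0 : ℝ) ≤ x := Nat.cast_nonneg _
    split_ifs with h
    · rw [mean_pure]
      refine le_trans ?_ le_self_add
      have h1 : (cost ⟨none, 1, 0⟩ : ℝ) ≤ 1 := by exact_mod_cast hc.none_le 1 0 (Nat.zero_le _)
      rw [← ENNReal.ofReal_natCast]
      exact ENNReal.ofReal_le_ofReal (by linarith)
    · rw [mean_pure]
      obtain ⟨hY, s, hRs, hsmall, -⟩ := hs
      have h1 := hc.some_le (Y / 1 * ((R.map (prefixWeight I.G I.A P.k)).sum : ℕ)) R hR
      have h4 : (cost ⟨some (Y / 1 * ((R.map (prefixWeight I.G I.A P.k)).sum : ℕ)),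
        1 + countTime I R, countQueries I R⟩ : ℝ) ≤ 1 + R.length * x := by exact_mod_cast h1
      have h5 : (R.map (extCount I.G 0)).sum = R.length := by
        simp [extCount]
      have h6 : (R.length : ℝ) ≤ 1 + 2 * P.κ (P.k - 1) * (Y * R.length) := by
        have h7 : 0 ≤ 2 * P.κ (P.k - 1) * (Y * R.length) := by positivity
        rcases hsmall with h8 | h8
        · have : (R.length : ℝ) ≤ 1 := by exact_mod_cast hRs.trans h8
          linarith
        · have := mul_le_mul_of_nonneg_right h8 (Nat.cast_nonneg (α := ℝ) R.length)
          linarith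
      have h7 : (R.length : ℝ) * x ≤ (1 + 2 * P.κ (P.k - 1) * (Y * R.length)) * x := by gcongr
      rw [h5, ← ENNReal.ofReal_natCast R.length, ← ENNReal.ofReal_mul hY,
        ← ENNReal.ofReal_mul (by positivity), ← ENNReal.ofReal_add (by positivity) (by positivity),
        ← ENNReal.ofReal_natCast]
      exact ENNReal.ofReal_le_ofReal (by linarith)
  | succ r ih =>
    have hlim := sizeLimit_nonneg hP hα hm t
    have hloop := loopCost_pos hP hα hm r (t + 1)
    rw [process, loopCost]
    split_ifs with h
    · rw [mean_pure]
      refine le_trans ?_ le_self_add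
      have h1 : (cost ⟨none, R.length * (1 + 2 * t) + 1, R.length * t⟩ : ℝ) ≤
          ((R.length * (1 + 2 * t) + 1 : ℕ) : ℝ) := by
        exact_mod_cast hc.none_le _ _ (by nlinarith [Nat.zero_le (R.length * t)])
      have h2 := loop_abort_le (a := R.length) (t := t) hlim hloop.le
      have hx : (0 : ℝ) ≤ x := Nat.cast_nonneg _
      rw [← ENNReal.ofReal_natCast]
      exact ENNReal.ofReal_le_ofReal (by linarith)
    · rw [mean_bind]
      calc _ ≤ mean (iidList (stepLaw I R) (nextSize I P t R Y)) (fun l =>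
            ENNReal.ofReal (R.length * (4 * t + 3) +
              (1 + (P.sizeLimit t + 1) * (7 * t + 11) + loopCost P r (t + 1)) + x) +
            ENNReal.ofReal (2 * P.κ (P.k - 1) * x) *
              (ENNReal.ofReal (nextScale I P t R Y) *
                (l.reduceOption.map (extCount I.G r)).sum)) := by
            refine mean_mono fun l hl => ?_
            have h1 := ih (t + 1) (by omega) (hR.reduceOption hl) (sized_next hs.1 hl)
            have h3 := loop_step (a := R.length) (t := t) (w := loopCost P r (t + 1))
              (length_reduceOption_of_mem hl) (le_of_not_exceeds hlim h)
            rw [mean_map]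
            refine (mean_mono (g := fun o => ((R.length * (1 + 2 * t) + 1 +
              (R.length * (1 + 2 * t) + (R.length + nextSize I P t R Y +
                nextSize I P t R Y * (3 * t + 3))) : ℕ) : ℝ≥0∞) + (cost o : ℝ≥0∞))
              fun o _ => ?_).trans ?_
            · exact_mod_cast hc.charge_le _ _ o queries_le_time
            · rw [mean_add, mean_const]
              refine (add_le_add le_rfl h1).trans ?_
              rw [← add_assoc, ← ENNReal.ofReal_natCast, ← ENNReal.ofReal_add (Nat.cast_nonneg _)
                (by positivity)]
              refine add_le_add (ENNReal.ofReal_le_ofReal ?_) le_rfl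
              linarith
        _ ≤ _ := by
            rw [mean_add, mean_const, mean_const_mul]
            refine add_le_add le_rfl (mul_le_mul' le_rfl ?_)
            exact mean_step_le hR hs.1 _

theorem nextSize_zero_le (hP : P.Valid) :
    (nextSize I P 0 [[]] 1 : ℝ) ≤ P.κ 0 * n + 1 := by
  have h := hP.κ_nonneg 0
  rw [nextSize, totalDeg_singleton_nil, one_mul]
  exact (Nat.ceil_lt_add_one (by positivity)).le

theorem approxLaw_cost_le (hP : P.Valid) (hα : 0 ≤ P.α) (hm : 0 ≤ P.mt)
    {cost : Outcome ℝ → ℕ} {x : ℕ} (hc : IsCost I P cost x) (up : Bool)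
    {o : Outcome ℝ} (ho : o ∈ (approxLaw I P up).support) :
    (cost o : ℝ) ≤ 8 * (P.κ 0 * n + 1) + loopCost P (P.k - 1) 1 +
      (P.finalLimit (numCliques I.G P.k) + 1) * x := by
  have hk := hP.two_le_k
  rw [approxLaw_eq_process] at ho
  obtain ⟨l, hl, ho⟩ := (PMF.mem_support_bind_iff _ _ _).1 ho
  obtain ⟨o', ho', rfl⟩ := (PMF.mem_support_map_iff _ _ _).1 ho
  have h1 := cost_le_of_mem_support hP hα hm hc up _ (P.k - 1) 1 (by omega)
    ((isLevel_zero I).reduceOption hl) _ ho'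
  have h2 := Nat.cast_le (α := ℝ).2 (hc.charge_le (nextSize I P 0 [[]] 1) 0 o' (Nat.zero_le _))
  rw [Nat.cast_add] at h2
  have h3 := Nat.cast_le (α := ℝ).2 (length_reduceOption_of_mem hl)
  have h4 := nextSize_zero_le (I := I) hP
  push_cast at h1
  linarith

theorem mean_approxLaw_cost_le (hP : P.Valid) (hα : 0 ≤ P.α) (hm : 0 ≤ P.mt)
    {cost : Outcome ℝ → ℕ} {x : ℕ} (hc : IsCost I P cost x) (up : Bool) :
    mean (approxLaw I P up) (fun o => (cost o : ℝ≥0∞)) ≤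
      ENNReal.ofReal (8 * (P.κ 0 * n + 1) + loopCost P (P.k - 1) 1 + x +
        2 * P.κ (P.k - 1) * x * (P.k ! * numCliques I.G P.k)) := by
  have hk := hP.two_le_k
  have hκ := hP.κ_nonneg (P.k - 1)
  have hκ0 := hP.κ_nonneg 0
  have hloop := loopCost_pos hP hα hm (P.k - 1) 1
  rw [approxLaw_eq_process, mean_bind]
  calc _ ≤ mean (iidList (stepLaw I [[]]) (nextSize I P 0 [[]] 1)) (fun l =>
        ENNReal.ofReal (8 * (P.κ 0 * n + 1) + loopCost P (P.k - 1) 1 + x) +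
          ENNReal.ofReal (2 * P.κ (P.k - 1) * x) *
            (ENNReal.ofReal (nextScale I P 0 [[]] 1) *
              (l.reduceOption.map (extCount I.G (P.k - 1))).sum)) := by
        refine mean_mono fun l hl => ?_
        have h1 := mean_cost_le hP hα hm hc up (numCliques I.G P.k) (P.k - 1) 1 (by omega)
          ((isLevel_zero I).reduceOption hl) (sized_next zero_le_one hl)
        have h3 := Nat.cast_le (α := ℝ).2 (length_reduceOption_of_mem hl)
        have h4 := nextSize_zero_le (I := I) hP
        rw [mean_map]
        refine (mean_mono (g := fun o => (nextSize I P 0 [[]] 1 : ℝ≥0∞) + (cost o : ℝ≥0∞))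
          fun o _ => ?_).trans ?_
        · exact_mod_cast hc.charge_le _ _ o (Nat.zero_le _)
        · rw [mean_add, mean_const]
          refine (add_le_add le_rfl h1).trans ?_
          rw [← add_assoc, ← ENNReal.ofReal_natCast, ← ENNReal.ofReal_add (Nat.cast_nonneg _)
            (by positivity)]
          refine add_le_add (ENNReal.ofReal_le_ofReal ?_) le_rfl
          push_cast
          linarith
    _ ≤ ENNReal.ofReal (8 * (P.κ 0 * n + 1) + loopCost P (P.k - 1) 1 + x) +
          ENNReal.ofReal (2 * P.κ (P.k - 1) * x) * (P.k ! * numCliques I.G P.k : ℕ) := by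
        rw [mean_add, mean_const, mean_const_mul]
        refine add_le_add le_rfl (mul_le_mul' le_rfl ?_)
        refine (mean_step_le (isLevel_zero I) zero_le_one _).trans ?_
        rw [ENNReal.ofReal_one, one_mul, List.map_singleton, List.sum_singleton, extSum_nil,
          sum_extCount, show 1 + (P.k - 1) = P.k by omega]
        exact_mod_cast card_orderedCliques_le I.G P.k
    _ = _ := by
        rw [← ENNReal.ofReal_natCast, ← ENNReal.ofReal_mul (by positivity),
          ← ENNReal.ofReal_add (by positivity) (by positivity)]
        push_cast
        rfl

end Cost

/-! ### Arithmetic of the complexity bounds -/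

section Bounds

/-- This estimate turns the powers of `k!` and the additional factors `k` of the costs into powers
of `k ^ k`. -/
theorem mul_factorial_le {k : ℕ} (hk : 1 ≤ k) : k * k ! ≤ k ^ k := by
  have h : ∀ i, i + 1 ≤ k → k * (i + 1)! ≤ k ^ (i + 1) := by
    intro i
    induction i with
    | zero => simp
    | succ i ih =>
      intro hi
      rw [Nat.factorial_succ, pow_succ]
      calc k * ((i + 1 + 1) * (i + 1)!) = k * (i + 1)! * (i + 1 + 1) := by ring
        _ ≤ k ^ (i + 1) * k := Nat.mul_le_mul (ih (by omega)) hi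
  obtain ⟨i, rfl⟩ : ∃ i, k = i + 1 := ⟨k - 1, by omega⟩
  exact h i le_rfl

theorem sq_le_three_pow (k : ℕ) : k ^ 2 ≤ 3 ^ k := by
  induction k with
  | zero => simp
  | succ k ih =>
    rw [pow_succ 3]
    rcases Nat.lt_or_ge k 2 with h | h
    · interval_cases k <;> simp
    · nlinarith

variable {P : Params}

/-- `ln(k / δ) / ε²` -/
def Params.ell (P : Params) : ℝ := Real.log (P.k / P.δ) / P.ε ^ 2

theorem log_two_le (hP : P.Valid) : Real.log 2 ≤ Real.log (P.k / P.δ) := by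
  have hδ := hP.δ_pos
  refine Real.log_le_log two_pos ((le_div_iff₀ hδ).2 ?_)
  nlinarith [hP.two_le_cast, hP.δ_lt]

theorem ell_pos (hP : P.Valid) : 0 < P.ell :=
  div_pos ((Real.log_pos one_lt_two).trans_le (log_two_le hP)) (pow_pos hP.ε_pos 2)

/-- The factor `3 · 4` comes from `K` and `ln (6 k / δ) ≤ 4 ln (k / δ)`, and `4 k²` from `γ⁻²`. -/
theorem K_le (hP : P.Valid) : P.K ≤ 48 * (P.k : ℝ) ^ 2 * P.ell := by
  have hk := hP.k_pos
  have hδ := hP.δ_pos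
  have hε := hP.ε_pos
  have h1 : Real.log (2 / P.β) = Real.log 6 + Real.log (P.k / P.δ) := by
    rw [← Real.log_mul (by norm_num) (by positivity), Params.β]
    congr 1
    field_simp
    norm_num
  have h2 : Real.log 6 ≤ 3 * Real.log 2 := by
    have h3 : (3 : ℝ) * Real.log 2 = Real.log (2 ^ 3) := by
      rw [Real.log_pow]
      norm_num
    rw [h3]
    exact Real.log_le_log (by norm_num) (by norm_num)
  have h4 : Real.log (2 / P.β) ≤ 4 * Real.log (P.k / P.δ) := by
    rw [h1]
    linarith [log_two_le hP]
  calc P.K ≤ 3 * (4 * Real.log (P.k / P.δ)) / P.γ ^ 2 := by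
        rw [Params.K]
        gcongr
    _ = _ := by
        rw [Params.γ, Params.ell]
        field_simp
        ring

theorem costBound_eq (n nk e c : ℕ) : costBound P n nk e c =
    (n * P.τ 1 / P.nt + (P.k : ℝ) ^ (3 * P.k) / P.δ ^ (2 * P.k) * (P.mt / P.nt)
        * ∑ t ∈ Finset.Icc 2 P.k, P.α ^ (t - 2) * P.τ t
      + (P.k : ℝ) ^ (e * P.k) / P.δ ^ P.k * (nk / P.nt) * P.τ P.k * c)
    * (3 ^ P.k * P.ell) + ((P.k : ℝ) ^ 2 + P.k * P.k ! * c) := by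
  rw [costBound, Params.ell, ← mul_div_assoc (3 ^ P.k : ℝ)]

theorem K_le_three_pow (hP : P.Valid) : P.K ≤ 48 * (3 ^ P.k * P.ell) := by
  have h : ((P.k : ℝ)) ^ 2 ≤ 3 ^ P.k := by exact_mod_cast sq_le_three_pow P.k
  have hell := ell_pos hP
  calc P.K ≤ 48 * (P.k : ℝ) ^ 2 * P.ell := K_le hP
    _ ≤ 48 * 3 ^ P.k * P.ell := by gcongr
    _ = _ := by ring

/-- The cost of the first sample. -/
theorem first_le (hP : P.Valid) (n : ℕ) :
    8 * (P.κ 0 * n + 1) ≤ 1536 * (n * P.τ 1 / P.nt * (3 ^ P.k * P.ell)) + 2 * (P.k : ℝ) ^ 2 := by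
  have h1 := hP.κ_le (t := 0) (by omega)
  have h2 := K_le_three_pow hP
  have hnt := hP.nt_pos
  have hτ := hP.τ_nonneg 1
  have hk := hP.two_le_cast
  have h3 : P.κ 0 * n ≤ 192 * (n * P.τ 1 / P.nt * (3 ^ P.k * P.ell)) := by
    calc P.κ 0 * n ≤ 4 * P.τ 1 * (48 * (3 ^ P.k * P.ell)) / P.nt * n := by
          refine mul_le_mul_of_nonneg_right (h1.trans ?_) (Nat.cast_nonneg _)
          gcongr
      _ = _ := by
          field_simp
          ring
  nlinarith

theorem loopCost_le (hP : P.Valid) (hα : 0 ≤ P.α) (hm : 0 ≤ P.mt) (r t : ℕ)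
    (htr : t + r ≤ P.k) :
    loopCost P r t ≤ 1 + r * (1 + 18 * P.k) +
      18 * P.k * ∑ j ∈ Finset.range r, P.sizeLimit (t + j) := by
  induction r generalizing t with
  | zero => simp [loopCost]
  | succ r ih =>
    have h1 := ih (t + 1) (by omega)
    have h2 := sizeLimit_nonneg hP hα hm t
    have h3 : (7 * t + 11 : ℝ) ≤ 18 * P.k := by
      have h4 : (t : ℝ) + 1 ≤ P.k := by exact_mod_cast (by omega : t + 1 ≤ P.k)
      linarith [hP.two_le_cast]
    have h5 : (P.sizeLimit t + 1) * (7 * t + 11) ≤ (P.sizeLimit t + 1) * (18 * P.k) := by gcongr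
    have h6 : ∑ j ∈ Finset.range (r + 1), P.sizeLimit (t + j) =
        P.sizeLimit t + ∑ j ∈ Finset.range r, P.sizeLimit (t + 1 + j) := by
      rw [Finset.sum_range_succ', add_comm]
      congr 1
      exact Finset.sum_congr rfl fun j _ => by rw [Nat.add_assoc, Nat.add_comm j]
    rw [loopCost, h6]
    push_cast
    linarith

theorem inv_β_eq : 1 / P.β = 3 * P.k / P.δ := by
  rw [Params.β, one_div_div]

/-- The cost of one iteration.  Of the factors `k`, one is contributed by the length of the ordered
cliques and two by `K`; together with `(k!)²` and `β⁻ᵗ` they make up `k ^ (3 k)`. -/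
theorem sizeLimit_le (hP : P.Valid) (hα : 0 ≤ P.α) (hm : 0 ≤ P.mt) {j : ℕ}
    (hj : j + 2 ≤ P.k) :
    P.k * P.sizeLimit (1 + j) ≤
      192 * ((P.k : ℝ) ^ (3 * P.k) / P.δ ^ (2 * P.k) * (P.mt / P.nt)
        * (P.α ^ j * P.τ (j + 2)) * (3 ^ P.k * P.ell)) := by
  have hk := hP.two_le_cast
  have hδ := hP.δ_pos
  have hnt := hP.nt_pos
  have hβ := hP.β_pos
  have hell := ell_pos hP
  have hτ := hP.τ_nonneg (j + 2)
  have hkk : (P.k : ℝ) * P.k ! ≤ (P.k : ℝ) ^ P.k := by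
    exact_mod_cast mul_factorial_le (by linarith [hP.two_le_k])
  have h1 : P.k * ((P.k ! : ℝ) ^ 2 * P.K / P.β ^ (1 + j)) ≤
      48 * ((P.k : ℝ) ^ (3 * P.k) / P.δ ^ (2 * P.k) * (3 ^ P.k * P.ell)) := by
    have h2 : 1 / P.β ^ (1 + j) ≤ (3 * P.k) ^ P.k / P.k / P.δ ^ (2 * P.k) := by
      have h3 : 1 ≤ 3 * (P.k : ℝ) / P.δ := (one_le_div hδ).2 (by linarith [hP.δ_lt])
      obtain ⟨i, hi⟩ : ∃ i, P.k = i + 1 := ⟨P.k - 1, by omega⟩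
      calc 1 / P.β ^ (1 + j) = (3 * P.k / P.δ) ^ (1 + j) := by
            rw [← inv_β_eq, one_div_pow]
        _ ≤ (3 * P.k / P.δ) ^ i := pow_le_pow_right₀ h3 (by omega)
        _ = (3 * P.k) ^ i / P.δ ^ i := div_pow _ _ _
        _ ≤ (3 * (3 * P.k) ^ i) / P.δ ^ (2 * P.k) := by
            have h4 : P.δ ^ (2 * P.k) ≤ P.δ ^ i :=
              pow_le_pow_of_le_one hδ.le hP.δ_lt.le (by omega)
            have h5 : (0 : ℝ) ≤ (3 * P.k) ^ i := by positivity
            gcongr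
            linarith
        _ = _ := by
            congr 1
            rw [eq_div_iff (by positivity)]
            nth_rewrite 4 [hi]
            rw [pow_succ]
            ring
    calc P.k * ((P.k ! : ℝ) ^ 2 * P.K / P.β ^ (1 + j))
        = P.k * (P.k ! : ℝ) ^ 2 * P.K * (1 / P.β ^ (1 + j)) := by ring
      _ ≤ P.k * (P.k ! : ℝ) ^ 2 * (48 * (P.k : ℝ) ^ 2 * P.ell) *
          ((3 * P.k) ^ P.k / P.k / P.δ ^ (2 * P.k)) := by
          have := K_le hP
          gcongr
      _ = 48 * ((P.k * P.k ! : ℝ) ^ 2 * P.k ^ P.k / P.δ ^ (2 * P.k) * (3 ^ P.k * P.ell)) := by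
          rw [mul_pow 3]
          field_simp
      _ ≤ 48 * (((P.k : ℝ) ^ P.k) ^ 2 * P.k ^ P.k / P.δ ^ (2 * P.k) * (3 ^ P.k * P.ell)) := by
          gcongr
      _ = _ := by
          rw [← pow_succ, ← pow_mul, mul_comm P.k]
  calc P.k * P.sizeLimit (1 + j) = 4 * (P.mt / P.nt) * (P.α ^ j * P.τ (j + 2)) *
        (P.k * ((P.k ! : ℝ) ^ 2 * P.K / P.β ^ (1 + j))) := by
        rw [Params.sizeLimit, Nat.add_sub_cancel_left, show 1 + j + 1 = j + 2 by ring]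
        ring
    _ ≤ 4 * (P.mt / P.nt) * (P.α ^ j * P.τ (j + 2)) *
        (48 * ((P.k : ℝ) ^ (3 * P.k) / P.δ ^ (2 * P.k) * (3 ^ P.k * P.ell))) := by
        gcongr
    _ = _ := by ring

theorem sum_Icc_two (k : ℕ) (f : ℕ → ℝ) :
    ∑ t ∈ Finset.Icc 2 k, f t = ∑ j ∈ Finset.range (k - 1), f (j + 2) := by
  rw [Finset.range_eq_Ico, Finset.sum_Ico_add']
  refine Finset.sum_congr ?_ fun _ _ => rfl
  ext t
  simp only [Finset.mem_Icc, Finset.mem_Ico]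
  omega

/-- The cost of the main loop. -/
theorem loop_le (hP : P.Valid) (hα : 0 ≤ P.α) (hm : 0 ≤ P.mt) :
    loopCost P (P.k - 1) 1 ≤ 3456 * ((P.k : ℝ) ^ (3 * P.k) / P.δ ^ (2 * P.k) * (P.mt / P.nt)
        * (∑ t ∈ Finset.Icc 2 P.k, P.α ^ (t - 2) * P.τ t) * (3 ^ P.k * P.ell)) +
      20 * (P.k : ℝ) ^ 2 := by
  have hk := hP.two_le_k
  have h1 := loopCost_le hP hα hm (P.k - 1) 1 (by omega)
  have h2 : P.k * ∑ j ∈ Finset.range (P.k - 1), P.sizeLimit (1 + j) ≤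
      192 * ((P.k : ℝ) ^ (3 * P.k) / P.δ ^ (2 * P.k) * (P.mt / P.nt)
        * (∑ t ∈ Finset.Icc 2 P.k, P.α ^ (t - 2) * P.τ t) * (3 ^ P.k * P.ell)) := by
    rw [sum_Icc_two, Finset.mul_sum, Finset.mul_sum, Finset.sum_mul, Finset.mul_sum]
    refine Finset.sum_le_sum fun j hj => ?_
    rw [Nat.add_sub_cancel]
    exact sizeLimit_le hP hα hm (by have := Finset.mem_range.1 hj; omega)
  have h3 : ((P.k - 1 : ℕ) : ℝ) = P.k - 1 := by
    rw [Nat.cast_sub (by omega), Nat.cast_one]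
  rw [h3] at h1
  have h4 := hP.two_le_cast
  nlinarith

/-- The cost of the last part on any run. -/
theorem finalLimit_mul_le (hP : P.Valid) (nk : ℕ) {x c : ℕ} (hx : x ≤ 5 * (P.k * P.k ! * c)) :
    (P.finalLimit nk + 1) * x ≤ 960 * ((P.k : ℝ) ^ (4 * P.k) / P.δ ^ P.k * (nk / P.nt) *
      P.τ P.k * c * (3 ^ P.k * P.ell)) + 5 * (P.k * P.k ! * c : ℝ) := by
  have hk := hP.two_le_cast
  have hδ := hP.δ_pos
  have hnt := hP.nt_pos
  have hβ := hP.β_pos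
  have hell := ell_pos hP
  have hτ := hP.τ_nonneg P.k
  have hlim := finalLimit_nonneg hP nk
  have hx' : (x : ℝ) ≤ 5 * (P.k * P.k ! * c) := by exact_mod_cast hx
  have hkk : (P.k : ℝ) * P.k ! ≤ (P.k : ℝ) ^ P.k := by
    exact_mod_cast mul_factorial_le (by linarith [hP.two_le_k])
  have h1 : (P.k : ℝ) * P.k ! * P.finalLimit nk ≤ 192 * ((P.k : ℝ) ^ (4 * P.k) / P.δ ^ P.k *
      (nk / P.nt) * P.τ P.k * (3 ^ P.k * P.ell)) := by
    calc (P.k : ℝ) * P.k ! * P.finalLimit nk = 4 * (P.k * (P.k ! : ℝ) ^ 3 * P.K *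
          (1 / P.β) ^ P.k * (nk / P.nt) * P.τ P.k) := by
          rw [Params.finalLimit, one_div_pow]
          ring
      _ ≤ 4 * (P.k * (P.k ! : ℝ) ^ 3 * (48 * (P.k : ℝ) ^ 2 * P.ell) *
          (3 * P.k / P.δ) ^ P.k * (nk / P.nt) * P.τ P.k) := by
          have := K_le hP
          rw [inv_β_eq]
          gcongr
      _ = 192 * ((P.k * P.k ! : ℝ) ^ 3 * P.k ^ P.k / P.δ ^ P.k *
          (nk / P.nt) * P.τ P.k * (3 ^ P.k * P.ell)) := by
          rw [div_pow, mul_pow 3]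
          ring
      _ ≤ 192 * (((P.k : ℝ) ^ P.k) ^ 3 * P.k ^ P.k / P.δ ^ P.k *
          (nk / P.nt) * P.τ P.k * (3 ^ P.k * P.ell)) := by
          gcongr
      _ = _ := by
          rw [← pow_succ, ← pow_mul, mul_comm P.k]
  calc (P.finalLimit nk + 1) * x ≤ (P.finalLimit nk + 1) * (5 * (P.k * P.k ! * c)) := by gcongr
    _ = 5 * c * (P.k * P.k ! * P.finalLimit nk) + 5 * (P.k * P.k ! * c) := by ring
    _ ≤ 5 * c * (192 * ((P.k : ℝ) ^ (4 * P.k) / P.δ ^ P.k *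
      (nk / P.nt) * P.τ P.k * (3 ^ P.k * P.ell))) + 5 * (P.k * P.k ! * c) := by gcongr
    _ = _ := by ring

/-- The expected cost of the last part. -/
theorem mean_final_le (hP : P.Valid) (nk : ℕ) {x c : ℕ} (hx : x ≤ 5 * (P.k * P.k ! * c)) :
    x + 2 * P.κ (P.k - 1) * x * (P.k ! * nk) ≤
      1920 * ((P.k : ℝ) ^ (3 * P.k) / P.δ ^ P.k * (nk / P.nt) *
      P.τ P.k * c * (3 ^ P.k * P.ell)) + 5 * (P.k * P.k ! * c : ℝ) := by
  have hk := hP.two_le_cast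
  have hk2 := hP.two_le_k
  have hδ := hP.δ_pos
  have hnt := hP.nt_pos
  have hell := ell_pos hP
  have hτ := hP.τ_nonneg P.k
  have hκ := hP.κ_le (t := P.k - 1) (by omega)
  rw [Nat.sub_add_cancel (by omega)] at hκ
  have hκ0 := hP.κ_nonneg (P.k - 1)
  have hK : 0 ≤ P.K := by linarith [hP.one_le_K]
  have hx' : (x : ℝ) ≤ 5 * (P.k * P.k ! * c) := by exact_mod_cast hx
  have hkk : (P.k : ℝ) * P.k ! ≤ (P.k : ℝ) ^ P.k := by
    exact_mod_cast mul_factorial_le (by omega)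
  have hkpow : (P.k : ℝ) ≤ (P.k : ℝ) ^ P.k := le_self_pow₀ (by linarith) (by omega)
  have h1 : 2 * P.κ (P.k - 1) * x * (P.k ! * nk) ≤ 1920 * ((P.k : ℝ) ^ (3 * P.k) / P.δ ^ P.k *
      (nk / P.nt) * P.τ P.k * c * (3 ^ P.k * P.ell)) := by
    calc 2 * P.κ (P.k - 1) * x * (P.k ! * nk)
        ≤ 2 * (4 * P.τ P.k * (48 * (P.k : ℝ) ^ 2 * P.ell) / P.nt) * (5 * (P.k * P.k ! * c)) *
            (P.k ! * nk) := by
          have hKle := K_le hP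
          have : P.κ (P.k - 1) ≤ 4 * P.τ P.k * (48 * (P.k : ℝ) ^ 2 * P.ell) / P.nt :=
            hκ.trans (by gcongr)
          gcongr
      _ = 1920 * ((P.k * (P.k * P.k ! : ℝ) ^ 2) / 1 * (nk / P.nt) * P.τ P.k * c *
            (1 * P.ell)) := by ring
      _ ≤ 1920 * (((P.k : ℝ) ^ P.k * ((P.k : ℝ) ^ P.k) ^ 2) / P.δ ^ P.k * (nk / P.nt) *
            P.τ P.k * c * (3 ^ P.k * P.ell)) := by
          have h3 : P.δ ^ P.k ≤ 1 := pow_le_one₀ hδ.le hP.δ_lt.le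
          have h4 : (1 : ℝ) ≤ 3 ^ P.k := one_le_pow₀ (by norm_num)
          gcongr
      _ = _ := by
          rw [← pow_succ', ← pow_mul, mul_comm P.k]
  linarith

variable {n : ℕ} {I : Instance n}

/-- The cost of a run is bounded by the complexity bound, with exponent `4` on every run and with
exponent `3` in expectation. -/
theorem cost_bounds (hP : P.Valid) (hα : 0 ≤ P.α) (hm : 0 ≤ P.mt) {cost : Outcome ℝ → ℕ}
    {x c : ℕ} (hc : IsCost I P cost x) (hx : x ≤ 5 * (P.k * P.k ! * c)) (up : Bool) :
    (∀ o ∈ (approxLaw I P up).support,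
      (cost o : ℝ) ≤ 4000 * costBound P n (numCliques I.G P.k) 4 c) ∧
    ∑' o, approxLaw I P up o * (cost o : ℝ≥0∞) ≤
      ENNReal.ofReal (4000 * costBound P n (numCliques I.G P.k) 3 c) := by
  have h1 := first_le hP n
  have h2 := loop_le hP hα hm
  have hδ := hP.δ_pos
  have hnt := hP.nt_pos
  have hell := ell_pos hP
  have hτ := hP.τ_nonneg
  have hg1 : 0 ≤ n * P.τ 1 / P.nt * (3 ^ P.k * P.ell) := by
    have := hτ 1
    positivity
  have hg2 : 0 ≤ (P.k : ℝ) ^ (3 * P.k) / P.δ ^ (2 * P.k) * (P.mt / P.nt)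
      * (∑ t ∈ Finset.Icc 2 P.k, P.α ^ (t - 2) * P.τ t) * (3 ^ P.k * P.ell) := by
    have : 0 ≤ ∑ t ∈ Finset.Icc 2 P.k, P.α ^ (t - 2) * P.τ t :=
      Finset.sum_nonneg fun t _ => mul_nonneg (pow_nonneg hα _) (hτ t)
    positivity
  have hg3 : ∀ e : ℕ, 0 ≤ (P.k : ℝ) ^ (e * P.k) / P.δ ^ P.k *
      ((numCliques I.G P.k : ℕ) / P.nt) * P.τ P.k * c * (3 ^ P.k * P.ell) := fun e => by
    have := hτ P.k
    positivity
  have hg4 : (0 : ℝ) ≤ (P.k : ℝ) ^ 2 := by positivity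
  have hg5 : (0 : ℝ) ≤ P.k * P.k ! * c := by positivity
  refine ⟨fun o ho => ?_, ?_⟩
  · have h3 := approxLaw_cost_le hP hα hm hc up ho
    have h4 := finalLimit_mul_le hP (numCliques I.G P.k) hx
    have hg := hg3 4
    rw [costBound_eq]
    linarith
  · refine (mean_approxLaw_cost_le hP hα hm hc up).trans (ENNReal.ofReal_le_ofReal ?_)
    have h4 := mean_final_le hP (numCliques I.G P.k) hx
    have hg := hg3 3
    rw [costBound_eq]
    linarith

end Bounds

end CliqueApprox

end

theorem mainTheorem4 :
    -- part 1: correctness for `ñ ≤ n_k`, with thresholds as they are or rounded up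
    (∀ (n : ℕ) (I : CliqueApprox.Instance n) (P : CliqueApprox.Params) (up : Bool),
      2 ≤ P.k → 0 < P.ε → P.ε < 1 → 0 < P.δ → P.δ < 1 → 0 < P.nt →
      (CliqueApprox.arboricity I.G : ℝ) ≤ P.α → (∀ t, 0 ≤ P.τ t) →
      CliqueApprox.IsGood I.G I.A P.k P.ε P.τ →
      (CliqueApprox.numEdges I.G : ℝ) / 2 ≤ P.mt →
      P.nt ≤ (CliqueApprox.numCliques I.G P.k : ℝ) →
      ENNReal.ofReal (1 - P.δ) ≤ (CliqueApprox.approxLaw I P up).toOuterMeasure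
        {o | ∃ x : ℝ, o.value = some x ∧
          (1 - P.ε) * (CliqueApprox.numCliques I.G P.k : ℝ) ≤ x ∧
          x ≤ (1 + P.ε) * (CliqueApprox.numCliques I.G P.k : ℝ)}) ∧
    -- part 2: correctness for `ñ > n_k`
    (∀ (n : ℕ) (I : CliqueApprox.Instance n) (P : CliqueApprox.Params),
      2 ≤ P.k → 0 < P.ε → P.ε < 1 → 0 < P.δ → P.δ < 1 → 0 < P.nt →
      (CliqueApprox.arboricity I.G : ℝ) ≤ P.α → (∀ t, 0 ≤ P.τ t) →
      CliqueApprox.IsBounded I.G I.A P.k P.τ →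
      (CliqueApprox.numEdges I.G : ℝ) / 2 ≤ P.mt →
      (CliqueApprox.numCliques I.G P.k : ℝ) < P.nt →
      -- thresholds rounded up: a value is returned, and it is as claimed
      ENNReal.ofReal (1 - P.δ) ≤ (CliqueApprox.approxLaw I P true).toOuterMeasure
        {o | ∃ x : ℝ, o.value = some x ∧ x ≤ (1 + P.ε) * P.nt} ∧
      -- thresholds as they are: no value other than claimed is returned
      ENNReal.ofReal (1 - P.δ) ≤ (CliqueApprox.approxLaw I P false).toOuterMeasure
        {o | ∀ x : ℝ, o.value = some x → x ≤ (1 + P.ε) * P.nt}) ∧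
    -- part 3: running time and query complexity, on every run and in expectation
    (∃ c : ℝ, 0 < c ∧
      ∀ (n : ℕ) (I : CliqueApprox.Instance n) (P : CliqueApprox.Params) (up : Bool) (ρ q : ℕ),
      2 ≤ P.k → 0 < P.ε → P.ε < 1 → 0 < P.δ → P.δ < 1 → 0 < P.nt →
      (CliqueApprox.arboricity I.G : ℝ) ≤ P.α → (∀ t, 0 ≤ P.τ t) → 0 ≤ P.mt →
      1 ≤ ρ → (∀ T, I.oracleTime T ≤ ρ) → (∀ T, I.oracleQueries T ≤ q) →
      (∀ o ∈ (CliqueApprox.approxLaw I P up).support,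
        (o.time : ℝ) ≤ c * CliqueApprox.costBound P n (CliqueApprox.numCliques I.G P.k) 4 ρ ∧
        (o.queries : ℝ) ≤ c * CliqueApprox.costBound P n (CliqueApprox.numCliques I.G P.k) 4 q) ∧
      ∑' o, CliqueApprox.approxLaw I P up o * (o.time : ENNReal) ≤ ENNReal.ofReal
        (c * CliqueApprox.costBound P n (CliqueApprox.numCliques I.G P.k) 3 ρ) ∧
      ∑' o, CliqueApprox.approxLaw I P up o * (o.queries : ENNReal) ≤ ENNReal.ofReal
        (c * CliqueApprox.costBound P n (CliqueApprox.numCliques I.G P.k) 3 q)) := by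
  -- `4000` is a round number above `3456`, the largest of the constants of the partial bounds
  refine ⟨?_, ?_, 4000, by norm_num, ?_⟩
  · intro n I P up hk hε hε1 hδ hδ1 hnt hα hτ hg hm hle
    exact CliqueApprox.approx_of_le up ⟨hk, hε, hε1, hδ, hδ1, hnt, hτ⟩ hα hg hm hle
  · intro n I P hk hε hε1 hδ hδ1 hnt hα hτ hb hm hlt
    have hP : P.Valid := ⟨hk, hε, hε1, hδ, hδ1, hnt, hτ⟩
    refine ⟨(CliqueApprox.approx_of_lt true hP hα hb hm hlt).trans
      (PMF.toOuterMeasure_mono _ ?_), (CliqueApprox.approx_of_lt false hP hα hb hm hlt).trans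
      (PMF.toOuterMeasure_mono _ ?_)⟩
    · rintro o ⟨⟨h1, h2⟩, -⟩
      obtain ⟨x, hx⟩ := Option.ne_none_iff_exists'.1 (h1 rfl)
      exact ⟨x, hx, h2 x hx⟩
    · rintro o ⟨⟨-, h2⟩, -⟩
      exact h2
  · intro n I P up ρ q hk hε hε1 hδ hδ1 hnt hα hτ hm hρ1 hρ hq
    have hP : P.Valid := ⟨hk, hε, hε1, hδ, hδ1, hnt, hτ⟩
    have hα0 : 0 ≤ P.α := (Nat.cast_nonneg _).trans hα
    have ht := CliqueApprox.cost_bounds hP hα0 hm (CliqueApprox.isCost_time I P hρ) (c := ρ) (by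
      have hf : 1 ≤ P.k.factorial := Nat.factorial_pos _
      have h1 : P.k ≤ P.k * ρ := Nat.le_mul_of_pos_right _ hρ1
      have h2 : P.k + 1 + (P.k + P.k * ρ) ≤ 4 * (P.k * ρ) := by omega
      have h3 := Nat.mul_le_mul_left P.k.factorial h2
      have h4 : 1 ≤ P.k.factorial * (P.k * ρ) := Nat.mul_pos hf (by omega)
      calc _ ≤ P.k.factorial * (P.k * ρ) + P.k.factorial * (4 * (P.k * ρ)) := by omega
        _ = _ := by ring) up
    have hqs := CliqueApprox.cost_bounds hP hα0 hm (CliqueApprox.isCost_queries I P hq) (c := q) (by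
      calc P.k.factorial * (P.k * q) = P.k * P.k.factorial * q := by ring
        _ ≤ _ := Nat.le_mul_of_pos_left _ (by norm_num)) up
    exact ⟨fun o ho => ⟨ht.1 o ho, hqs.1 o ho⟩, ht.2, hqs.2⟩
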